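/- **Setting.** For integers $p,q\ge 0$ let $\odot^{p}\mathbb C^4\otimes\wedge^{q}\mathbb C^4\subset\otimes^{p+q}\mathbb C^4$ be the space of tuples $\xi=(\xi^{A_1\dots A_q}_{B_1\dots B_p})$, with indices in $\{1,2,3,4\}$, that are symmetric in the subscripts and antisymmetric in the superscripts, with the inner product $\langle\xi,\zeta\rangle=\sum_{A,B}\xi^A_B\overline{\zeta^A_B}$. Fix an integer $k\ge 6$. For $l=0,\dots,4$ let $\mathscr V_l$ be the kernel of the contraction $$\mathscr C(\xi)^{A_1\dots A_{l-1}}_{B_1\dots B_{k-l-1}}=\sum_{C=1}^4\xi^{CA_1\dots A_{l-1}}_{B_1\dots B_{k-l-1}C}$$ on $\odot^{k-l}\mathbb C^4\otimes\wedge^l\mathbb C^4$ (so $\mathscr V_0=\odot^k\mathbb C^4$, and $\mathscr V_4=\{0\}$). Let $$(\nabla^{AB})=\begin{pmatrix}0&i\partial_0+\partial_5&\partial_3+i\partial_4&\partial_1+i\partial_2\\-i\partial_0-\partial_5&0&\partial_1-i\partial_2&-\partial_3+i\partial_4\\-\partial_3-i\partial_4&-\partial_1+i\partial_2&0&-i\partial_0+\partial_5\\-\partial_1-i\partial_2&\partial_3-i\partial_4&i\partial_0-\partial_5&0\end{pmatrix},\qquad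 \partial_j=\partial_{x^j},\ x=(x^0,\dots,x^5)\in\mathbb R^6,$$ and for $l=0,\dots,3$ let $\mathscr D_l:C^\infty(\mathbb R^6,\mathscr V_l)\to C^\infty(\mathbb R^6,\mathscr V_{l+1})$ be $$(\mathscr D_lf)^{A_1\dots A_{l+1}}_{B_2\dots B_{k-l}}=\sum_{B_1}\nabla^{B_1[A_1}f^{A_2\dots A_{l+1}]}_{B_1B_2\dots B_{k-l}},$$ where $[\dots]$ is antisymmetrization (the mean over all permutations, weighted with their signs). Let $\varphi(x)=|x|^2$, let $L^2_\varphi(\mathbb R^6,\mathscr V_l)$ be the Hilbert space of $\mathscr V_l$-valued functions with inner product $\langle f,h\rangle_\varphi=\int_{\mathbb R^6}\langle f,h\rangle e^{-\varphi}dx$ and norm $\|\cdot\|_\varphi$, and let $\Theta_l$ be the formal adjoint of $\mathscr D_l$ with respect to $\langle\cdot,\cdot\rangle_\varphi$. Then $\mathscr D_l$ also denotes the densely defined operator $L^2_\varphi(\mathbb R^6,\mathscr V_l)\to L^2_\varphi(\mathbb R^6,\mathscr V_{l+1})$ given by $\mathscr D_lf=u$ if $\langle u,g\rangle_\varphi=\langle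 f,\Theta_lg\rangle_\varphi$ for all $g\in C_0^\infty(\mathbb R^6,\mathscr V_{l+1})$; its domain consists of all $f$ for which such a $u\in L^2_\varphi$ exists. Let $\mathscr D_l^*$ be its Hilbert space adjoint, and let $$\Box_l=\mathscr D_{l-1}\mathscr D_{l-1}^*+\mathscr D_l^*\mathscr D_l\quad(l=1,2),\qquad \Box_3=\mathscr D_2\mathscr D_2^*,$$ with their natural domains. **Theorem.** For every integer $k\ge 6$ there is a constant $C>0$, depending only on $k$, such that the following holds. (1) For $l=1,2,3$ the operator $\Box_l$ has a bounded self-adjoint inverse $N_l$ on $L^2_\varphi(\mathbb R^6,\mathscr V_l)$ (that is, $N_l$ maps $L^2_\varphi(\mathbb R^6,\mathscr V_l)$ into $\mathrm{Dom}(\Box_l)$, $\Box_lN_lf=f$ for all $f$, and $N_l\Box_lu=u$ for all $u\in\mathrm{Dom}(\Box_l)$), and $\|N_lf\|_\varphi\le C\|f\|_\varphi$ for all $f\in L^2_\varphi(\mathbb R^6,\mathscr V_l)$. (2) Let $l\in\{0,1,2\}$ and $f\in L^2_\varphi(\mathbb R^6,\mathscr V_{l+1})$. Then $N_{l+1}f\in\mathrm{Dom}(\mathscr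 D_l^*)\cap\mathrm{Dom}(\mathscr D_{l+1})$ and $$\|\mathscr D_l^*N_{l+1}f\|_\varphi\le C\|f\|_\varphi,\qquad\|\mathscr D_{l+1}N_{l+1}f\|_\varphi\le C\|f\|_\varphi .$$ If moreover $f\in\mathrm{Dom}(\mathscr D_{l+1})$ and $\mathscr D_{l+1}f=0$ (which is automatic for $l=2$), then $\mathscr D_l^*N_{l+1}f$ is the canonical solution of $\mathscr D_lu=f$: it lies in $\mathrm{Dom}(\mathscr D_l)$, $\mathscr D_l(\mathscr D_l^*N_{l+1}f)=f$, and it is orthogonal to $\ker\mathscr D_l$. -/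

import Mathlib

open MeasureTheory
open scoped ContDiff ENNReal LinearPMap

noncomputable section

namespace Massless

/-- `⊗^p ℂ⁴ ⊗ ⊗^q ℂ⁴ = ⊗^(p+q) ℂ⁴` as the tuples `ξ (B, A) = ξ^{A₁…A_q}_{B₁…B_p}`, with the Hermitian
inner product `⟨ξ, ζ⟩ = ∑ ξ^A_B conj(ζ^A_B)` (sum over all index tuples). -/
abbrev Tensor (p q : ℕ) : Type :=
  EuclideanSpace ℂ ((Fin p → Fin 4) × (Fin q → Fin 4))

/-- `⊙^p ℂ⁴ ⊗ ∧^q ℂ⁴`: symmetric in the subscripts, antisymmetric in the superscripts. -/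
def symExt (p q : ℕ) : Submodule ℂ (Tensor p q) where
  carrier := {ξ | (∀ (σ : Equiv.Perm (Fin p)) (B : Fin p → Fin 4) (A : Fin q → Fin 4),
        ξ (fun i => B (σ i), A) = ξ (B, A)) ∧
      ∀ (σ : Equiv.Perm (Fin q)) (B : Fin p → Fin 4) (A : Fin q → Fin 4),
        ξ (B, fun i => A (σ i)) = ((Equiv.Perm.sign σ : ℤ) : ℂ) * ξ (B, A)}
  zero_mem' := by simp
  add_mem' := by
    rintro a b ⟨ha, ha'⟩ ⟨hb, hb'⟩
    refine ⟨fun σ B A => ?_, fun σ B A => ?_⟩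
    · simp [ha, hb]
    · simp [ha', hb', mul_add]
  smul_mem' := by
    rintro c a ⟨ha, ha'⟩
    refine ⟨fun σ B A => ?_, fun σ B A => ?_⟩
    · simp [ha]
    · simp [ha', mul_left_comm]

/-- The contraction
`𝒞(f)^{A₁…A_q}_{B₁…B_p} = ∑_C f^{C A₁…A_q}_{B₁…B_p C}`. -/
def contraction (p q : ℕ) : Tensor (p + 1) (q + 1) →ₗ[ℂ] Tensor p q where
  toFun ξ := WithLp.toLp 2 fun BA =>
    ∑ c : Fin 4, ξ (Fin.snoc (α := fun _ => Fin 4) BA.1 c, Fin.cons (α := fun _ => Fin 4) c BA.2)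
  map_add' a b := by ext BA; simp [Finset.sum_add_distrib]
  map_smul' c a := by ext BA; simp [Finset.mul_sum]

/-- The kernel of the contraction in `⊙^p ℂ⁴ ⊗ ∧^q ℂ⁴`. If `p = 0` or `q = 0` there is nothing to
contract. The space `𝒱_l` belonging to `k` is `kerC (k - l) l`. -/
def kerC : (p q : ℕ) → Submodule ℂ (Tensor p q)
  | p + 1, q + 1 => symExt (p + 1) (q + 1) ⊓ LinearMap.ker (contraction p q)
  | 0, q => symExt 0 q
  | p + 1, 0 => symExt (p + 1) 0

/-- The points of `ℝ⁶` as complex antisymmetric `4 × 4` matrices. -/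
def embed (x : EuclideanSpace ℝ (Fin 6)) : Matrix (Fin 4) (Fin 4) ℂ :=
  !![0, Complex.I * x 0 + x 5, x 3 + Complex.I * x 4, x 1 + Complex.I * x 2;
    -Complex.I * x 0 - x 5, 0, x 1 - Complex.I * x 2, -x 3 + Complex.I * x 4;
    -x 3 - Complex.I * x 4, -x 1 + Complex.I * x 2, 0, -Complex.I * x 0 + x 5;
    -x 1 - Complex.I * x 2, x 3 - Complex.I * x 4, Complex.I * x 0 - x 5, 0]

/-- The `j`-th unit vector of `ℝ⁶`. -/
def e (j : Fin 6) : EuclideanSpace ℝ (Fin 6) := EuclideanSpace.single j 1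

/-- The algebraic map
`ξ ↦ ∑_b M^{b [A₁} ξ^{A₂ … A_{q+1}]}_{b B₁ … B_p}`, where `[…]` is antisymmetrization, i.e. the mean
over all permutations, weighted with their signs. -/
def symbolAux (p q : ℕ) (M : Matrix (Fin 4) (Fin 4) ℂ) : Tensor (p + 1) q →ₗ[ℂ] Tensor p (q + 1) where
  toFun ξ := WithLp.toLp 2 fun BA =>
    ((q + 1).factorial : ℂ)⁻¹ * ∑ σ : Equiv.Perm (Fin (q + 1)), ((Equiv.Perm.sign σ : ℤ) : ℂ) *
      ∑ b : Fin 4, M b (BA.2 (σ 0)) *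
        ξ (Fin.cons (α := fun _ => Fin 4) b BA.1, fun i => BA.2 (σ i.succ))
  map_add' a b := by
    ext BA; simp [mul_add, Finset.sum_add_distrib]
  map_smul' c a := by
    ext BA
    simp only [PiLp.smul_apply, smul_eq_mul, RingHom.id_apply, Finset.mul_sum]
    refine Finset.sum_congr rfl fun σ _ => Finset.sum_congr rfl fun b _ => ?_
    ring

theorem kerC_le_symExt (p q : ℕ) : kerC p q ≤ symExt p q := by
  cases p <;> cases q <;> simp [kerC]

theorem mem_kerC_iff (p q : ℕ) (ξ : Tensor (p + 1) (q + 1)) :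
    ξ ∈ kerC (p + 1) (q + 1) ↔ ξ ∈ symExt (p + 1) (q + 1) ∧ ∀ B A, ∑ c : Fin 4,
      ξ (Fin.snoc (α := fun _ => Fin 4) B c, Fin.cons (α := fun _ => Fin 4) c A) = 0 := by
  simp only [kerC, Submodule.mem_inf, LinearMap.mem_ker]
  refine and_congr_right fun _ => ⟨fun h B A => ?_, fun h => ?_⟩
  · exact congrArg (fun η : Tensor p q => η (B, A)) h
  · ext BA; exact h BA.1 BA.2

theorem symbolAux_mem_symExt {p q : ℕ} (M : Matrix (Fin 4) (Fin 4) ℂ)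
    {ξ : Tensor (p + 1) q} (hξ : ξ ∈ symExt (p + 1) q) : symbolAux p q M ξ ∈ symExt p (q + 1) := by
  refine ⟨fun σ B A => ?_, fun τ B A => ?_⟩
  · simp only [symbolAux, LinearMap.coe_mk, AddHom.coe_mk]
    congr 1
    refine Finset.sum_congr rfl fun ρ _ => ?_
    congr 1
    refine Finset.sum_congr rfl fun b _ => ?_
    congr 1
    rw [← hξ.1 (Equiv.Perm.decomposeFin.symm (0, σ)) (Fin.cons b B)]
    refine congrArg (fun X => ξ (X, fun i => A (ρ i.succ))) (funext fun i => ?_)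
    refine Fin.cases ?_ (fun i => ?_) i <;> simp
  · simp only [symbolAux, LinearMap.coe_mk, AddHom.coe_mk]
    rw [mul_left_comm]
    congr 1
    rw [← Equiv.sum_comp (Equiv.mulLeft τ⁻¹), Finset.mul_sum]
    refine Finset.sum_congr rfl fun ρ _ => ?_
    simp [mul_assoc]

theorem symbolAux_mem_kerC {p q : ℕ} {M : Matrix (Fin 4) (Fin 4) ℂ} (hM : ∀ a b, M a b = -M b a)
    {ξ : Tensor (p + 1) q} (hξ : ξ ∈ kerC (p + 1) q) : symbolAux p q M ξ ∈ kerC p (q + 1) := by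
  have hs := kerC_le_symExt _ _ hξ
  cases p with
  | zero => simpa [kerC] using symbolAux_mem_symExt M hs
  | succ p =>
  refine (mem_kerC_iff _ _ _).2 ⟨symbolAux_mem_symExt M hs, fun B A => ?_⟩
  simp only [symbolAux, LinearMap.coe_mk, AddHom.coe_mk]
  rw [← Finset.mul_sum, Finset.sum_comm]
  simp only [← Finset.mul_sum]
  rw [Finset.sum_eq_zero, mul_zero]
  intro τ _
  rw [mul_eq_zero]
  right
  by_cases h0 : τ 0 = 0
  · have hsym : ∀ (b c : Fin 4) A', ξ (Fin.cons (α := fun _ => Fin 4) b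
        (Fin.snoc (α := fun _ => Fin 4) B c), A') = ξ (Fin.cons (α := fun _ => Fin 4) c
        (Fin.snoc (α := fun _ => Fin 4) B b), A') := by
      intro b c A'
      rw [← hs.1 (Equiv.swap 0 (Fin.last _))]
      refine congrArg (fun X => ξ (X, A')) (funext fun i => ?_)
      refine Fin.cases ?_ (fun i => ?_) i
      · simp [← Fin.succ_last]
      · refine Fin.lastCases ?_ (fun i => ?_) i
        · simp
        · rw [Equiv.swap_apply_of_ne_of_ne (Fin.succ_ne_zero _)
            (by rw [← Fin.succ_last]; exact fun h => (Fin.castSucc_lt_last i).ne (Fin.succ_injective _ h))]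
          simp
    have hA : ∃ A' : Fin q → Fin 4, ∀ c : Fin 4,
        (fun i : Fin q => Fin.cons (α := fun _ => Fin 4) c A (τ i.succ)) = A' := by
      refine ⟨fun i => Fin.cons (α := fun _ => Fin 4) 0 A (τ i.succ), fun c => ?_⟩
      ext i
      have : τ i.succ ≠ 0 := fun h => Fin.succ_ne_zero i (τ.injective (h.trans h0.symm))
      obtain ⟨j, hj⟩ := Fin.exists_succ_eq.2 this
      rw [← hj]; simp
    obtain ⟨A', hA'⟩ := hA
    simp only [hA', h0, Fin.cons_zero]
    have key : (∑ c : Fin 4, ∑ b : Fin 4, M b c * ξ (Fin.cons (α := fun _ => Fin 4) b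
        (Fin.snoc (α := fun _ => Fin 4) B c), A')) = -∑ c : Fin 4, ∑ b : Fin 4, M b c *
        ξ (Fin.cons (α := fun _ => Fin 4) b (Fin.snoc (α := fun _ => Fin 4) B c), A') := by
      conv_lhs => rw [Finset.sum_comm]
      rw [← Finset.sum_neg_distrib]
      refine Finset.sum_congr rfl fun c _ => ?_
      rw [← Finset.sum_neg_distrib]
      refine Finset.sum_congr rfl fun b _ => ?_
      rw [hM, hsym]; ring
    exact self_eq_neg.1 key
  · obtain ⟨j, hj⟩ : ∃ j : Fin q, τ j.succ = 0 := by
      have : τ⁻¹ 0 ≠ 0 := fun h => h0 ((Equiv.Perm.inv_eq_iff_eq.1 h).symm)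
      obtain ⟨j, hj⟩ := Fin.exists_succ_eq.2 this
      exact ⟨j, by rw [hj]; simp⟩
    cases q with
    | zero => exact j.elim0
    | succ q =>
    obtain ⟨a, ha⟩ := Fin.exists_succ_eq.2 h0
    rw [Finset.sum_comm]
    refine Finset.sum_eq_zero fun b _ => ?_
    simp only [← ha, Fin.cons_succ]
    rw [← Finset.mul_sum, mul_eq_zero]
    right
    have hc := ((mem_kerC_iff _ _ _).1 hξ).2 (Fin.cons (α := fun _ => Fin 4) b B)
      (fun i => Fin.cons (α := fun _ => Fin 4) 0 A (τ (Equiv.swap 0 j i.succ).succ))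
    rw [← mul_zero (((Equiv.Perm.sign (Equiv.swap 0 j) : ℤ) : ℂ)), ← hc, Finset.mul_sum]
    refine Finset.sum_congr rfl fun c _ => ?_
    rw [← hs.2, Fin.cons_snoc_eq_snoc_cons]
    refine congrArg (fun X => ξ (_, X)) (funext fun i => ?_)
    by_cases hi : i = j
    · subst hi; simp [hj]
    · have h1 : Equiv.swap 0 j i ≠ 0 := fun h => hi (by
        have := congrArg (Equiv.swap 0 j) h; simpa using this)
      obtain ⟨m, hm⟩ := Fin.exists_succ_eq.2 h1
      have h2 : τ i.succ ≠ 0 := fun h => hi (Fin.succ_injective _ (τ.injective (h.trans hj.symm)))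
      obtain ⟨n, hn⟩ := Fin.exists_succ_eq.2 h2
      rw [← hm, Fin.cons_succ, hm, Equiv.swap_apply_self, ← hn]
      simp

theorem embed_antisymm (x : EuclideanSpace ℝ (Fin 6)) (a b : Fin 4) :
    embed x a b = -embed x b a := by
  fin_cases a <;> fin_cases b <;> simp [embed] <;> ring

/-- The space `𝒱 = ker 𝒞 ⊂ ⊙^p ℂ⁴ ⊗ ∧^q ℂ⁴` as a finite dimensional Hilbert space, with the inner
product of `⊗^(p+q) ℂ⁴`. The space `𝒱_l` belonging to `k` is `𝒱 (k - l) l`. -/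
def 𝒱 (p q : ℕ) : Type := ↥(kerC p q)

instance (p q : ℕ) : NormedAddCommGroup (𝒱 p q) :=
  inferInstanceAs (NormedAddCommGroup (kerC p q))

instance (p q : ℕ) : InnerProductSpace ℂ (𝒱 p q) :=
  inferInstanceAs (InnerProductSpace ℂ (kerC p q))

instance (p q : ℕ) : FiniteDimensional ℂ (𝒱 p q) :=
  inferInstanceAs (FiniteDimensional ℂ (kerC p q))

instance (p q : ℕ) : CompleteSpace (𝒱 p q) := FiniteDimensional.complete ℂ _

/-- The symbol map `𝒱_l → 𝒱_{l+1}` obtained from `𝒟_l` by replacing `∂_{x^i}` by `δ_{ij}`: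
`(σ_j ξ)^{A₁…A_{q+1}}_{B₁…B_p} = ∑_b embed(e_j)^{b [A₁} ξ^{A₂…A_{q+1}]}_{b B₁…B_p}`. -/
def symbol (p q : ℕ) (j : Fin 6) : 𝒱 (p + 1) q →ₗ[ℂ] 𝒱 p (q + 1) where
  toFun ξ := ⟨symbolAux p q (embed (e j)) ξ.1, symbolAux_mem_kerC (embed_antisymm _) ξ.2⟩
  map_add' a b := Subtype.ext ((symbolAux p q (embed (e j))).map_add a.1 b.1)
  map_smul' c a := Subtype.ext ((symbolAux p q (embed (e j))).map_smul c a.1)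

/-- The operator `𝒟_l` on functions:
`(𝒟 f)^{A₁…A_{q+1}}_{B₁…B_p} = ∑_b ∇^{b [A₁} f^{A₂…A_{q+1}]}_{b B₁…B_p}`, where `∇^{AB}` is the `(A, B)` entry
of the matrix `embed x` with `x^j` replaced by `∂_{x^j}`. -/
def diffOp (p q : ℕ) (f : EuclideanSpace ℝ (Fin 6) → 𝒱 (p + 1) q) :
    EuclideanSpace ℝ (Fin 6) → 𝒱 p (q + 1) :=
  fun x => ∑ j : Fin 6, symbol p q j (fderiv ℝ f x (e j))

/-- The formal adjoint of `𝒟_l` with respect to the weight `e^{-|x|²}`: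
`Θ g = -∑_j e^{|x|²} ∂_j (e^{-|x|²} σ_j^* g)`. -/
def formalAdj (p q : ℕ) (g : EuclideanSpace ℝ (Fin 6) → 𝒱 p (q + 1)) :
    EuclideanSpace ℝ (Fin 6) → 𝒱 (p + 1) q :=
  fun x => -∑ j : Fin 6, Real.exp (‖x‖ ^ 2) •
    (LinearMap.adjoint (symbol p q j)) (fderiv ℝ (fun y => Real.exp (-(‖y‖ ^ 2)) • g y) x (e j))

/-- The measure `e^{-|x|²} dx` on `ℝ⁶`. -/
def weight : Measure (EuclideanSpace ℝ (Fin 6)) :=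
  (volume : Measure (EuclideanSpace ℝ (Fin 6))).withDensity
    fun x => ENNReal.ofReal (Real.exp (-(‖x‖ ^ 2)))

/-- The weighted Hilbert space `L²_φ(ℝ⁶, 𝒱)`, `𝒱 = 𝒱 p q`, `φ(x) = |x|²`. -/
abbrev L2 (p q : ℕ) : Type := Lp (𝒱 p q) 2 weight

/-- The test functions `C_0^∞(ℝ⁶, 𝒱)`. -/
def IsTest {p q : ℕ} (g : EuclideanSpace ℝ (Fin 6) → 𝒱 p q) : Prop :=
  ContDiff ℝ ∞ g ∧ HasCompactSupport g

instance : IsLocallyFiniteMeasure weight :=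
  IsLocallyFiniteMeasure.withDensity_ofReal (by fun_prop)

theorem IsTest.memLp {p q : ℕ} {g : EuclideanSpace ℝ (Fin 6) → 𝒱 p q} (hg : IsTest g) :
    MemLp g 2 weight :=
  hg.1.continuous.memLp_of_hasCompactSupport hg.2

theorem contDiff_fderiv_apply {F : Type*} [NormedAddCommGroup F] [NormedSpace ℝ F]
    {g : EuclideanSpace ℝ (Fin 6) → F} (hg : ContDiff ℝ ∞ g) (v : EuclideanSpace ℝ (Fin 6)) :
    ContDiff ℝ ∞ fun x => fderiv ℝ g x v :=
  (hg.fderiv_right (m := ∞) (by simp)).clm_apply contDiff_const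

theorem IsTest.diffOp {p q : ℕ} {f : EuclideanSpace ℝ (Fin 6) → 𝒱 (p + 1) q} (hf : IsTest f) :
    IsTest (diffOp p q f) := by
  refine ⟨ContDiff.sum fun j _ => ?_, ?_⟩
  · exact ((LinearMap.toContinuousLinearMap (symbol p q j)).restrictScalars ℝ).contDiff.comp
      (contDiff_fderiv_apply hf.1 (e j))
  · refine HasCompactSupport.mono' (hf.2.fderiv (𝕜 := ℝ)) fun x hx => ?_
    refine subset_tsupport _ fun h => hx ?_
    simp [Massless.diffOp, h]

theorem IsTest.formalAdj {p q : ℕ} {g : EuclideanSpace ℝ (Fin 6) → 𝒱 p (q + 1)}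
    (hg : IsTest g) : IsTest (formalAdj p q g) := by
  have h1 : ContDiff ℝ ∞ fun y => Real.exp (-(‖y‖ ^ 2)) • g y :=
    (Real.contDiff_exp.comp (contDiff_norm_sq ℝ).neg).smul hg.1
  have h2 : HasCompactSupport fun y => Real.exp (-(‖y‖ ^ 2)) • g y := hg.2.smul_left
  refine ⟨ContDiff.neg (ContDiff.sum fun j _ => ?_), ?_⟩
  · refine (Real.contDiff_exp.comp (contDiff_norm_sq ℝ)).smul ?_
    exact ((LinearMap.toContinuousLinearMap
      (LinearMap.adjoint (symbol p q j))).restrictScalars ℝ).contDiff.comp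
      (contDiff_fderiv_apply h1 (e j))
  · refine HasCompactSupport.mono' (h2.fderiv (𝕜 := ℝ)) fun x hx => ?_
    refine subset_tsupport _ fun h => hx ?_
    simp [Massless.formalAdj, h]

theorem integral_weight {F : Type*} [NormedAddCommGroup F] [NormedSpace ℝ F]
    (h : EuclideanSpace ℝ (Fin 6) → F) :
    ∫ x, h x ∂weight = ∫ x, Real.exp (-(‖x‖ ^ 2)) • h x := by
  rw [weight, integral_withDensity_eq_integral_toReal_smul (by fun_prop) (by simp)]
  refine integral_congr_ae (Filter.Eventually.of_forall fun x => ?_)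
  simp only
  rw [ENNReal.toReal_ofReal (Real.exp_pos _).le]

/-- `formalAdj` is the formal adjoint of `diffOp`:
`⟨𝒟 f, g⟩_φ = ⟨f, Θ g⟩_φ` for test functions. -/
theorem integral_inner_diffOp {p q : ℕ} {f : EuclideanSpace ℝ (Fin 6) → 𝒱 (p + 1) q}
    {g : EuclideanSpace ℝ (Fin 6) → 𝒱 p (q + 1)} (hf : IsTest f) (hg : IsTest g) :
    ∫ x, inner ℂ (diffOp p q f x) (g x) ∂weight = ∫ x, inner ℂ (f x) (formalAdj p q g x) ∂weight := by
  set w : EuclideanSpace ℝ (Fin 6) → 𝒱 p (q + 1) := fun y => Real.exp (-(‖y‖ ^ 2)) • g y with hw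
  have hw1 : ContDiff ℝ ∞ w := (Real.contDiff_exp.comp (contDiff_norm_sq ℝ).neg).smul hg.1
  have hL : ∀ j, Continuous (LinearMap.adjoint (symbol p q j)) := fun j =>
    LinearMap.continuous_of_finiteDimensional _
  let T : Fin 6 → (𝒱 p (q + 1) →L[ℝ] 𝒱 (p + 1) q) := fun j =>
    (LinearMap.toContinuousLinearMap (LinearMap.adjoint (symbol p q j))).restrictScalars ℝ
  have hcs : ∀ (a b : EuclideanSpace ℝ (Fin 6) → 𝒱 (p + 1) q), Continuous a → Continuous b →
      (∀ x ∉ tsupport f, a x = 0) → Integrable (fun x => inner ℂ (a x) (b x)) volume := by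
    intro a b ha hb h0
    refine (ha.inner hb).integrable_of_hasCompactSupport ?_
    refine HasCompactSupport.intro (K := tsupport f) hf.2 fun x hx => ?_
    rw [h0 x hx, inner_zero_left]
  have hf0 : ∀ x ∉ tsupport f, f x = 0 := fun x hx => image_eq_zero_of_notMem_tsupport hx
  have hfd0 : ∀ j, ∀ x ∉ tsupport f, fderiv ℝ f x (e j) = 0 := fun j x hx => by
    have : fderiv ℝ f x = 0 := by
      by_contra h
      exact hx (support_fderiv_subset ℝ h)
    rw [this]; rfl
  have hfd : ∀ j, Continuous fun x => fderiv ℝ f x (e j) := fun j =>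
    (contDiff_fderiv_apply hf.1 _).continuous
  have hwd : ∀ j, Continuous fun x => T j (fderiv ℝ w x (e j)) := fun j =>
    (T j).continuous.comp (contDiff_fderiv_apply hw1 _).continuous
  have hTw : ∀ j, Continuous fun x => T j (w x) := fun j => (T j).continuous.comp hw1.continuous
  have hTd : ∀ j x, fderiv ℝ (fun y => T j (w y)) x (e j) = T j (fderiv ℝ w x (e j)) := fun j x => by
    have := (T j).hasFDerivAt.comp x (hw1.differentiable (by simp) x).hasFDerivAt
    exact congrArg (fun L : EuclideanSpace ℝ (Fin 6) →L[ℝ] 𝒱 (p + 1) q => L (e j)) this.fderiv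
  have ibp : ∀ j, ∫ x, inner ℂ (f x) (T j (fderiv ℝ w x (e j))) =
      -∫ x, inner ℂ (fderiv ℝ f x (e j)) (T j (w x)) := fun j => by
    have := integral_bilinear_fderiv_right_eq_neg_left_of_integrable (μ := volume) (f := f)
      (g := fun y => T j (w y)) (v := e j)
      (B := (isBoundedBilinearMap_inner (𝕜 := ℂ) (E := 𝒱 (p + 1) q)).toContinuousLinearMap)
      (hcs _ _ (hfd j) (hTw j) (hfd0 j))
      (by simp only [hTd]; exact hcs _ _ hf.1.continuous (hwd j) hf0)
      (hcs _ _ hf.1.continuous (hTw j) hf0)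
      (fun x _ => hf.1.differentiable (by simp) x)
      (fun x _ => (T j).differentiableAt.comp x (hw1.differentiable (by simp) x))
    simp only [hTd] at this
    exact this
  rw [integral_weight, integral_weight]
  have e1 : ∀ x, Real.exp (-(‖x‖ ^ 2)) • inner ℂ (diffOp p q f x) (g x) =
      ∑ j, inner ℂ (fderiv ℝ f x (e j)) (T j (w x)) := fun x => by
    rw [← inner_smul_right_eq_smul, diffOp, sum_inner]
    refine Finset.sum_congr rfl fun j _ => ?_
    exact (LinearMap.adjoint_inner_right _ _ _).symm
  have e2 : ∀ x, Real.exp (-(‖x‖ ^ 2)) • inner ℂ (f x) (formalAdj p q g x) =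
      -∑ j, inner ℂ (f x) (T j (fderiv ℝ w x (e j))) := fun x => by
    rw [← inner_smul_right_eq_smul, formalAdj, smul_neg, inner_neg_right, ← Finset.smul_sum,
      smul_smul, ← Real.exp_add, neg_add_cancel, Real.exp_zero, one_smul, inner_sum]
    rfl
  simp only [e1, e2]
  rw [integral_neg, integral_finsetSum _ fun j _ => hcs _ _ (hfd j) (hTw j) (hfd0 j),
    integral_finsetSum _ fun j _ => hcs _ _ hf.1.continuous (hwd j) hf0, ← Finset.sum_neg_distrib]
  exact Finset.sum_congr rfl fun j _ => by rw [ibp, neg_neg]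

/-- The graph of the weak maximal extension of `𝒟_l`: the pairs `(f, u)` of `L²_φ` functions with
`⟨u, g⟩_φ = ⟨f, Θ g⟩_φ` for all test functions `g`. -/
def weakGraph (p q : ℕ) : Submodule ℂ (L2 (p + 1) q × L2 p (q + 1)) where
  carrier := {fu | ∀ (g : EuclideanSpace ℝ (Fin 6) → 𝒱 p (q + 1)) (hg : IsTest g),
    inner ℂ fu.2 (hg.memLp.toLp g) = inner ℂ fu.1 (hg.formalAdj.memLp.toLp (formalAdj p q g))}
  zero_mem' := by intro g hg; exact (inner_zero_left _).trans (inner_zero_left _).symm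
  add_mem' := by
    intro a b ha hb g hg
    change inner ℂ (a.2 + b.2) _ = inner ℂ (a.1 + b.1) _
    rw [inner_add_left, inner_add_left, ha g hg, hb g hg]
  smul_mem' := by
    intro c a ha g hg
    change inner ℂ (c • a.2) _ = inner ℂ (c • a.1) _
    rw [inner_smul_left, inner_smul_left, ha g hg]

theorem IsTest.smul_const {p q : ℕ} {h : EuclideanSpace ℝ (Fin 6) → ℝ} (hh : ContDiff ℝ ∞ h)
    (hc : HasCompactSupport h) (v : 𝒱 p q) : IsTest fun x => h x • v :=
  ⟨hh.smul contDiff_const, hc.smul_right⟩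

/-- An `L²_φ` function orthogonal to all test functions is zero. -/
theorem eq_zero_of_test {p q : ℕ} (u : L2 p q)
    (h : ∀ (g : EuclideanSpace ℝ (Fin 6) → 𝒱 p q) (hg : IsTest g),
      inner ℂ u (hg.memLp.toLp g) = 0) : u = 0 := by
  rw [Lp.eq_zero_iff_ae_eq_zero]
  have hloc : LocallyIntegrable u weight := (Lp.memLp u).locallyIntegrable (by norm_num)
  refine ae_eq_zero_of_integral_contDiff_smul_eq_zero hloc fun g hg hc => ?_
  refine ext_inner_left ℂ fun v => ?_
  have hint : Integrable (fun x => g x • u x) weight :=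
    hloc.integrable_smul_left_of_hasCompactSupport hg.continuous hc
  have h0 := h _ (IsTest.smul_const hg hc v)
  rw [inner_zero_right, ← integral_inner hint, ← map_eq_zero (starRingEnd ℂ), ← h0,
    L2.inner_def, ← integral_conj]
  refine integral_congr_ae ?_
  filter_upwards [(IsTest.smul_const hg hc v).memLp.coeFn_toLp] with x hx
  rw [hx, inner_conj_symm, inner_smul_left_eq_smul, inner_smul_right_eq_smul]

theorem weakGraph_single (p q : ℕ) (x : L2 (p + 1) q × L2 p (q + 1)) (hx : x ∈ weakGraph p q)
    (h0 : x.1 = 0) : x.2 = 0 :=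
  eq_zero_of_test _ fun g hg => by rw [hx g hg, h0, inner_zero_left]

/-- The operator `𝒟_l : L²_φ(ℝ⁶, 𝒱_l) → L²_φ(ℝ⁶, 𝒱_{l+1})`, in the weak sense, for `l = q` and
`k = p + 1 + q`. Its graph is `weakGraph p q`. -/
def weakD (p q : ℕ) : L2 (p + 1) q →ₗ.[ℂ] L2 p (q + 1) := (weakGraph p q).toLinearPMap

theorem IsTest.mem_weakGraph {p q : ℕ} {f : EuclideanSpace ℝ (Fin 6) → 𝒱 (p + 1) q}
    (hf : IsTest f) : (hf.memLp.toLp f, hf.diffOp.memLp.toLp (Massless.diffOp p q f)) ∈ weakGraph p q := by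
  intro g hg
  have hin : ∀ {m n : ℕ} {a b : EuclideanSpace ℝ (Fin 6) → 𝒱 m n} (ha : IsTest a) (hb : IsTest b),
      inner ℂ (ha.memLp.toLp a) (hb.memLp.toLp b) = ∫ x, inner ℂ (a x) (b x) ∂weight := by
    intro m n a b ha hb
    rw [L2.inner_def]
    refine integral_congr_ae ?_
    filter_upwards [ha.memLp.coeFn_toLp, hb.memLp.coeFn_toLp] with x h1 h2
    rw [h1, h2]
  change inner ℂ (hf.diffOp.memLp.toLp (Massless.diffOp p q f)) _ = inner ℂ (hf.memLp.toLp f) _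
  rw [hin hf.diffOp hg, hin hf hg.formalAdj, integral_inner_diffOp hf hg]

/-- `𝒟_l` is densely defined, so that its Hilbert space adjoint is the genuine one. -/
theorem weakD_dense (p q : ℕ) : Dense ((weakD p q).domain : Set (L2 (p + 1) q)) := by
  rw [Submodule.dense_iff_topologicalClosure_eq_top, Submodule.topologicalClosure_eq_top_iff,
    Submodule.eq_bot_iff]
  intro u hu
  refine eq_zero_of_test u fun g hg => ?_
  rw [Submodule.mem_orthogonal'] at hu
  exact hu _ ⟨_, hg.mem_weakGraph, rfl⟩

section Operators

variable {E F G : Type*} [AddCommGroup E] [Module ℂ E] [AddCommGroup F] [Module ℂ F]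
  [AddCommGroup G] [Module ℂ G]

/-- The composition `T ∘ S` of partially defined operators, with its natural domain
`{x ∈ Dom S | S x ∈ Dom T}`. -/
def pcomp (T : F →ₗ.[ℂ] G) (S : E →ₗ.[ℂ] F) : E →ₗ.[ℂ] G where
  domain := (T.domain.comap S.toFun).map S.domain.subtype
  toFun :=
    { toFun := fun x => T ⟨S ⟨x, by obtain ⟨y, _, hy⟩ := x.2; rw [← hy]; exact y.2⟩, by
        obtain ⟨x, y, hy, rfl⟩ := x; exact hy⟩
      map_add' := fun x y => by
        rw [← T.map_add]; exact congrArg T (Subtype.ext (S.map_add ⟨x, _⟩ ⟨y, _⟩))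
      map_smul' := fun c x => by
        rw [RingHom.id_apply, ← T.map_smul]; exact congrArg T (Subtype.ext (S.map_smul c ⟨x, _⟩)) }

theorem mem_pcomp_domain (T : F →ₗ.[ℂ] G) (S : E →ₗ.[ℂ] F) (x : E) :
    x ∈ (pcomp T S).domain ↔ ∃ h : x ∈ S.domain, S ⟨x, h⟩ ∈ T.domain := by
  constructor
  · rintro ⟨y, hy, rfl⟩; exact ⟨y.2, hy⟩
  · rintro ⟨h, h'⟩; exact ⟨⟨x, h⟩, h', rfl⟩

end Operators

/-- The Hodge Laplacian on `L²_φ(ℝ⁶, 𝒱_{l+1})`, where `k = p + l + 2` and `l + 1 = 1, 2, 3`, with its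
natural domain:
`□_{l+1} = 𝒟_l 𝒟_l^* + 𝒟_{l+1}^* 𝒟_{l+1}` for `l + 1 = 1, 2`, and `□_3 = 𝒟_2 𝒟_2^*`. -/
def hodgeLaplacian (p l : ℕ) : L2 (p + 1) (l + 1) →ₗ.[ℂ] L2 (p + 1) (l + 1) :=
  if l = 2 then pcomp (weakD (p + 1) l) (weakD (p + 1) l)†
  else pcomp (weakD (p + 1) l) (weakD (p + 1) l)† + pcomp (weakD p (l + 1))† (weakD p (l + 1))

/-- The bounded operator `N` is an inverse of the partially defined operator `T`: it maps the whole
space into `Dom T`, `T N f = f` for all `f`, and `N T u = u` for all `u ∈ Dom T`. -/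
def IsBoundedInverse {H : Type*} [NormedAddCommGroup H] [InnerProductSpace ℂ H]
    (T : H →ₗ.[ℂ] H) (N : H →L[ℂ] H) : Prop :=
  (∀ f : H, ∃ h : N f ∈ T.domain, T ⟨N f, h⟩ = f) ∧ ∀ u : T.domain, N (T u) = u

end Massless

end

/-! Everything rests on the a priori estimate `‖u‖² ≤ ‖𝒟_l^* u‖² + ‖𝒟_{l+1} u‖²` on `Dom(𝒟_l^*) ∩
Dom(𝒟_{l+1})` (`norm_sq_le_adjoint_add`). Given it, `𝒟_{l+1} 𝒟_l = 0` and closedness, the abstract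
theory of Hilbert complexes (`exists_hodge_solution`) produces `N` and the canonical solutions, with
all bounds equal to `1`. The operator `□_3` fits the same pattern because `𝒱_4 = 0`.

For smooth `g` of temperate growth the estimate comes from the commutator `[∂_j, ∂_k^*] = 2δ_{jk}`,
where `∂_j^* = -∂_j + 2x_j`. Let `v_j` be the adjoint symbol before projection to the kernel of the
contraction (`lowerSymbol`), and let `τ` exchange the first two subscripts. Integration by parts
turns `∑_{j,k} ∫⟨τ v_j ∂_j^* g, v_k ∂_k^* g⟩` into `∑_{j,k} ∫⟨τ v_j ∂_k g, v_k ∂_j g⟩ + 2 ∑_j ∫⟨τ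
v_j g, v_j g⟩`. Three algebraic facts conclude. The real part of the left side is at most `‖Θg‖²`,
since the form of `τ` is nonpositive on the part of `∑_j v_j ∂_j^* g` that the projection removes
(`norm_symmetrize_le`, `re_inner_swapLower_le`). Exchanging subscripts after lowering is the same as
exchanging superscripts after raising, so the first term on the right has real part at least
`-2‖𝒟g‖²` (`inner_swapLower_lowerMul`, `neg_two_mul_le_re_inner_swapUpper`). The completeness
relation of the six matrices and the vanishing trace of `g` give `∑_j ⟨τ v_j g, v_j g⟩ = 2|g|²`
(`sum_inner_swapLower_self`). Together `4‖g‖² ≤ ‖Θg‖² + 2‖𝒟g‖²` (`integral_norm_sq_le`).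

The passage to the weak domains uses polynomials instead of mollifiers. `𝒟` lowers the degree by one
and `Θ` raises it by one, so the orthogonal projection of `u` to the polynomials of bounded degree
does not increase either norm on the right of the estimate, and polynomials are dense for the
Gaussian weight. -/

noncomputable section
namespace Massless

/-! ### Closed operators and Hilbert complexes. -/

section Hilbert

variable {E F G : Type*} [NormedAddCommGroup E] [InnerProductSpace ℂ E] [CompleteSpace E]
  [NormedAddCommGroup F] [InnerProductSpace ℂ F] [CompleteSpace F]
  [NormedAddCommGroup G] [InnerProductSpace ℂ G] [CompleteSpace G]

/-- A closed operator that is bounded below by one admits a bounded self-adjoint solution operator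
`N` of the variational problem `⟨A (N f), A g⟩ = ⟨f, g⟩`. -/
theorem exists_variational_solution (A : E →ₗ.[ℂ] F) (hA : A.IsClosed)
    (hb : ∀ u : A.domain, ‖(u : E)‖ ≤ ‖A u‖) :
    ∃ N : E →L[ℂ] E, IsSelfAdjoint N ∧ ∀ f, ∃ h : N f ∈ A.domain, ∀ g : A.domain,
      inner ℂ (A ⟨N f, h⟩) (A g) = inner ℂ f (g : E) := by
  -- The product carries the sup norm, so the lower bound makes the projection of the graph to `F`
  -- an isometry. Its range `R`, the range of `A`, is therefore complete.
  let φ : A.graph →ₗᵢ[ℂ] F :=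
    { toLinearMap := (LinearMap.snd ℂ E F).comp A.graph.subtype
      norm_map' := by
        rintro ⟨⟨u, w⟩, h⟩
        obtain ⟨y, rfl, rfl⟩ := (LinearPMap.mem_graph_iff A).1 h
        change ‖A y‖ = ‖((y : E), A y)‖
        rw [Prod.norm_mk, max_eq_right (hb y)] }
  have : CompleteSpace A.graph := hA.completeSpace_coe
  let R := LinearMap.range φ.toLinearMap
  have : CompleteSpace R := φ.equivRange.symm.toContinuousLinearEquiv.isUniformEmbedding.isUniformInducing.completeSpace (by
    have : Set.range φ.equivRange.symm.toContinuousLinearEquiv = Set.univ := φ.equivRange.symm.surjective.range_eq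
    rw [this]; exact isComplete_univ)
  -- `B` is `A⁻¹` after the orthogonal projection to `R`, and `N = B B^*`: indeed `⟨A B B^* f, A g⟩
  -- = ⟨B^* f, A g⟩ = ⟨f, B A g⟩ = ⟨f, g⟩`.
  let B : F →L[ℂ] E := (ContinuousLinearMap.fst ℂ E F).comp (A.graph.subtypeL.comp
    ((φ.equivRange.symm.toContinuousLinearEquiv : R →L[ℂ] A.graph).comp R.orthogonalProjectionOnto))
  have hBr : ∀ w : F, ∃ h : B w ∈ A.domain, A ⟨B w, h⟩ = R.orthogonalProjectionOnto w := by
    intro w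
    set q := φ.equivRange.symm (R.orthogonalProjectionOnto w) with hq
    have h1 : φ q = R.orthogonalProjectionOnto w := by
      have := φ.equivRange.apply_symm_apply (R.orthogonalProjectionOnto w)
      exact congrArg Subtype.val this
    obtain ⟨y, hy1, hy2⟩ := (LinearPMap.mem_graph_iff A).1 q.2
    have hBw : B w = y := hy1.symm
    refine ⟨hBw ▸ y.2, ?_⟩
    have : (⟨B w, hBw ▸ y.2⟩ : A.domain) = y := Subtype.ext hBw
    rw [this, hy2]; exact h1
  have hBA : ∀ g : A.domain, B (A g) = g := by
    intro g
    have hg : A g ∈ R := ⟨⟨(g, A g), A.mem_graph g⟩, rfl⟩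
    obtain ⟨h, h'⟩ := hBr (A g)
    have h2 : (R.orthogonalProjectionOnto (A g) : F) = A g := by
      rw [Submodule.coe_orthogonalProjectionOnto_apply]
      exact Submodule.starProjection_eq_self_iff.2 hg
    rw [h2] at h'
    have h3 := hb (⟨B (A g), h⟩ - g)
    rw [LinearPMap.map_sub, h', sub_self, norm_zero] at h3
    exact sub_eq_zero.1 (norm_le_zero_iff.1 h3)
  refine ⟨B.comp (ContinuousLinearMap.adjoint B), ?_, fun f => ?_⟩
  · rw [ContinuousLinearMap.isSelfAdjoint_iff_isSymmetric]
    intro x y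
    change inner ℂ (B (ContinuousLinearMap.adjoint B x)) y = inner ℂ x (B (ContinuousLinearMap.adjoint B y))
    rw [← ContinuousLinearMap.adjoint_inner_right, ContinuousLinearMap.adjoint_inner_left]
  · obtain ⟨h, h'⟩ := hBr (ContinuousLinearMap.adjoint B f)
    refine ⟨h, fun g => ?_⟩
    have hg : A g ∈ R := ⟨⟨(g, A g), A.mem_graph g⟩, rfl⟩
    have h'' : A ⟨(B.comp (ContinuousLinearMap.adjoint B)) f, h⟩ =
      R.orthogonalProjectionOnto (ContinuousLinearMap.adjoint B f) := h'
    rw [h'', ← hBA g, ← ContinuousLinearMap.adjoint_inner_left,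
      Submodule.coe_orthogonalProjectionOnto_apply, Submodule.inner_starProjection_left_eq_right,
      Submodule.starProjection_eq_self_iff.2 hg]

/-- The pair of two operators as an operator on the intersection of their domains. -/
def pairOp (U : E →ₗ.[ℂ] F) (S : E →ₗ.[ℂ] G) : E →ₗ.[ℂ] WithLp 2 (F × G) where
  domain := U.domain ⊓ S.domain
  toFun := (WithLp.linearEquiv 2 ℂ (F × G)).symm.toLinearMap ∘ₗ
    ((U.toFun ∘ₗ Submodule.inclusion inf_le_left).prod (S.toFun ∘ₗ Submodule.inclusion inf_le_right))

omit [CompleteSpace E] [CompleteSpace F] [CompleteSpace G] in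
theorem pairOp_isClosed {U : E →ₗ.[ℂ] F} {S : E →ₗ.[ℂ] G} (hU : U.IsClosed) (hS : S.IsClosed) :
    (pairOp U S).IsClosed := by
  have : ((pairOp U S).graph : Set (E × WithLp 2 (F × G))) =
      (fun x => (x.1, (WithLp.ofLp x.2).1)) ⁻¹' (U.graph : Set (E × F)) ∩
      (fun x => (x.1, (WithLp.ofLp x.2).2)) ⁻¹' (S.graph : Set (E × G)) := by
    ext ⟨u, w⟩
    simp only [SetLike.mem_coe, LinearPMap.mem_graph_iff, Set.mem_inter_iff, Set.mem_preimage]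
    constructor
    · rintro ⟨y, rfl, rfl⟩
      exact ⟨⟨⟨y, y.2.1⟩, rfl, rfl⟩, ⟨⟨y, y.2.2⟩, rfl, rfl⟩⟩
    · rintro ⟨⟨y, rfl, hy⟩, ⟨z, hz1, hz2⟩⟩
      refine ⟨⟨y, y.2, hz1 ▸ z.2⟩, rfl, ?_⟩
      have hz : z = ⟨y, hz1 ▸ z.2⟩ := Subtype.ext hz1
      rw [hz] at hz2
      change WithLp.toLp 2 (U y, S ⟨y, hz1 ▸ z.2⟩) = w
      rw [hy, hz2]
  rw [LinearPMap.IsClosed, this]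
  have hc : Continuous fun x : E × WithLp 2 (F × G) => WithLp.ofLp x.2 :=
    (WithLp.prod_continuous_ofLp 2 F G).comp continuous_snd
  exact (hU.preimage (continuous_fst.prodMk (continuous_fst.comp hc))).inter
    (hS.preimage (continuous_fst.prodMk (continuous_snd.comp hc)))

/-- With the `ℓ²` norm on `F × G`, the hypothesis `hb` is exactly the lower bound for `pairOp U S`.
-/
theorem exists_variational_solution_pair {U : E →ₗ.[ℂ] F} {S : E →ₗ.[ℂ] G} (hU : U.IsClosed)
    (hS : S.IsClosed)
    (hb : ∀ (u : E) (h : u ∈ U.domain) (h' : u ∈ S.domain),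
      ‖u‖ ^ 2 ≤ ‖U ⟨u, h⟩‖ ^ 2 + ‖S ⟨u, h'⟩‖ ^ 2) :
    ∃ N : E →L[ℂ] E, IsSelfAdjoint N ∧ ∀ f, ∃ (h : N f ∈ U.domain) (h' : N f ∈ S.domain),
      ∀ (g : E) (k : g ∈ U.domain) (k' : g ∈ S.domain),
      inner ℂ (U ⟨N f, h⟩) (U ⟨g, k⟩) + inner ℂ (S ⟨N f, h'⟩) (S ⟨g, k'⟩) = inner ℂ f g := by
  obtain ⟨N, hN, h⟩ := exists_variational_solution (pairOp U S) (pairOp_isClosed hU hS) (by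
    rintro ⟨u, hu1, hu2⟩
    refine le_of_sq_le_sq ?_ (norm_nonneg _)
    rw [WithLp.prod_norm_sq_eq_of_L2]
    exact hb u hu1 hu2)
  refine ⟨N, hN, fun f => ?_⟩
  obtain ⟨h1, h2⟩ := h f
  refine ⟨h1.1, h1.2, fun g k k' => ?_⟩
  rw [← h2 ⟨g, k, k'⟩, WithLp.prod_inner_apply]
  rfl

/-- A closed densely defined operator is the adjoint of its adjoint. -/
theorem mem_domain_of_adjoint_adjoint {T : E →ₗ.[ℂ] F} (hT : Dense (T.domain : Set E))
    (hc : T.IsClosed) {x : E} {y : F}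
    (h : ∀ g : T†.domain, inner ℂ x (T† g) = inner ℂ y (g : F)) :
    ∃ hx : x ∈ T.domain, T ⟨x, hx⟩ = y := by
  let e := (WithLp.linearEquiv 2 ℂ (E × F))
  let Γ : Submodule ℂ (WithLp 2 (E × F)) := T.graph.comap e.toLinearMap
  have hΓ : IsClosed (Γ : Set (WithLp 2 (E × F))) :=
    hc.preimage (WithLp.prod_continuous_ofLp 2 E F)
  have : CompleteSpace Γ := hΓ.completeSpace_coe
  -- A vector orthogonal to the graph has the form `(-T† b, b)`, and `h` says that `(x, y)` is
  -- orthogonal to all of these. The closed graph is its own double complement.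
  have hmem : WithLp.toLp 2 (x, y) ∈ Γᗮᗮ := by
    rw [Submodule.mem_orthogonal']
    intro w hw
    rw [Submodule.mem_orthogonal] at hw
    have h1 : ∀ z : T.domain, inner ℂ (-(WithLp.ofLp w).1) (z : E) = inner ℂ (WithLp.ofLp w).2 (T z) := by
      intro z
      have := hw (WithLp.toLp 2 ((z : E), T z)) (T.mem_graph z)
      rw [WithLp.prod_inner_apply] at this
      have h2 : inner ℂ (z : E) (WithLp.ofLp w).1 + inner ℂ (T z) (WithLp.ofLp w).2 = 0 := this
      rw [← inner_conj_symm, ← inner_conj_symm (WithLp.ofLp w).2, inner_neg_right,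
        ← eq_neg_of_add_eq_zero_right h2]
    have hd : (WithLp.ofLp w).2 ∈ T†.domain := LinearPMap.mem_adjoint_domain_of_exists _ ⟨_, h1⟩
    have h3 := h ⟨_, hd⟩
    rw [LinearPMap.adjoint_apply_eq hT ⟨_, hd⟩ h1, inner_neg_right] at h3
    rw [WithLp.prod_inner_apply]
    change inner ℂ x (WithLp.ofLp w).1 + inner ℂ y (WithLp.ofLp w).2 = 0
    rw [← h3]; ring
  rw [Submodule.orthogonal_orthogonal] at hmem
  obtain ⟨z, hz1, hz2⟩ := (LinearPMap.mem_graph_iff T).1 hmem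
  have hz1 : (z : E) = x := hz1
  subst hz1
  exact ⟨z.2, hz2⟩

/-- The solution of the Hodge Laplacian of a Hilbert complex `E → F → G`, given the basic
estimate. -/
theorem exists_hodge_solution {T : E →ₗ.[ℂ] F} {S : F →ₗ.[ℂ] G}
    (hT : Dense (T.domain : Set E)) (hS : Dense (S.domain : Set F)) (hTc : T.IsClosed)
    (hSc : S.IsClosed) (hST : ∀ x : T.domain, ∃ h : T x ∈ S.domain, S ⟨T x, h⟩ = 0)
    (hb : ∀ (u : F) (h : u ∈ T†.domain) (h' : u ∈ S.domain),
      ‖u‖ ^ 2 ≤ ‖T† ⟨u, h⟩‖ ^ 2 + ‖S ⟨u, h'⟩‖ ^ 2) :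
    ∃ N : F →L[ℂ] F, IsBoundedInverse (pcomp T T† + pcomp S† S) N ∧ IsSelfAdjoint N ∧
      (∀ f, ‖N f‖ ≤ ‖f‖) ∧ ∀ f, ∃ (h₁ : N f ∈ T†.domain) (h₂ : N f ∈ S.domain),
        ‖T† ⟨N f, h₁⟩‖ ≤ ‖f‖ ∧ ‖S ⟨N f, h₂⟩‖ ≤ ‖f‖ ∧
        ∀ hf : f ∈ S.domain, S ⟨f, hf⟩ = 0 →
          (∃ h₃ : T† ⟨N f, h₁⟩ ∈ T.domain, T ⟨T† ⟨N f, h₁⟩, h₃⟩ = f) ∧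
          ∀ v : T.domain, T v = 0 → inner ℂ (v : E) (T† ⟨N f, h₁⟩) = 0 := by
  obtain ⟨N, hN, hv⟩ := exists_variational_solution_pair
    (LinearPMap.adjoint_isClosed hT) hSc hb
  choose h₁ h₂ hv using hv
  have hfa := LinearPMap.adjoint_isFormalAdjoint hT
  have hfs := LinearPMap.adjoint_isFormalAdjoint hS
  -- the closed kernel of `S`
  let K : Submodule ℂ F := (S.graph).comap (LinearMap.inl ℂ F G)
  have hKc : IsClosed (K : Set F) := hSc.preimage (by fun_prop : Continuous fun x : F => (x, (0 : G)))
  have : CompleteSpace K := hKc.completeSpace_coe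
  have hK : ∀ x, x ∈ K ↔ ∃ h : x ∈ S.domain, S ⟨x, h⟩ = 0 := by
    intro x
    change (x, (0 : G)) ∈ S.graph ↔ _
    rw [LinearPMap.mem_graph_iff]
    constructor
    · rintro ⟨y, rfl, hy⟩; exact ⟨y.2, hy⟩
    · rintro ⟨h, h'⟩; exact ⟨⟨x, h⟩, rfl, h'⟩
  -- The range of `T` lies in `K`, hence `T†` vanishes on `Kᗮ`.
  have hKp : ∀ x ∈ Kᗮ, ∃ h : x ∈ T†.domain, T† ⟨x, h⟩ = 0 := by
    intro x hx
    have h1 : ∀ z : T.domain, inner ℂ (0 : E) (z : E) = inner ℂ x (T z) := by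
      intro z
      rw [inner_zero_left, (Submodule.mem_orthogonal' _ _).1 hx _ ((hK _).2 (hST z))]
    exact ⟨LinearPMap.mem_adjoint_domain_of_exists _ ⟨_, h1⟩, LinearPMap.adjoint_apply_eq hT _ h1⟩
  have hdec : ∀ g : F, g = K.starProjection g + (g - K.starProjection g) := fun g => by abel
  have hP : ∀ g, K.starProjection g ∈ K := fun g => Submodule.starProjection_apply_mem _ _
  have hQ : ∀ g, g - K.starProjection g ∈ Kᗮ := fun g => K.sub_starProjection_mem_orthogonal g
  -- The variational identity splits along `K ⊕ Kᗮ`. Tested on the `K`-component of `g ∈ Dom T†` the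
  -- `S`-term drops out, while `T†` does not see the other component; this leaves `⟨T† N f, T† g⟩ =
  -- ⟨P_K f, g⟩`.
  have hTT : ∀ f, ∃ h₃ : T† ⟨N f, h₁ f⟩ ∈ T.domain,
      T ⟨T† ⟨N f, h₁ f⟩, h₃⟩ = K.starProjection f := by
    intro f
    refine mem_domain_of_adjoint_adjoint hT hTc fun g => ?_
    obtain ⟨a1, a2⟩ := (hK _).1 (hP g)
    obtain ⟨b1, b2⟩ := hKp _ (hQ g)
    have c1 : K.starProjection (g : F) ∈ T†.domain := by
      have := T†.domain.sub_mem g.2 b1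
      rwa [sub_sub_cancel] at this
    have := hv f _ c1 a1
    rw [a2, inner_zero_right, add_zero, ← Submodule.inner_starProjection_left_eq_right] at this
    rw [← this]
    have hg : g = ⟨_, c1⟩ + ⟨_, b1⟩ := Subtype.ext (hdec g)
    conv_lhs => rw [hg, LinearPMap.map_add, b2, add_zero]
  -- The same splitting on the `Kᗮ`-component, where the `T†`-term drops out.
  have hSS : ∀ f, ∃ h₃ : S ⟨N f, h₂ f⟩ ∈ S†.domain,
      S† ⟨S ⟨N f, h₂ f⟩, h₃⟩ = f - K.starProjection f := by
    intro f
    have h1 : ∀ z : S.domain, inner ℂ (f - K.starProjection f) (z : F) =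
        inner ℂ (S ⟨N f, h₂ f⟩) (S z) := by
      intro g
      obtain ⟨a1, a2⟩ := (hK _).1 (hP g)
      obtain ⟨b1, b2⟩ := hKp _ (hQ g)
      have c1 : (g : F) - K.starProjection (g : F) ∈ S.domain := S.domain.sub_mem g.2 a1
      have := hv f _ b1 c1
      rw [b2, inner_zero_right, zero_add] at this
      have hg : g = ⟨_, a1⟩ + ⟨_, c1⟩ := Subtype.ext (hdec g)
      conv_rhs => rw [hg, LinearPMap.map_add, a2, zero_add, this]
      rw [inner_sub_left, inner_sub_right, Submodule.inner_starProjection_left_eq_right]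
    exact ⟨LinearPMap.mem_adjoint_domain_of_exists _ ⟨_, h1⟩, LinearPMap.adjoint_apply_eq hS _ h1⟩
  have hen : ∀ f, ‖T† ⟨N f, h₁ f⟩‖ ^ 2 + ‖S ⟨N f, h₂ f⟩‖ ^ 2 ≤ ‖f‖ * ‖N f‖ := by
    intro f
    have := hv f (N f) (h₁ f) (h₂ f)
    rw [inner_self_eq_norm_sq_to_K, inner_self_eq_norm_sq_to_K] at this
    have h2 : (((‖T† ⟨N f, h₁ f⟩‖ ^ 2 + ‖S ⟨N f, h₂ f⟩‖ ^ 2 : ℝ)) : ℂ) = inner ℂ f (N f) := by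
      rw [← this]; push_cast; rfl
    have h3 := norm_inner_le_norm (𝕜 := ℂ) f (N f)
    rw [← h2, Complex.norm_real, Real.norm_of_nonneg (by positivity)] at h3
    exact h3
  have hNn : ∀ f, ‖N f‖ ≤ ‖f‖ := by
    intro f
    have h1 := (hb _ (h₁ f) (h₂ f)).trans (hen f)
    by_contra hc
    push Not at hc
    nlinarith [norm_nonneg f, norm_nonneg (N f)]
  refine ⟨N, ⟨fun f => ?_, fun u => ?_⟩, hN, hNn, fun f => ⟨h₁ f, h₂ f, ?_, ?_, fun hf hf0 => ⟨?_, fun v hv0 => ?_⟩⟩⟩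
  · obtain ⟨a, ha⟩ := hTT f
    obtain ⟨b, hb⟩ := hSS f
    refine ⟨⟨(mem_pcomp_domain _ _ _).2 ⟨h₁ f, a⟩, (mem_pcomp_domain _ _ _).2 ⟨h₂ f, b⟩⟩, ?_⟩
    rw [LinearPMap.add_apply]
    change T ⟨T† ⟨N f, h₁ f⟩, a⟩ + S† ⟨S ⟨N f, h₂ f⟩, b⟩ = f
    rw [ha, hb]; abel
  · obtain ⟨u, hu1, hu2⟩ := u
    obtain ⟨p1, p2⟩ := (mem_pcomp_domain _ _ _).1 hu1
    obtain ⟨q1, q2⟩ := (mem_pcomp_domain _ _ _).1 hu2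
    rw [LinearPMap.add_apply]
    change N (T ⟨T† ⟨u, p1⟩, p2⟩ + S† ⟨S ⟨u, q1⟩, q2⟩) = u
    set f := T ⟨T† ⟨u, p1⟩, p2⟩ + S† ⟨S ⟨u, q1⟩, q2⟩ with hf
    -- `u` satisfies the variational identity that characterizes `N f`, so `N f - u` has zero energy
    -- and `hb` makes it vanish.
    have key : ∀ (g : F) (k : g ∈ T†.domain) (k' : g ∈ S.domain),
        inner ℂ (T† ⟨u, p1⟩) (T† ⟨g, k⟩) + inner ℂ (S ⟨u, q1⟩) (S ⟨g, k'⟩) = inner ℂ f g := by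
      intro g k k'
      rw [hf, inner_add_left, hfs ⟨_, q2⟩ ⟨g, k'⟩, (hfa.symm) ⟨_, p2⟩ ⟨g, k⟩]
    have e1 : N f - u ∈ T†.domain := T†.domain.sub_mem (h₁ f) p1
    have e2 : N f - u ∈ S.domain := S.domain.sub_mem (h₂ f) q1
    have d1 := hv f _ e1 e2
    rw [← key _ e1 e2] at d1
    have t1 : T† ⟨N f - u, e1⟩ = T† ⟨N f, h₁ f⟩ - T† ⟨u, p1⟩ := LinearPMap.map_sub _ ⟨N f, h₁ f⟩ ⟨u, p1⟩
    have t2 : S ⟨N f - u, e2⟩ = S ⟨N f, h₂ f⟩ - S ⟨u, q1⟩ := LinearPMap.map_sub _ ⟨N f, h₂ f⟩ ⟨u, q1⟩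
    have d2 : inner ℂ (T† ⟨N f - u, e1⟩) (T† ⟨N f - u, e1⟩) +
        inner ℂ (S ⟨N f - u, e2⟩) (S ⟨N f - u, e2⟩) = 0 := by
      conv_lhs => enter [1, 2]; rw [t1]
      conv_lhs => enter [2, 2]; rw [t2]
      rw [inner_sub_left, inner_sub_left]
      linear_combination d1
    rw [inner_self_eq_norm_sq_to_K, inner_self_eq_norm_sq_to_K] at d2
    have d3 : ‖T† ⟨N f - u, e1⟩‖ ^ 2 + ‖S ⟨N f - u, e2⟩‖ ^ 2 = 0 := by
      have : (((‖T† ⟨N f - u, e1⟩‖ ^ 2 + ‖S ⟨N f - u, e2⟩‖ ^ 2 : ℝ)) : ℂ) = ((0 : ℝ) : ℂ) := by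
        push_cast; exact d2
      exact_mod_cast this
    have d4 := hb _ e1 e2
    rw [d3] at d4
    have : ‖N f - u‖ = 0 := by nlinarith [norm_nonneg (N f - u)]
    exact sub_eq_zero.1 (norm_eq_zero.1 this)
  · have := hen f
    have h2 := hNn f
    refine le_of_sq_le_sq ?_ (norm_nonneg _)
    nlinarith [norm_nonneg f, sq_nonneg ‖S ⟨N f, h₂ f⟩‖]
  · have := hen f
    have h2 := hNn f
    refine le_of_sq_le_sq ?_ (norm_nonneg _)
    nlinarith [norm_nonneg f, sq_nonneg ‖T† ⟨N f, h₁ f⟩‖]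
  · obtain ⟨a, ha⟩ := hTT f
    exact ⟨a, ha.trans (Submodule.starProjection_eq_self_iff.2 ((hK f).2 ⟨hf, hf0⟩))⟩
  · rw [← (hfa.symm) v ⟨N f, h₁ f⟩, hv0, inner_zero_left]

end Hilbert

/-! ### (Anti)symmetrization of functions already equivariant in all indices but the first. -/

section Alternation

open Equiv

variable {n : ℕ}

/-- The mean of `χ σ • F (A ∘ σ)` over the transpositions `σ = (0 i)`. -/
def alt (χ : Perm (Fin (n + 1)) →* ℤˣ) (F : (Fin (n + 1) → Fin 4) → ℂ) (A : Fin (n + 1) → Fin 4) : ℂ :=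
  ((n + 1 : ℕ) : ℂ)⁻¹ * ∑ i, ((χ (swap 0 i) : ℤ) : ℂ) * F fun m => A (swap 0 i m)

/-- `F` transforms with the character `χ` under the permutations that fix `0`. -/
def StabEquivariant (χ : Perm (Fin (n + 1)) →* ℤˣ) (F : (Fin (n + 1) → Fin 4) → ℂ) : Prop :=
  ∀ σ : Perm (Fin (n + 1)), σ 0 = 0 → ∀ A, F (fun m => A (σ m)) = ((χ σ : ℤ) : ℂ) * F A

/-- `F` transforms with the character `χ` under all permutations. -/
def Equivariant (χ : Perm (Fin n) →* ℤˣ) (F : (Fin n → Fin 4) → ℂ) : Prop :=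
  ∀ σ : Perm (Fin n), ∀ A, F (fun m => A (σ m)) = ((χ σ : ℤ) : ℂ) * F A

theorem char_mul_self (u : ℤˣ) : ((u : ℤ) : ℂ) * ((u : ℤ) : ℂ) = 1 := by
  rw [← Int.cast_mul, ← Units.val_mul, Int.units_mul_self]; simp

/-- The transpositions `(0 i)` represent the cosets of the stabilizer of `0`. Since `(0 σi) σ (0 i)`
fixes `0`, a permutation `σ` merely permutes the summands, up to the character. -/
theorem StabEquivariant.alt {χ : Perm (Fin (n + 1)) →* ℤˣ} {F : (Fin (n + 1) → Fin 4) → ℂ}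
    (hF : StabEquivariant χ F) : Equivariant χ (alt χ F) := by
  intro σ A
  simp only [Massless.alt]
  rw [mul_left_comm]
  congr 1
  rw [Finset.mul_sum, ← Equiv.sum_comp σ fun i => ((χ σ : ℤ) : ℂ) * (((χ (swap 0 i) : ℤ) : ℂ) * F fun m => A (swap 0 i m))]
  refine Finset.sum_congr rfl fun i _ => ?_
  have h := hF (swap 0 (σ i) * σ * swap 0 i) (by simp) (fun m => A (swap 0 (σ i) m))
  simp only [Perm.mul_apply, swap_apply_self] at h
  rw [h, map_mul, map_mul]
  push_cast
  linear_combination (((χ (swap 0 (σ i)) : ℤ) : ℂ) * ((χ σ : ℤ) : ℂ) * F fun m => A (swap 0 (σ i) m)) *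
    char_mul_self (χ (swap 0 i))

theorem Equivariant.sum_conj_mul {χ : Perm (Fin n) →* ℤˣ} {G : (Fin n → Fin 4) → ℂ}
    (hG : Equivariant χ G) (F : (Fin n → Fin 4) → ℂ) (σ : Perm (Fin n)) :
    ∑ A, (starRingEnd ℂ) (G A) * (((χ σ : ℤ) : ℂ) * F fun m => A (σ m)) =
      ∑ A, (starRingEnd ℂ) (G A) * F A := by
  rw [← Equiv.sum_comp (Equiv.arrowCongr σ (Equiv.refl (Fin 4))) fun A => (starRingEnd ℂ) (G A) *
    (((χ σ : ℤ) : ℂ) * F fun m => A (σ m))]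
  refine Finset.sum_congr rfl fun A _ => ?_
  have h1 : (fun m => (Equiv.arrowCongr σ (Equiv.refl (Fin 4))) A (σ m)) = A := by
    ext m; simp
  have h2 := hG σ ((Equiv.arrowCongr σ (Equiv.refl (Fin 4))) A)
  rw [h1] at h2
  rw [h1, h2]
  simp only [map_mul, map_intCast]
  ring

theorem Equivariant.sum_conj_alt {χ : Perm (Fin (n + 1)) →* ℤˣ} {G : (Fin (n + 1) → Fin 4) → ℂ}
    (hG : Equivariant χ G) (F : (Fin (n + 1) → Fin 4) → ℂ) :
    ∑ A, (starRingEnd ℂ) (G A) * Massless.alt χ F A = ∑ A, (starRingEnd ℂ) (G A) * F A := by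
  have h : ∀ A, (starRingEnd ℂ) (G A) * Massless.alt χ F A = ((n + 1 : ℕ) : ℂ)⁻¹ *
      ∑ i, (starRingEnd ℂ) (G A) * (((χ (swap 0 i) : ℤ) : ℂ) * F fun m => A (swap 0 i m)) := by
    intro A; rw [Massless.alt, Finset.mul_sum, Finset.mul_sum, Finset.mul_sum]
    exact Finset.sum_congr rfl fun i _ => by ring
  simp only [h]
  rw [← Finset.mul_sum, Finset.sum_comm]
  simp only [hG.sum_conj_mul, Finset.sum_const, Finset.card_univ, Fintype.card_fin, nsmul_eq_mul]
  rw [← mul_assoc, inv_mul_cancel₀ (by exact_mod_cast n.succ_ne_zero), one_mul]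

/-- Conjugation by an element of the stabilizer of `0` carries each nontrivial `(0 i)` to `(0 1)`,
so these `n` transpositions contribute equally. This ties the norm of the (anti)symmetrization to a
single exchange form. For `n = 0` the index `1` is `0`, but the term has the factor `n`. -/
theorem StabEquivariant.sum_conj_alt {χ : Perm (Fin (n + 1)) →* ℤˣ}
    {F : (Fin (n + 1) → Fin 4) → ℂ} (hF : StabEquivariant χ F) :
    ((n + 1 : ℕ) : ℂ) * ∑ A, (starRingEnd ℂ) (F A) * Massless.alt χ F A =
      ∑ A, (starRingEnd ℂ) (F A) * F A + n * (((χ (swap 0 1) : ℤ) : ℂ) *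
        ∑ A, (starRingEnd ℂ) (F A) * F fun m => A (swap 0 1 m)) := by
  have h : ∀ A, (starRingEnd ℂ) (F A) * Massless.alt χ F A = ((n + 1 : ℕ) : ℂ)⁻¹ *
      ∑ i, (starRingEnd ℂ) (F A) * (((χ (swap 0 i) : ℤ) : ℂ) * F fun m => A (swap 0 i m)) := by
    intro A; rw [Massless.alt, Finset.mul_sum, Finset.mul_sum, Finset.mul_sum]
    exact Finset.sum_congr rfl fun i _ => by ring
  simp only [h]
  rw [← Finset.mul_sum, ← mul_assoc, mul_inv_cancel₀ (by exact_mod_cast n.succ_ne_zero), one_mul,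
    Finset.sum_comm, Fin.sum_univ_succ]
  congr 1
  · have h0 : χ (Equiv.refl (Fin (n + 1))) = 1 := map_one χ
    simp [h0]
  · rw [← nsmul_eq_mul]
    refine (Finset.sum_eq_card_nsmul fun i _ => ?_).trans (by rw [Finset.card_univ, Fintype.card_fin])
    obtain _ | n := n
    · exact i.elim0
    have h01 : (1 : Fin (n + 2)) ≠ 0 := by simp
    set ρ : Perm (Fin (n + 2)) := swap 1 i.succ with hρ
    have hρ0 : ρ 0 = 0 := swap_apply_of_ne_of_ne h01.symm (Fin.succ_ne_zero i).symm
    have hc : swap 0 1 = ρ * swap 0 i.succ * ρ⁻¹ := by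
      rw [← swap_apply_apply, hρ0, hρ, swap_apply_right]
    rw [Finset.mul_sum, ← Equiv.sum_comp (Equiv.arrowCongr ρ (Equiv.refl (Fin 4)))]
    refine Finset.sum_congr rfl fun A _ => ?_
    have h1 : ∀ B, F ((Equiv.arrowCongr ρ (Equiv.refl (Fin 4))) B) = ((χ ρ : ℤ) : ℂ) * F B := by
      intro B
      have := hF ρ⁻¹ (by rw [Perm.inv_eq_iff_eq, hρ0]) B
      rw [map_inv, Int.units_inv_eq_self] at this
      rw [← this]; rfl
    have h2 : (fun m => (Equiv.arrowCongr ρ (Equiv.refl (Fin 4))) A (swap 0 i.succ m)) =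
        (Equiv.arrowCongr ρ (Equiv.refl (Fin 4))) fun m => A (swap 0 1 m) := by
      funext m
      have : ρ⁻¹ * swap 0 i.succ = swap 0 1 * ρ⁻¹ := by
        rw [hc, hρ, swap_inv]; simp [mul_assoc]
      simpa using congrArg (fun τ : Perm (Fin (n + 2)) => A (τ m)) this
    have h3 : χ (swap 0 1) = χ (swap 0 i.succ) := by
      rw [hc, map_mul, map_mul, map_inv, mul_right_comm, mul_inv_cancel, one_mul]
    rw [h2, h1, h1, h3]
    simp only [map_mul, map_intCast]
    linear_combination ((starRingEnd ℂ) (F A) * (((χ (swap 0 i.succ) : ℤ) : ℂ) * F fun m => A (swap 0 1 m))) *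
      char_mul_self (χ ρ)

/-- Every permutation is some `(0 i)` times one that fixes `0`. The second factor is absorbed by
equivariance, and its `n!` choices cancel against the normalization. -/
theorem StabEquivariant.mean_eq_alt {F : (Fin (n + 1) → Fin 4) → ℂ}
    (hF : StabEquivariant Perm.sign F) (A : Fin (n + 1) → Fin 4) :
    ((n + 1).factorial : ℂ)⁻¹ * ∑ σ : Perm (Fin (n + 1)), ((Perm.sign σ : ℤ) : ℂ) *
      F (fun m => A (σ m)) = Massless.alt Perm.sign F A := by
  have h : ∀ (i : Fin (n + 1)) (ρ : Perm (Fin n)),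
      ((Perm.sign (Perm.decomposeFin.symm (i, ρ)) : ℤ) : ℂ) *
        F (fun m => A (Perm.decomposeFin.symm (i, ρ) m)) =
      ((Perm.sign (swap 0 i) : ℤ) : ℂ) * F fun m => A (swap 0 i m) := by
    intro i ρ
    have h1 : Perm.decomposeFin.symm (i, ρ) = swap 0 i * Perm.decomposeFin.symm (0, ρ) := by
      ext m; refine Fin.cases ?_ (fun m => ?_) m <;> simp
    have h2 := hF (Perm.decomposeFin.symm (0, ρ)) (by simp) (fun m => A (swap 0 i m))
    rw [h1]
    simp only [Perm.mul_apply, map_mul]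
    rw [h2]
    push_cast
    linear_combination (((Perm.sign (swap 0 i) : ℤ) : ℂ) * F fun m => A (swap 0 i m)) *
      char_mul_self (Perm.sign (Perm.decomposeFin.symm (0, ρ)))
  rw [← Equiv.sum_comp Perm.decomposeFin.symm, Fintype.sum_prod_type]
  simp only [h, Finset.sum_const, Finset.card_univ, Fintype.card_perm, Fintype.card_fin, nsmul_eq_mul]
  rw [← Finset.mul_sum, ← mul_assoc, Massless.alt]
  congr 1
  rw [Nat.factorial_succ]
  push_cast
  have : (n.factorial : ℂ) ≠ 0 := by exact_mod_cast n.factorial_ne_zero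
  field_simp

theorem sum_cons {M : Type*} [AddCommMonoid M] (F : (Fin (n + 1) → Fin 4) → M) :
    ∑ A, F A = ∑ a : Fin 4, ∑ A : Fin n → Fin 4, F (Fin.cons (α := fun _ => Fin 4) a A) := by
  rw [← Equiv.sum_comp (Fin.consEquiv fun _ : Fin (n + 1) => Fin 4), Fintype.sum_prod_type]
  rfl

theorem cons_comp_swap (c : Fin 4) (B : Fin n → Fin 4) (i : Fin n) :
    (fun m => Fin.cons (α := fun _ => Fin 4) c B (swap 0 i.succ m)) =
      Fin.cons (α := fun _ => Fin 4) (B i) (Function.update B i c) := by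
  ext m
  refine Fin.cases ?_ (fun m => ?_) m
  · simp
  · by_cases h : m = i
    · subst h; simp
    · rw [swap_apply_of_ne_of_ne (Fin.succ_ne_zero _) (fun h' => h (Fin.succ_injective _ h'))]
      simp [h]

theorem cons_cons_comp_swap (a b : Fin 4) (B : Fin n → Fin 4) :
    (fun m => Fin.cons (α := fun _ => Fin 4) a (Fin.cons (α := fun _ => Fin 4) b B) (swap 0 1 m)) =
      Fin.cons (α := fun _ => Fin 4) b (Fin.cons (α := fun _ => Fin 4) a B) := by
  have := cons_comp_swap a (Fin.cons (α := fun _ => Fin 4) b B) 0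
  rw [Fin.update_cons_zero] at this
  exact this

theorem update_eq_comp_swap (B : Fin n → Fin 4) (i k : Fin n) (c : Fin 4) :
    Function.update B i c = fun m => Function.update (fun m => B (swap i k m)) k c (swap i k m) := by
  ext m
  by_cases h : m = i
  · subst h; simp
  · have : swap i k m ≠ k := fun h' => h (by
      have := congrArg (swap i k) h'; simpa using this)
    simp [h, this]

theorem stabEquivariant_of_cons {χ : Perm (Fin (n + 1)) →* ℤˣ} {χ' : Perm (Fin n) →* ℤˣ}
    (hχ : ∀ ρ, χ (Perm.decomposeFin.symm (0, ρ)) = χ' ρ) {F : (Fin (n + 1) → Fin 4) → ℂ}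
    (hF : ∀ a, Equivariant χ' fun A => F (Fin.cons (α := fun _ => Fin 4) a A)) :
    StabEquivariant χ F := by
  intro σ hσ A
  obtain ⟨⟨i, ρ⟩, rfl⟩ := Perm.decomposeFin.symm.surjective σ
  rw [Perm.decomposeFin_symm_apply_zero] at hσ
  subst hσ
  have h := hF (A 0) ρ (fun m => A m.succ)
  have h1 : (Fin.cons (α := fun _ => Fin 4) (A 0) fun m => A m.succ) = A := Fin.cons_self_tail A
  simp only [h1] at h
  rw [hχ, ← h]
  congr 1
  ext m
  refine Fin.cases ?_ (fun m => ?_) m <;> simp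

theorem Equivariant.cons {χ : Perm (Fin (n + 1)) →* ℤˣ} {χ' : Perm (Fin n) →* ℤˣ}
    (hχ : ∀ ρ, χ (Perm.decomposeFin.symm (0, ρ)) = χ' ρ) {F : (Fin (n + 1) → Fin 4) → ℂ}
    (hF : Equivariant χ F) (a : Fin 4) :
    Equivariant χ' fun A => F (Fin.cons (α := fun _ => Fin 4) a A) := by
  intro ρ A
  have := hF (Perm.decomposeFin.symm (0, ρ)) (Fin.cons (α := fun _ => Fin 4) a A)
  rw [hχ] at this
  simp only
  rw [← this]
  congr 1
  ext m
  refine Fin.cases ?_ (fun m => ?_) m <;> simp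

theorem sign_decomposeFin_zero (ρ : Perm (Fin n)) :
    Perm.sign (Perm.decomposeFin.symm (0, ρ)) = Perm.sign ρ := by simp

theorem mem_symExt_iff {p q : ℕ} (ξ : Tensor p q) : ξ ∈ symExt p q ↔
    (∀ A, Equivariant 1 fun B => ξ (B, A)) ∧ ∀ B, Equivariant Perm.sign fun A => ξ (B, A) := by
  constructor
  · rintro ⟨h1, h2⟩
    exact ⟨fun A σ B => by simpa using h1 σ B A, fun B σ A => h2 σ B A⟩
  · rintro ⟨h1, h2⟩
    exact ⟨fun σ B A => by simpa using h1 A σ B, fun σ B A => h2 B σ A⟩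

theorem inner_tensor {p q : ℕ} (ξ ζ : Tensor p q) :
    inner ℂ ξ ζ = ∑ B, ∑ A, (starRingEnd ℂ) (ξ (B, A)) * ζ (B, A) := by
  rw [PiLp.inner_apply, Fintype.sum_prod_type]
  simp only [RCLike.inner_apply, mul_comm]

theorem inner_tensor' {p q : ℕ} (ξ ζ : Tensor p q) :
    inner ℂ ξ ζ = ∑ A, ∑ B, (starRingEnd ℂ) (ξ (B, A)) * ζ (B, A) := by
  rw [inner_tensor, Finset.sum_comm]

end Alternation

/-! ### The contraction, its kernel and its adjoint. -/

section Contraction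

open Equiv

theorem symExt.lower {p q : ℕ} {ξ : Tensor p q} (h : ξ ∈ symExt p q) (σ : Perm (Fin p)) (B A) :
    ξ (fun m => B (σ m), A) = ξ (B, A) := h.1 σ B A

theorem symExt.upper {p q : ℕ} {ξ : Tensor p q} (h : ξ ∈ symExt p q) (σ : Perm (Fin q)) (B A) :
    ξ (B, fun m => A (σ m)) = ((Perm.sign σ : ℤ) : ℂ) * ξ (B, A) := h.2 σ B A

theorem symExt.update_upper {p q : ℕ} {ξ : Tensor p q} (h : ξ ∈ symExt p q) (A : Fin q → Fin 4)
    (j k : Fin q) : ∃ A' : Fin q → Fin 4, ∃ ε : ℂ, ε ≠ 0 ∧ ∀ B c,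
      ξ (B, Function.update A j c) = ε * ξ (B, Function.update A' k c) :=
  ⟨fun m => A (swap j k m), ((Perm.sign (swap j k) : ℤ) : ℂ), by simp, fun B c => by
    rw [update_eq_comp_swap A j k c, symExt.upper h]⟩

theorem symExt.update_lower {p q : ℕ} {ξ : Tensor p q} (h : ξ ∈ symExt p q) (B : Fin p → Fin 4)
    (i k : Fin p) : ∃ B' : Fin p → Fin 4, ∀ A c,
      ξ (Function.update B i c, A) = ξ (Function.update B' k c, A) :=
  ⟨fun m => B (swap i k m), fun A c => by rw [update_eq_comp_swap B i k c, symExt.lower h]⟩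

/-- By (anti)symmetry any subscript may be contracted with any superscript. This form is uniform in
`p` and `q`: if one of them is `0`, the condition is empty. -/
theorem mem_kerC_iff_update {p q : ℕ} (ξ : Tensor p q) : ξ ∈ kerC p q ↔ ξ ∈ symExt p q ∧
    ∀ (i : Fin p) (j : Fin q) B A, ∑ c : Fin 4,
      ξ (Function.update B i c, Function.update A j c) = 0 := by
  obtain _ | p := p
  · exact ⟨fun h => ⟨kerC_le_symExt _ _ h, fun i => i.elim0⟩, fun h => h.1⟩
  obtain _ | q := q
  · exact ⟨fun h => ⟨kerC_le_symExt _ _ h, fun _ i => i.elim0⟩, fun h => h.1⟩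
  rw [mem_kerC_iff]
  refine and_congr_right fun hs => ⟨fun h i j B A => ?_, fun h B A => ?_⟩
  · obtain ⟨B', hB⟩ := symExt.update_lower hs B i (Fin.last p)
    obtain ⟨A', ε, -, hA⟩ := symExt.update_upper hs A j 0
    simp only [hB, hA, ← Finset.mul_sum]
    rw [← mul_zero ε, ← h (Fin.init B') (Fin.tail A')]
    congr 1
    refine Finset.sum_congr rfl fun c _ => ?_
    rw [← Fin.cons_self_tail A', Fin.update_cons_zero, ← Fin.snoc_init_self B', Fin.update_snoc_last]
    simp
  · rw [← h (Fin.last p) 0 (Fin.snoc (α := fun _ => Fin 4) B 0) (Fin.cons (α := fun _ => Fin 4) 0 A)]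
    refine Finset.sum_congr rfl fun c _ => ?_
    rw [Fin.update_cons_zero, Fin.update_snoc_last]

theorem contraction_apply_of_mem {p q : ℕ} {ξ : Tensor (p + 1) (q + 1)}
    (h : ξ ∈ symExt (p + 1) (q + 1)) (B : Fin p → Fin 4) (A : Fin q → Fin 4) :
    contraction p q ξ (B, A) = ∑ c : Fin 4, ξ (Fin.cons (α := fun _ => Fin 4) c B,
      Fin.cons (α := fun _ => Fin 4) c A) := by
  simp only [contraction, LinearMap.coe_mk, AddHom.coe_mk]
  refine Finset.sum_congr rfl fun c _ => ?_
  rw [Fin.snoc_eq_cons_rotate]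
  exact symExt.lower h _ _ _

/-- A double contraction is symmetric in the two subscripts and antisymmetric in the two
superscripts, hence equal to its negative. -/
theorem contraction_mem_kerC {p q : ℕ} {ξ : Tensor (p + 1) (q + 1)}
    (h : ξ ∈ symExt (p + 1) (q + 1)) : contraction p q ξ ∈ kerC p q := by
  have h' := (mem_symExt_iff _).1 h
  rw [mem_kerC_iff_update, mem_symExt_iff]
  refine ⟨⟨fun A σ B => ?_, fun B σ A => ?_⟩, fun i j B A => ?_⟩
  · simp only [contraction_apply_of_mem h, Finset.mul_sum]
    exact Finset.sum_congr rfl fun c _ => (h'.1 _).cons (χ' := 1) (by simp) c σ B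
  · simp only [contraction_apply_of_mem h, Finset.mul_sum]
    exact Finset.sum_congr rfl fun c _ => (h'.2 _).cons sign_decomposeFin_zero c σ A
  · simp only [contraction_apply_of_mem h]
    have hsw : ∀ d c : Fin 4, ξ (Fin.cons (α := fun _ => Fin 4) c (Function.update B i d),
        Fin.cons (α := fun _ => Fin 4) c (Function.update A j d)) =
        -ξ (Fin.cons (α := fun _ => Fin 4) d (Function.update B i c),
          Fin.cons (α := fun _ => Fin 4) d (Function.update A j c)) := by
      intro d c
      have h1 := symExt.lower h (swap 0 i.succ) (Fin.cons (α := fun _ => Fin 4) d (Function.update B i c))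
        (Fin.cons (α := fun _ => Fin 4) c (Function.update A j d))
      have h2 := symExt.upper h (swap 0 j.succ) (Fin.cons (α := fun _ => Fin 4) d (Function.update B i c))
        (Fin.cons (α := fun _ => Fin 4) d (Function.update A j c))
      rw [cons_comp_swap] at h1 h2
      simp only [Function.update_self, Function.update_idem] at h1 h2
      rw [h1, h2, Perm.sign_swap (Fin.succ_ne_zero j).symm]
      simp
    refine self_eq_neg.1 ?_
    conv_lhs => rw [Finset.sum_comm]
    rw [← Finset.sum_neg_distrib]
    refine Finset.sum_congr rfl fun c _ => ?_
    rw [← Finset.sum_neg_distrib]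
    exact Finset.sum_congr rfl fun d _ => hsw _ _

/-- With `L` the restriction of `C` to `H`, the vector `y` is orthogonal to `ker L = ker L^*L`,
hence in the range of the symmetric map `L^*L`. Solving `y = L^*L u` instead of `y = L^* s` places
the preimage `s = C u` in the range of `C`. -/
theorem exists_inner_eq_inner_map {E F : Type*} [NormedAddCommGroup E] [InnerProductSpace ℂ E]
    [FiniteDimensional ℂ E] [NormedAddCommGroup F] [InnerProductSpace ℂ F] [FiniteDimensional ℂ F]
    (C : E →ₗ[ℂ] F) {H : Submodule ℂ E} {y : E} (hy : y ∈ H)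
    (h : ∀ ξ ∈ H, C ξ = 0 → inner ℂ ξ y = 0) :
    ∃ u ∈ H, ∀ ζ ∈ H, inner ℂ ζ y = inner ℂ (C ζ) (C u) := by
  let L : H →ₗ[ℂ] F := C.domRestrict _
  have hsym : (LinearMap.adjoint L ∘ₗ L).IsSymmetric := fun a b => by
    simp only [LinearMap.comp_apply, LinearMap.adjoint_inner_left, LinearMap.adjoint_inner_right]
  have hmem : (⟨y, hy⟩ : H) ∈ LinearMap.range (LinearMap.adjoint L ∘ₗ L) := by
    rw [← Submodule.orthogonal_orthogonal (LinearMap.range (LinearMap.adjoint L ∘ₗ L)),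
      hsym.orthogonal_range, Submodule.mem_orthogonal]
    intro u hu
    refine h u.1 u.2 ?_
    change L u = 0
    rw [LinearMap.mem_ker, LinearMap.comp_apply] at hu
    rw [← inner_self_eq_zero (𝕜 := ℂ), ← LinearMap.adjoint_inner_right, hu, inner_zero_right]
  obtain ⟨u, hu⟩ := hmem
  refine ⟨u, u.2, fun ζ hζ => ?_⟩
  change inner ℂ (⟨ζ, hζ⟩ : H) ⟨y, hy⟩ = inner ℂ (L ⟨ζ, hζ⟩) (L u)
  rw [← hu, LinearMap.comp_apply, LinearMap.adjoint_inner_right]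

/-- A tensor orthogonal to the kernel of the contraction is in the range of its adjoint, with a
preimage in the range of the contraction. -/
theorem exists_inner_eq_inner_contraction {p q : ℕ} {y : Tensor (p + 1) (q + 1)}
    (hy : y ∈ symExt (p + 1) (q + 1)) (h : ∀ ξ ∈ kerC (p + 1) (q + 1), inner ℂ ξ y = 0) :
    ∃ s ∈ kerC p q, ∀ ζ ∈ symExt (p + 1) (q + 1), inner ℂ ζ y = inner ℂ (contraction p q ζ) s := by
  obtain ⟨u, hu, h'⟩ := exists_inner_eq_inner_map (contraction p q) hy fun ξ hξ h0 => h ξ ⟨hξ, h0⟩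
  exact ⟨_, contraction_mem_kerC hu, h'⟩

/-- Fixing the first subscript. -/
def slice {p q : ℕ} (b : Fin 4) (v : Tensor (p + 1) q) : Tensor p q :=
  WithLp.toLp 2 fun BA => v (Fin.cons (α := fun _ => Fin 4) b BA.1, BA.2)

theorem slice_mem_kerC {p q : ℕ} {v : Tensor (p + 1) q} (hv : v ∈ kerC (p + 1) q) (b : Fin 4) :
    slice b v ∈ kerC p q := by
  rw [mem_kerC_iff_update, mem_symExt_iff] at *
  refine ⟨⟨fun A => (hv.1.1 A).cons (χ' := 1) (by simp) b, fun B => hv.1.2 (Fin.cons b B)⟩, fun i j B A => ?_⟩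
  simp only [slice, Fin.cons_update]
  exact hv.2 i.succ j (Fin.cons b B) A

/-- Symmetrization in the subscripts, of a tensor that is symmetric in all subscripts but the
first. -/
def symmetrize {p q : ℕ} (v : Tensor (p + 1) q) : Tensor (p + 1) q :=
  WithLp.toLp 2 fun BA => alt 1 (fun B => v (B, BA.2)) BA.1

/-- Exchange of the first two subscripts. -/
def swapLower {p q : ℕ} : Tensor (p + 2) q →ₗ[ℂ] Tensor (p + 2) q where
  toFun v := WithLp.toLp 2 fun BA => v (fun m => BA.1 (swap 0 1 m), BA.2)
  map_add' _ _ := rfl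
  map_smul' _ _ := rfl

theorem inner_symmetrize {p q : ℕ} {ζ : Tensor (p + 1) q} (hζ : ζ ∈ symExt (p + 1) q)
    (v : Tensor (p + 1) q) : inner ℂ ζ (symmetrize v) = inner ℂ ζ v := by
  rw [inner_tensor', inner_tensor']
  refine Finset.sum_congr rfl fun A _ => ?_
  exact Equivariant.sum_conj_alt (G := fun B => ζ (B, A)) (((mem_symExt_iff _).1 hζ).1 A)
    fun B => v (B, A)

section

variable {p q : ℕ} {v : Tensor (p + 1) q} (hv : ∀ b, slice b v ∈ symExt p q)
include hv

theorem stabEquivariant_of_slice (A : Fin q → Fin 4) : StabEquivariant 1 fun B => v (B, A) :=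
  stabEquivariant_of_cons (χ' := 1) (by simp) fun b => ((mem_symExt_iff _).1 (hv b)).1 A

theorem upper_of_slice (B : Fin (p + 1) → Fin 4) : Equivariant Perm.sign fun A => v (B, A) := by
  intro σ A
  have := ((mem_symExt_iff _).1 (hv (B 0))).2 (Fin.tail B) σ A
  simp only [slice, Fin.cons_self_tail] at this
  exact this

theorem symmetrize_mem_symExt : symmetrize v ∈ symExt (p + 1) q := by
  rw [mem_symExt_iff]
  refine ⟨fun A => (stabEquivariant_of_slice hv A).alt, fun B σ A => ?_⟩
  simp only [symmetrize, alt, upper_of_slice hv _ σ A]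
  rw [mul_left_comm]
  congr 1
  rw [Finset.mul_sum]
  exact Finset.sum_congr rfl fun i _ => by ring

theorem norm_symmetrize_sq : ((‖symmetrize v‖ ^ 2 : ℝ) : ℂ) = inner ℂ v (symmetrize v) := by
  have h := inner_symmetrize (symmetrize_mem_symExt hv) v
  rw [inner_self_eq_norm_sq_to_K] at h
  rw [← inner_conj_symm, ← h]
  simp

end

theorem inner_symmetrize_self {p q : ℕ} {v : Tensor (p + 2) q}
    (hv : ∀ b, slice b v ∈ symExt (p + 1) q) :
    ((p + 2 : ℕ) : ℂ) * inner ℂ v (symmetrize v) =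
      (‖v‖ : ℂ) ^ 2 + ((p + 1 : ℕ) : ℂ) * inner ℂ v (swapLower v) := by
  have h1 : inner ℂ v v = (‖v‖ : ℂ) ^ 2 := inner_self_eq_norm_sq_to_K v
  rw [← h1]
  rw [inner_tensor', inner_tensor', inner_tensor']
  rw [Finset.mul_sum, Finset.mul_sum, ← Finset.sum_add_distrib]
  refine Finset.sum_congr rfl fun A _ => ?_
  have := (stabEquivariant_of_slice hv A).sum_conj_alt
  simp only [MonoidHom.one_apply, Units.val_one, Int.cast_one, one_mul] at this
  exact this

end Contraction

/-! ### The exchange form and the projection to the kernel of the contraction. -/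

section Projection

open Equiv

/-- The tensor `δ^{A₁}_{B₁} s^{A₂…}_{B₂…}`. -/
def deltaMul {p q : ℕ} (s : Tensor p q) : Tensor (p + 1) (q + 1) :=
  WithLp.toLp 2 fun BA => if BA.1 0 = BA.2 0 then s (Fin.tail BA.1, Fin.tail BA.2) else 0

/-- The antisymmetrization of `deltaMul s` in the superscripts. -/
def altDeltaMul {p q : ℕ} (s : Tensor p q) : Tensor (p + 1) (q + 1) :=
  WithLp.toLp 2 fun BA => alt Perm.sign (fun A => deltaMul s (BA.1, A)) BA.2

/-- Multiplication by `δ` is the adjoint of contracting the first subscript with the first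
superscript. -/
theorem inner_deltaMul {p q : ℕ} (G : Tensor (p + 1) (q + 1)) (s : Tensor p q) :
    inner ℂ G (deltaMul s) = ∑ B, ∑ A, (starRingEnd ℂ) (∑ c : Fin 4,
      G (Fin.cons (α := fun _ => Fin 4) c B, Fin.cons (α := fun _ => Fin 4) c A)) * s (B, A) := by
  rw [inner_tensor, sum_cons, Finset.sum_comm]
  refine Finset.sum_congr rfl fun B _ => ?_
  simp only [sum_cons (n := q)]
  simp only [deltaMul, Fin.cons_zero, Fin.tail_cons, mul_ite, mul_zero]
  simp only [map_sum, Finset.sum_mul]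
  calc _ = ∑ c : Fin 4, ∑ A : Fin q → Fin 4, (starRingEnd ℂ) (G (Fin.cons (α := fun _ => Fin 4) c B,
        Fin.cons (α := fun _ => Fin 4) c A)) * s (B, A) := by
        refine Finset.sum_congr rfl fun c _ => ?_
        rw [Finset.sum_comm]
        simp
    _ = _ := Finset.sum_comm

theorem inner_altDeltaMul {p q : ℕ} {G : Tensor (p + 1) (q + 1)}
    (hG : ∀ B, Equivariant Perm.sign fun A => G (B, A)) (s : Tensor p q) :
    inner ℂ G (altDeltaMul s) = inner ℂ G (deltaMul s) := by
  rw [inner_tensor, inner_tensor]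
  refine Finset.sum_congr rfl fun B _ => ?_
  exact Equivariant.sum_conj_alt (G := fun A => G (B, A)) (hG B) fun A => deltaMul s (B, A)

theorem slice_altDeltaMul_mem {p q : ℕ} {s : Tensor p q} (hs : s ∈ symExt p q) (b : Fin 4) :
    slice b (altDeltaMul s) ∈ symExt p (q + 1) := by
  rw [mem_symExt_iff] at *
  refine ⟨fun A σ B => ?_, fun B => ?_⟩
  · have h : ∀ B : Fin p → Fin 4, Fin.tail (Fin.cons (α := fun _ => Fin 4) b B) = B := fun B => by simp
    simp only [slice, altDeltaMul, alt, deltaMul, Fin.cons_zero, h, (hs.1 _ σ B)]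
    simp
  · refine StabEquivariant.alt (F := fun A => deltaMul s (Fin.cons (α := fun _ => Fin 4) b B, A))
      (stabEquivariant_of_cons sign_decomposeFin_zero fun a σ A => ?_)
    simp only [deltaMul, Fin.cons_zero, Fin.tail_cons]
    split_ifs
    · exact hs.2 _ σ A
    · simp

/-- Pairing with `altDeltaMul s` contracts the exchanged tensor. Of the transpositions `(0 i)` in
the alternation, `i = 0` returns `s`, and the others contract a subscript of `s` with a superscript,
giving zero. What matters later is that the value is nonnegative. -/
theorem inner_swapLower_altDeltaMul {p q : ℕ} {s : Tensor (p + 1) q} (hs : s ∈ kerC (p + 1) q) :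
    inner ℂ (swapLower (altDeltaMul s)) (altDeltaMul s) = ((q + 1 : ℕ) : ℂ)⁻¹ * inner ℂ s s := by
  have hs' := kerC_le_symExt _ _ hs
  have hup := fun B => upper_of_slice (slice_altDeltaMul_mem hs') B
  rw [inner_altDeltaMul (G := swapLower (altDeltaMul s)) (fun B =>
    hup fun m => B (swap 0 1 m)), inner_deltaMul, inner_tensor, Finset.mul_sum]
  refine Finset.sum_congr rfl fun B _ => ?_
  rw [Finset.mul_sum]
  refine Finset.sum_congr rfl fun A _ => ?_
  rw [← mul_assoc]
  congr 1
  have key : ∑ c : Fin 4, swapLower (altDeltaMul s) (Fin.cons (α := fun _ => Fin 4) c B,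
      Fin.cons (α := fun _ => Fin 4) c A) = ((q + 1 : ℕ) : ℂ)⁻¹ * s (B, A) := by
    obtain ⟨b, B, rfl⟩ : ∃ b B', B = Fin.cons (α := fun _ => Fin 4) b B' :=
      ⟨B 0, Fin.tail B, (Fin.cons_self_tail B).symm⟩
    change ∑ c : Fin 4, altDeltaMul s (fun m => Fin.cons (α := fun _ => Fin 4) c
      (Fin.cons (α := fun _ => Fin 4) b B) (swap 0 1 m), Fin.cons (α := fun _ => Fin 4) c A) = _
    simp only [cons_cons_comp_swap]
    simp only [altDeltaMul, alt]
    rw [← Finset.mul_sum]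
    congr 1
    rw [Finset.sum_comm, Fin.sum_univ_succ, Finset.sum_eq_zero (s := Finset.univ (α := Fin q)), add_zero]
    · simp [deltaMul]
    · intro i _
      simp only [cons_comp_swap, deltaMul, Fin.cons_zero, Fin.tail_cons]
      split_ifs
      · rw [← Finset.mul_sum]
        have := ((mem_kerC_iff_update _).1 hs).2 0 i (Fin.cons (α := fun _ => Fin 4) 0 B) A
        simp only [Fin.update_cons_zero] at this
        rw [this, mul_zero]
      · simp
  rw [key]
  simp

/-- Only the trivial transposition survives: for the others the contracted pair of indices lies
inside a slice of `v`, which is in the kernel of the contraction. -/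
theorem contraction_symmetrize {p q : ℕ} {v : Tensor (p + 2) (q + 1)}
    (hv : ∀ b, slice b v ∈ kerC (p + 1) (q + 1)) (B : Fin (p + 1) → Fin 4) (A : Fin q → Fin 4) :
    contraction (p + 1) q (symmetrize v) (B, A) = ((p + 2 : ℕ) : ℂ)⁻¹ * ∑ c : Fin 4,
      v (Fin.cons (α := fun _ => Fin 4) c B, Fin.cons (α := fun _ => Fin 4) c A) := by
  have hv' := fun b => kerC_le_symExt _ _ (hv b)
  rw [contraction_apply_of_mem (symmetrize_mem_symExt hv')]
  simp only [symmetrize, alt]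
  rw [← Finset.mul_sum]
  congr 1
  rw [Finset.sum_comm, Fin.sum_univ_succ, Finset.sum_eq_zero (s := Finset.univ (α := Fin (p + 1))), add_zero]
  · simp
  · intro i _
    simp only [cons_comp_swap, MonoidHom.one_apply, Units.val_one, Int.cast_one, one_mul]
    have := ((mem_kerC_iff_update _).1 (hv (B i))).2 i 0 B (Fin.cons (α := fun _ => Fin 4) 0 A)
    simp only [Fin.update_cons_zero] at this
    exact this

theorem inner_symmetrize_deltaMul {p q : ℕ} {v : Tensor (p + 2) (q + 1)}
    (hv : ∀ b, slice b v ∈ kerC (p + 1) (q + 1)) (s : Tensor (p + 1) q) :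
    inner ℂ v (deltaMul s) =
      ((p + 2 : ℕ) : ℂ) * inner ℂ (contraction (p + 1) q (symmetrize v)) s := by
  rw [inner_deltaMul, inner_tensor, Finset.mul_sum]
  refine Finset.sum_congr rfl fun B _ => ?_
  rw [Finset.mul_sum]
  refine Finset.sum_congr rfl fun A _ => ?_
  rw [contraction_symmetrize hv, map_mul, map_inv₀, Complex.conj_natCast, ← mul_assoc, ← mul_assoc,
    mul_inv_cancel₀ (by exact_mod_cast (p + 1).succ_ne_zero), one_mul]

/-- The symmetrization `y` of `v` is orthogonal to the kernel of the contraction, so it is `𝒞^* s`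
for some `s`. The tensor `z = altDeltaMul s`, which symmetrizes to `y`, satisfies `⟨v, z⟩ = (p +
2)‖y‖²` and `‖z‖² ≤ (p + 2)‖y‖²`; Cauchy–Schwarz concludes. The gain of `p + 2` over the trivial
bound `‖y‖ ≤ ‖v‖` is what makes the exchange form nonpositive on such `v`. -/
theorem norm_symmetrize_le {p q : ℕ} {v : Tensor (p + 2) q}
    (hv : ∀ b, slice b v ∈ kerC (p + 1) q) (h0 : ∀ ξ ∈ kerC (p + 2) q, inner ℂ ξ v = 0) :
    (p + 2 : ℝ) * ‖symmetrize v‖ ^ 2 ≤ ‖v‖ ^ 2 := by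
  have hv' := fun b => kerC_le_symExt _ _ (hv b)
  have hy := symmetrize_mem_symExt hv'
  obtain _ | q := q
  -- Without superscripts the kernel is the whole space of symmetric tensors, so `v` is orthogonal
  -- to its own symmetrization, which therefore vanishes.
  · have h1 := norm_symmetrize_sq hv'
    rw [← inner_conj_symm, h0 _ hy, map_zero] at h1
    have h2 : ‖symmetrize v‖ ^ 2 = 0 := by exact_mod_cast h1
    rw [h2]; simp
  set y := symmetrize v with hyd
  obtain ⟨s, hs, hsy⟩ := exists_inner_eq_inner_contraction hy fun ξ hξ => by
    rw [hyd, inner_symmetrize (kerC_le_symExt _ _ hξ), h0 ξ hξ]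
  have hs' := kerC_le_symExt _ _ hs
  set z := altDeltaMul s with hz
  have hzs := slice_altDeltaMul_mem hs'
  have hyy : inner ℂ y y = ((‖y‖ ^ 2 : ℝ) : ℂ) := by
    rw [inner_self_eq_norm_sq_to_K]; simp
  -- `⟨v, z⟩ = (p + 2) ‖y‖²`
  have hvz : inner ℂ v z = ((p + 2 : ℕ) : ℂ) * ((‖y‖ ^ 2 : ℝ) : ℂ) := by
    rw [hz, inner_altDeltaMul (fun B => upper_of_slice hv' B), inner_symmetrize_deltaMul hv,
      ← hsy _ hy, hyy]
  have hcd : ∀ h ∈ symExt (p + 2) (q + 1), inner ℂ h z = inner ℂ h y := by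
    intro h hh
    rw [hz, inner_altDeltaMul ((mem_symExt_iff _).1 hh).2, hsy h hh, inner_deltaMul, inner_tensor]
    simp only [contraction_apply_of_mem hh]
  have hzz : inner ℂ z (symmetrize z) = ((‖y‖ ^ 2 : ℝ) : ℂ) := by
    have hm := symmetrize_mem_symExt hzs
    rw [← inner_conj_symm, hcd _ hm, inner_conj_symm, inner_symmetrize hy, hcd _ hy, hyy]
  -- In fact `‖z‖² = (p + 2)‖y‖² - (p + 1)/(q + 1) ‖s‖²`.
  have hz2 : ‖z‖ ^ 2 ≤ (p + 2 : ℝ) * ‖y‖ ^ 2 := by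
    have h1 := inner_symmetrize_self hzs
    rw [hzz, ← inner_conj_symm, inner_swapLower_altDeltaMul hs, inner_self_eq_norm_sq_to_K, ← hz] at h1
    have h2 : ((p + 2 : ℕ) : ℝ) * ‖y‖ ^ 2 =
        ‖z‖ ^ 2 + ((p + 1 : ℕ) : ℝ) * (((q + 1 : ℕ) : ℝ)⁻¹ * ‖s‖ ^ 2) := by
      have h3 : (((((p + 2 : ℕ) : ℝ) * ‖y‖ ^ 2 : ℝ)) : ℂ) =
          ((‖z‖ ^ 2 + ((p + 1 : ℕ) : ℝ) * (((q + 1 : ℕ) : ℝ)⁻¹ * ‖s‖ ^ 2) : ℝ) : ℂ) := by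
        push_cast
        push_cast at h1
        rw [h1]
        simp
      exact_mod_cast h3
    have h4 : 0 ≤ ((p + 1 : ℕ) : ℝ) * (((q + 1 : ℕ) : ℝ)⁻¹ * ‖s‖ ^ 2) := by positivity
    push_cast at h2 h4
    linarith
  have hcs : (p + 2 : ℝ) * ‖y‖ ^ 2 ≤ ‖v‖ * ‖z‖ := by
    have h1 := norm_inner_le_norm (𝕜 := ℂ) v z
    rw [hvz, norm_mul, Complex.norm_natCast, Complex.norm_real, Real.norm_of_nonneg (by positivity)] at h1
    push_cast at h1
    exact h1
  have h5 : ((p + 2 : ℝ) * ‖y‖ ^ 2) * ((p + 2 : ℝ) * ‖y‖ ^ 2) ≤ ‖v‖ ^ 2 * ((p + 2 : ℝ) * ‖y‖ ^ 2) := by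
    calc _ ≤ (‖v‖ * ‖z‖) * (‖v‖ * ‖z‖) := mul_self_le_mul_self (by positivity) hcs
      _ = ‖v‖ ^ 2 * ‖z‖ ^ 2 := by ring
      _ ≤ _ := mul_le_mul_of_nonneg_left hz2 (by positivity)
  by_cases hy0 : (p + 2 : ℝ) * ‖y‖ ^ 2 = 0
  · rw [hy0]; positivity
  · exact le_of_mul_le_mul_right h5 (lt_of_le_of_ne (by positivity) (Ne.symm hy0))

theorem inner_swapLower_left {p q : ℕ} (v w : Tensor (p + 2) q) :
    inner ℂ (swapLower v) w = inner ℂ v (swapLower w) := by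
  rw [inner_tensor', inner_tensor']
  refine Finset.sum_congr rfl fun A _ => ?_
  rw [← Equiv.sum_comp (Equiv.arrowCongr (swap (0 : Fin (p + 2)) 1) (Equiv.refl (Fin 4)))]
  refine Finset.sum_congr rfl fun B _ => ?_
  have h : ∀ u : Tensor (p + 2) q, swapLower u ((Equiv.arrowCongr (swap (0 : Fin (p + 2)) 1) (Equiv.refl (Fin 4))) B, A) = u (B, A) := by
    intro u
    change u (fun m => (Equiv.arrowCongr (swap (0 : Fin (p + 2)) 1) (Equiv.refl (Fin 4))) B (swap 0 1 m), A) = _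
    simp
  rw [h]
  congr 1

theorem swapLower_of_mem {p q : ℕ} {x : Tensor (p + 2) q} (hx : x ∈ symExt (p + 2) q) :
    swapLower x = x := by
  ext BA
  exact symExt.lower hx _ _ _

/-- The exchange form is bounded above by the norm of the projection to the kernel of the
contraction. -/
theorem re_inner_swapLower_le {p q : ℕ} {v x : Tensor (p + 2) q}
    (hv : ∀ b, slice b v ∈ kerC (p + 1) q) (hx : x ∈ kerC (p + 2) q)
    (h : ∀ ξ ∈ kerC (p + 2) q, inner ℂ ξ v = inner ℂ ξ x) :
    (inner ℂ (swapLower v) v).re ≤ ‖x‖ ^ 2 := by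
  have hw : ∀ b, slice b (v - x) ∈ kerC (p + 1) q := fun b =>
    (kerC (p + 1) q).sub_mem (hv b) (slice_mem_kerC hx b)
  have hw0 : ∀ ξ ∈ kerC (p + 2) q, inner ℂ ξ (v - x) = 0 := fun ξ hξ => by
    rw [inner_sub_right, h ξ hξ, sub_self]
  have h1 := norm_symmetrize_le hw hw0
  have hw' := fun b => kerC_le_symExt _ _ (hw b)
  have h2 := inner_symmetrize_self hw'
  rw [← norm_symmetrize_sq hw'] at h2
  have h3 := congrArg Complex.re h2
  rw [Complex.add_re, ← Complex.ofReal_natCast, ← Complex.ofReal_natCast, Complex.re_ofReal_mul,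
    Complex.re_ofReal_mul, ← Complex.ofReal_pow, Complex.ofReal_re, Complex.ofReal_re] at h3
  have hxs := swapLower_of_mem (kerC_le_symExt _ _ hx)
  -- The exchange fixes `x`, and `w = v - x` is orthogonal to `x`, so there are no cross terms. On
  -- the remainder, `(p + 2)⟨w, τw⟩ - ⟨w, τw⟩ = (p + 2)‖symmetrize w‖² - ‖w‖² ≤ 0`.
  have h4 : inner ℂ (swapLower v) v = inner ℂ x x + inner ℂ (v - x) (swapLower (v - x)) := by
    have e1 : inner ℂ x v = inner ℂ x x := h x hx
    have e2 : inner ℂ v x = inner ℂ x x := by rw [← inner_conj_symm, e1, inner_conj_symm]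
    rw [map_sub, hxs, inner_sub_left, inner_sub_right, inner_sub_right, inner_swapLower_left, e2,
      ← inner_swapLower_left x, hxs, e1]
    ring
  have h5 : (inner ℂ x x).re = ‖x‖ ^ 2 := by
    rw [inner_self_eq_norm_sq_to_K]; norm_cast
  rw [h4, Complex.add_re, h5]
  push_cast at h3
  nlinarith

end Projection

/-! ### Raising and lowering indices with the symbol matrices. -/

section Symbols

open Equiv

/-- `(lowerMul M f)^{A₂…}_{B₁B₂…} = ∑_a conj(M^{B₁ a}) f^{a A₂…}_{B₂…}`. -/
def lowerMul {p q : ℕ} (M : Matrix (Fin 4) (Fin 4) ℂ) : Tensor p (q + 1) →ₗ[ℂ] Tensor (p + 1) q where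
  toFun f := WithLp.toLp 2 fun BA => ∑ a : Fin 4, (starRingEnd ℂ) (M (BA.1 0) a) *
    f (Fin.tail BA.1, Fin.cons (α := fun _ => Fin 4) a BA.2)
  map_add' f g := by ext BA; simp [mul_add, Finset.sum_add_distrib]
  map_smul' c f := by ext BA; simp [Finset.mul_sum, mul_left_comm]

/-- `(raiseMul M ξ)^{A₁A₂…}_{B…} = ∑_b M^{b A₁} ξ^{A₂…}_{b B…}`. -/
def raiseMul {p q : ℕ} (M : Matrix (Fin 4) (Fin 4) ℂ) : Tensor (p + 1) q →ₗ[ℂ] Tensor p (q + 1) where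
  toFun ξ := WithLp.toLp 2 fun BA => ∑ b : Fin 4, M b (BA.2 0) *
    ξ (Fin.cons (α := fun _ => Fin 4) b BA.1, Fin.tail BA.2)
  map_add' f g := by ext BA; simp [mul_add, Finset.sum_add_distrib]
  map_smul' c f := by ext BA; simp [Finset.mul_sum, mul_left_comm]

/-- Alternation in the superscripts, of a tensor that is antisymmetric in all superscripts but the
first. -/
def altUpper {p q : ℕ} : Tensor p (q + 1) →ₗ[ℂ] Tensor p (q + 1) where
  toFun u := WithLp.toLp 2 fun BA => alt Perm.sign (fun A => u (BA.1, A)) BA.2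
  map_add' f g := by ext BA; simp [alt, mul_add, Finset.sum_add_distrib]
  map_smul' c f := by ext BA; simp [alt, Finset.mul_sum, mul_left_comm]

/-- Exchange of the first two superscripts. -/
def swapUpper {p q : ℕ} : Tensor p (q + 2) →ₗ[ℂ] Tensor p (q + 2) where
  toFun v := WithLp.toLp 2 fun BA => v (BA.1, fun m => BA.2 (swap 0 1 m))
  map_add' _ _ := rfl
  map_smul' _ _ := rfl

theorem stabEquivariant_raiseMul {p q : ℕ} (M : Matrix (Fin 4) (Fin 4) ℂ) {ξ : Tensor (p + 1) q}
    (hξ : ξ ∈ symExt (p + 1) q) (B : Fin p → Fin 4) :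
    StabEquivariant Perm.sign fun A => raiseMul M ξ (B, A) := by
  refine stabEquivariant_of_cons sign_decomposeFin_zero fun a σ A => ?_
  simp only [raiseMul, LinearMap.coe_mk, AddHom.coe_mk, Fin.cons_zero, Fin.tail_cons,
    Finset.mul_sum]
  refine Finset.sum_congr rfl fun b _ => ?_
  rw [symExt.upper hξ]; ring

theorem symbolAux_eq_altUpper {p q : ℕ} (M : Matrix (Fin 4) (Fin 4) ℂ) {ξ : Tensor (p + 1) q}
    (hξ : ξ ∈ symExt (p + 1) q) : symbolAux p q M ξ = altUpper (raiseMul M ξ) := by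
  ext BA
  exact (stabEquivariant_raiseMul M hξ BA.1).mean_eq_alt BA.2

theorem inner_altUpper {p q : ℕ} {f : Tensor p (q + 1)}
    (hf : ∀ B, Equivariant Perm.sign fun A => f (B, A)) (u : Tensor p (q + 1)) :
    inner ℂ f (altUpper u) = inner ℂ f u := by
  rw [inner_tensor, inner_tensor]
  refine Finset.sum_congr rfl fun B _ => ?_
  exact Equivariant.sum_conj_alt (G := fun A => f (B, A)) (hf B) fun A => u (B, A)

theorem inner_raiseMul {p q : ℕ} (M : Matrix (Fin 4) (Fin 4) ℂ) (f : Tensor p (q + 1))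
    (ξ : Tensor (p + 1) q) : inner ℂ f (raiseMul M ξ) = inner ℂ (lowerMul M f) ξ := by
  rw [inner_tensor, inner_tensor, sum_cons (n := p)]
  conv_rhs => rw [Finset.sum_comm]
  refine Finset.sum_congr rfl fun B _ => ?_
  simp only [sum_cons (n := q), raiseMul, lowerMul, LinearMap.coe_mk, AddHom.coe_mk, Fin.cons_zero,
    Fin.tail_cons, map_sum, map_mul, Complex.conj_conj, Finset.mul_sum, Finset.sum_mul]
  rw [Finset.sum_comm]
  conv_rhs => rw [Finset.sum_comm]
  refine Finset.sum_congr rfl fun A _ => ?_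
  rw [Finset.sum_comm]
  refine Finset.sum_congr rfl fun b _ => Finset.sum_congr rfl fun a _ => ?_
  ring

theorem inner_symbolAux {p q : ℕ} (M : Matrix (Fin 4) (Fin 4) ℂ) {ξ : Tensor (p + 1) q}
    (hξ : ξ ∈ symExt (p + 1) q) {f : Tensor p (q + 1)}
    (hf : ∀ B, Equivariant Perm.sign fun A => f (B, A)) :
    inner ℂ f (symbolAux p q M ξ) = inner ℂ (lowerMul M f) ξ := by
  rw [symbolAux_eq_altUpper M hξ, inner_altUpper hf, inner_raiseMul]

theorem sum_cons_cons {n : ℕ} {M : Type*} [AddCommMonoid M] (F : (Fin (n + 2) → Fin 4) → M) :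
    ∑ A, F A = ∑ A : Fin n → Fin 4, ∑ a : Fin 4, ∑ b : Fin 4,
      F (Fin.cons (α := fun _ => Fin 4) a (Fin.cons (α := fun _ => Fin 4) b A)) := by
  rw [sum_cons]
  simp only [sum_cons (n := n)]
  conv_rhs => rw [Finset.sum_comm]
  exact Finset.sum_congr rfl fun a _ => Finset.sum_comm

theorem sum_comm_four (F : Fin 4 → Fin 4 → Fin 4 → Fin 4 → ℂ) :
    ∑ a, ∑ b, ∑ c, ∑ d, F a b c d = ∑ c, ∑ d, ∑ a, ∑ b, F a b c d := by
  have := Finset.sum_comm (s := Finset.univ) (t := Finset.univ)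
    (f := fun (x y : Fin 4 × Fin 4) => F x.1 x.2 y.1 y.2)
  simpa only [Fintype.sum_prod_type] using this

theorem inner_swapUpper_raiseMul {p q : ℕ} (M N : Matrix (Fin 4) (Fin 4) ℂ)
    (f g : Tensor (p + 1) (q + 1)) :
    inner ℂ (swapUpper (raiseMul N f)) (raiseMul M g) = ∑ B : Fin p → Fin 4,
      ∑ A : Fin q → Fin 4, ∑ b₀ : Fin 4, ∑ b₁ : Fin 4, ∑ a₀ : Fin 4, ∑ a₁ : Fin 4,
      M b₁ a₀ * (starRingEnd ℂ) (N b₀ a₁) *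
      ((starRingEnd ℂ) (f (Fin.cons (α := fun _ => Fin 4) b₀ B, Fin.cons (α := fun _ => Fin 4) a₀ A)) *
      g (Fin.cons (α := fun _ => Fin 4) b₁ B, Fin.cons (α := fun _ => Fin 4) a₁ A)) := by
  have h2 : ∀ (a₀ a₁ : Fin 4) (B : Fin p → Fin 4) (A : Fin q → Fin 4),
      swapUpper (raiseMul N f) (B, Fin.cons (α := fun _ => Fin 4) a₀
        (Fin.cons (α := fun _ => Fin 4) a₁ A)) =
      raiseMul N f (B, Fin.cons (α := fun _ => Fin 4) a₁ (Fin.cons (α := fun _ => Fin 4) a₀ A)) := by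
    intro b₀ b₁ B A
    change raiseMul N f (B, fun m => Fin.cons (α := fun _ => Fin 4) b₀
        (Fin.cons (α := fun _ => Fin 4) b₁ A) (swap 0 1 m)) = _
    rw [cons_cons_comp_swap]
  rw [inner_tensor]
  refine Finset.sum_congr rfl fun B _ => ?_
  rw [sum_cons_cons]
  refine Finset.sum_congr rfl fun A _ => ?_
  rw [← sum_comm_four]
  refine Finset.sum_congr rfl fun a₀ _ => Finset.sum_congr rfl fun a₁ _ => ?_
  rw [h2]
  simp only [raiseMul, LinearMap.coe_mk, AddHom.coe_mk, Fin.cons_zero, Fin.tail_cons]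
  rw [map_sum, Finset.sum_mul_sum]
  refine Finset.sum_congr rfl fun b₀ _ => Finset.sum_congr rfl fun b₁ _ => ?_
  rw [map_mul]; ring

/-- Exchanging subscripts after lowering amounts to exchanging superscripts after raising. -/
theorem inner_swapLower_lowerMul {p q : ℕ} (M N : Matrix (Fin 4) (Fin 4) ℂ)
    (f g : Tensor (p + 1) (q + 1)) :
    inner ℂ (swapLower (lowerMul M f)) (lowerMul N g) =
      inner ℂ (swapUpper (raiseMul N f)) (raiseMul M g) := by
  have h1 : ∀ (b₀ b₁ : Fin 4) (B : Fin p → Fin 4) (A : Fin q → Fin 4),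
      swapLower (lowerMul M f) (Fin.cons (α := fun _ => Fin 4) b₀
        (Fin.cons (α := fun _ => Fin 4) b₁ B), A) =
      lowerMul M f (Fin.cons (α := fun _ => Fin 4) b₁ (Fin.cons (α := fun _ => Fin 4) b₀ B), A) := by
    intro b₀ b₁ B A
    change lowerMul M f (fun m => Fin.cons (α := fun _ => Fin 4) b₀
        (Fin.cons (α := fun _ => Fin 4) b₁ B) (swap 0 1 m), A) = _
    rw [cons_cons_comp_swap]
  rw [inner_swapUpper_raiseMul, inner_tensor']
  simp only [sum_cons_cons (n := p)]
  rw [Finset.sum_comm]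
  refine Finset.sum_congr rfl fun B _ => Finset.sum_congr rfl fun A _ =>
    Finset.sum_congr rfl fun b₀ _ => Finset.sum_congr rfl fun b₁ _ => ?_
  rw [h1]
  simp only [lowerMul, LinearMap.coe_mk, AddHom.coe_mk, Fin.cons_zero, Fin.tail_cons]
  rw [map_sum, Finset.sum_mul_sum]
  refine Finset.sum_congr rfl fun a₀ _ => Finset.sum_congr rfl fun a₁ _ => ?_
  rw [map_mul, Complex.conj_conj]; ring

/-- The matrices `embed (e j)` over the Gaussian integers. -/
def gaussianEmbed : Fin 6 → Matrix (Fin 4) (Fin 4) GaussianInt :=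
  ![!![0, ⟨0, 1⟩, 0, 0; ⟨0, -1⟩, 0, 0, 0; 0, 0, 0, ⟨0, -1⟩; 0, 0, ⟨0, 1⟩, 0],
    !![0, 0, 0, 1; 0, 0, 1, 0; 0, -1, 0, 0; -1, 0, 0, 0],
    !![0, 0, 0, ⟨0, 1⟩; 0, 0, ⟨0, -1⟩, 0; 0, ⟨0, 1⟩, 0, 0; ⟨0, -1⟩, 0, 0, 0],
    !![0, 0, 1, 0; 0, 0, 0, -1; -1, 0, 0, 0; 0, 1, 0, 0],
    !![0, 0, ⟨0, 1⟩, 0; 0, 0, 0, ⟨0, 1⟩; ⟨0, -1⟩, 0, 0, 0; 0, ⟨0, -1⟩, 0, 0],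
    !![0, 1, 0, 0; -1, 0, 0, 0; 0, 0, 0, 1; 0, 0, -1, 0]]

theorem embed_e (j : Fin 6) (a b : Fin 4) :
    embed (e j) a b = GaussianInt.toComplex (gaussianEmbed j a b) := by
  have h : ∀ j i : Fin 6, e j i = if i = j then 1 else 0 := fun j i => by simp [e, eq_comm]
  fin_cases j <;> fin_cases a <;> fin_cases b <;>
    simp [embed, h, gaussianEmbed, GaussianInt.toComplex_def]

/-- The completeness relation of the matrices `embed (e j)`. -/
theorem sum_embed_mul_conj (b₁ a₀ b₀ a₁ : Fin 4) :
    ∑ j, embed (e j) b₁ a₀ * (starRingEnd ℂ) (embed (e j) b₀ a₁) =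
      2 * ((if b₁ = b₀ then 1 else 0) * (if a₀ = a₁ then 1 else 0) -
        (if b₁ = a₁ then 1 else 0) * (if a₀ = b₀ then 1 else 0)) := by
  -- Over the Gaussian integers these are `4⁴` identities with decidable equality, settled by
  -- computation.
  have h : ∀ b₁ a₀ b₀ a₁ : Fin 4, ∑ j, gaussianEmbed j b₁ a₀ * star (gaussianEmbed j b₀ a₁) =
      2 * ((if b₁ = b₀ then 1 else 0) * (if a₀ = a₁ then 1 else 0) -
        (if b₁ = a₁ then 1 else 0) * (if a₀ = b₀ then 1 else 0)) := by decide +kernel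
  have h' := congrArg GaussianInt.toComplex (h b₁ a₀ b₀ a₁)
  simp only [map_sum, map_mul, map_sub, GaussianInt.toComplex_star] at h'
  simp only [embed_e, h', apply_ite GaussianInt.toComplex, map_one, map_zero, map_ofNat]

/-- The completeness relation leaves two terms: one is twice the squared norm of `F`, the other is a
multiple of `|tr F|²`, which vanishes. -/
theorem sum_embed_contract (F : Fin 4 → Fin 4 → ℂ) (hF : ∑ c, F c c = 0) :
    ∑ j, ∑ b₀, ∑ b₁, ∑ a₀, ∑ a₁, embed (e j) b₁ a₀ * (starRingEnd ℂ) (embed (e j) b₀ a₁) *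
      ((starRingEnd ℂ) (F b₀ a₀) * F b₁ a₁) = 2 * ∑ b, ∑ a, (starRingEnd ℂ) (F b a) * F b a := by
  have h1 : ∑ j, ∑ b₀, ∑ b₁, ∑ a₀, ∑ a₁, embed (e j) b₁ a₀ * (starRingEnd ℂ) (embed (e j) b₀ a₁) *
      ((starRingEnd ℂ) (F b₀ a₀) * F b₁ a₁) = ∑ b₀, ∑ b₁, ∑ a₀, ∑ a₁,
      (∑ j, embed (e j) b₁ a₀ * (starRingEnd ℂ) (embed (e j) b₀ a₁)) *
      ((starRingEnd ℂ) (F b₀ a₀) * F b₁ a₁) := by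
    rw [Finset.sum_comm]
    refine Finset.sum_congr rfl fun b₀ _ => ?_
    rw [Finset.sum_comm]
    refine Finset.sum_congr rfl fun b₁ _ => ?_
    rw [Finset.sum_comm]
    refine Finset.sum_congr rfl fun a₀ _ => ?_
    rw [Finset.sum_comm]
    exact Finset.sum_congr rfl fun a₁ _ => (Finset.sum_mul _ _ _).symm
  have h2 : ∑ b₀, ∑ b₁, ∑ a₀, ∑ a₁, (if b₁ = b₀ then 1 else 0) * (if a₀ = a₁ then 1 else 0) *
      ((starRingEnd ℂ) (F b₀ a₀) * F b₁ a₁) = ∑ b, ∑ a, (starRingEnd ℂ) (F b a) * F b a := by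
    simp
  have h3 : ∑ b₀, ∑ b₁, ∑ a₀, ∑ a₁, (if b₁ = a₁ then 1 else 0) * (if a₀ = b₀ then 1 else 0) *
      ((starRingEnd ℂ) (F b₀ a₀) * F b₁ a₁) = (starRingEnd ℂ) (∑ c, F c c) * ∑ c, F c c := by
    rw [map_sum, Finset.sum_mul_sum]
    simp
  rw [hF, mul_zero] at h3
  have h4 : ∑ b₀, ∑ b₁, ∑ a₀, ∑ a₁,
      (∑ j, embed (e j) b₁ a₀ * (starRingEnd ℂ) (embed (e j) b₀ a₁)) *
      ((starRingEnd ℂ) (F b₀ a₀) * F b₁ a₁) = 2 * (∑ b₀, ∑ b₁, ∑ a₀, ∑ a₁, (if b₁ = b₀ then 1 else 0) * (if a₀ = a₁ then 1 else 0) *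
      ((starRingEnd ℂ) (F b₀ a₀) * F b₁ a₁)) - 2 * (∑ b₀, ∑ b₁, ∑ a₀, ∑ a₁, (if b₁ = a₁ then 1 else 0) * (if a₀ = b₀ then 1 else 0) *
      ((starRingEnd ℂ) (F b₀ a₀) * F b₁ a₁)) := by
    simp only [sum_embed_mul_conj, Finset.mul_sum, ← Finset.sum_sub_distrib]
    refine Finset.sum_congr rfl fun b₀ _ => Finset.sum_congr rfl fun b₁ _ =>
      Finset.sum_congr rfl fun a₀ _ => Finset.sum_congr rfl fun a₁ _ => ?_
    ring
  rw [h1, h4, h2, h3, mul_zero, sub_zero]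

/-- The source of positivity in the a priori estimate. With all other indices fixed, the first
subscript and superscript of `f` form a trace-free `4 × 4` matrix, to which `sum_embed_contract`
applies. -/
theorem sum_inner_swapLower_self {p q : ℕ} {f : Tensor (p + 1) (q + 1)}
    (hf : f ∈ kerC (p + 1) (q + 1)) :
    ∑ j, inner ℂ (swapLower (lowerMul (embed (e j)) f)) (lowerMul (embed (e j)) f) =
      2 * inner ℂ f f := by
  simp only [inner_swapLower_lowerMul, inner_swapUpper_raiseMul]
  have e1 : inner ℂ f f = ∑ B : Fin p → Fin 4, ∑ A : Fin q → Fin 4, ∑ b : Fin 4, ∑ a : Fin 4,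
      (starRingEnd ℂ) (f (Fin.cons (α := fun _ => Fin 4) b B, Fin.cons (α := fun _ => Fin 4) a A)) *
        f (Fin.cons (α := fun _ => Fin 4) b B, Fin.cons (α := fun _ => Fin 4) a A) := by
    rw [inner_tensor, sum_cons (n := p), Finset.sum_comm]
    refine Finset.sum_congr rfl fun B _ => ?_
    simp only [sum_cons (n := q)]
    conv_rhs => rw [Finset.sum_comm]
    exact Finset.sum_congr rfl fun b _ => Finset.sum_comm
  rw [e1, Finset.sum_comm, Finset.mul_sum]
  refine Finset.sum_congr rfl fun B _ => ?_
  rw [Finset.sum_comm, Finset.mul_sum]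
  refine Finset.sum_congr rfl fun A _ => ?_
  refine sum_embed_contract (fun b a => f (Fin.cons (α := fun _ => Fin 4) b B,
    Fin.cons (α := fun _ => Fin 4) a A)) ?_
  have := ((mem_kerC_iff_update _).1 hf).2 0 0 (Fin.cons (α := fun _ => Fin 4) 0 B)
    (Fin.cons (α := fun _ => Fin 4) 0 A)
  simpa only [Fin.update_cons_zero] using this

theorem lowerMul_slice_mem {p q : ℕ} (M : Matrix (Fin 4) (Fin 4) ℂ) {f : Tensor p (q + 1)}
    (hf : f ∈ kerC p (q + 1)) (b : Fin 4) : slice b (lowerMul M f) ∈ kerC p q := by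
  rw [mem_kerC_iff_update, mem_symExt_iff] at *
  refine ⟨⟨fun A σ B => ?_, fun B σ A => ?_⟩, fun i j B A => ?_⟩ <;>
    simp only [slice, lowerMul, LinearMap.coe_mk, AddHom.coe_mk, Fin.cons_zero, Fin.tail_cons,
      Finset.mul_sum]
  · refine Finset.sum_congr rfl fun a _ => ?_
    have := hf.1.1 (Fin.cons (α := fun _ => Fin 4) a A) σ B
    simp only at this
    rw [this]; ring
  · refine Finset.sum_congr rfl fun a _ => ?_
    have := (hf.1.2 B).cons sign_decomposeFin_zero a σ A
    simp only at this
    rw [this]; ring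
  · rw [Finset.sum_comm]
    refine Finset.sum_eq_zero fun a _ => ?_
    rw [← Finset.mul_sum]
    have := hf.2 i j.succ B (Fin.cons (α := fun _ => Fin 4) a A)
    simp only [← Fin.cons_update] at this
    rw [this, mul_zero]

/-- From `(q + 2)‖alt u‖² = ‖u‖² - (q + 1)⟨u, τu⟩`, with `τ` the exchange of superscripts, the form
is at least `-(q + 2)/(q + 1) ‖alt u‖²`, and `(q + 2)/(q + 1) ≤ 2`. -/
theorem neg_two_mul_le_re_inner_swapUpper {p q : ℕ} {u : Tensor p (q + 2)}
    (hu : ∀ B, StabEquivariant Perm.sign fun A => u (B, A)) :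
    -2 * ‖altUpper u‖ ^ 2 ≤ (inner ℂ (swapUpper u) u).re := by
  have h1 : ((q + 2 : ℕ) : ℂ) * inner ℂ u (altUpper u) =
      (‖u‖ : ℂ) ^ 2 - ((q + 1 : ℕ) : ℂ) * inner ℂ u (swapUpper u) := by
    have h0 : inner ℂ u u = (‖u‖ : ℂ) ^ 2 := inner_self_eq_norm_sq_to_K u
    rw [← h0, inner_tensor, inner_tensor, inner_tensor]
    rw [Finset.mul_sum, Finset.mul_sum, ← Finset.sum_sub_distrib]
    refine Finset.sum_congr rfl fun B _ => ?_
    have := (hu B).sum_conj_alt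
    rw [Perm.sign_swap (by simp), sub_eq_add_neg, ← mul_neg] at *
    simp only [Units.val_neg, Units.val_one, Int.cast_neg, Int.cast_one, neg_mul, one_mul] at this
    exact this
  have h2 : inner ℂ u (altUpper u) = ((‖altUpper u‖ ^ 2 : ℝ) : ℂ) := by
    have h3 : inner ℂ (altUpper u) (altUpper u) = inner ℂ (altUpper u) u :=
      inner_altUpper (fun B => (hu B).alt) u
    rw [← inner_conj_symm, ← h3, inner_self_eq_norm_sq_to_K]
    simp
  rw [h2] at h1
  have h3 := congrArg Complex.re h1
  rw [Complex.sub_re, ← Complex.ofReal_natCast, ← Complex.ofReal_natCast, Complex.re_ofReal_mul,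
    Complex.re_ofReal_mul, ← Complex.ofReal_pow, Complex.ofReal_re, Complex.ofReal_re] at h3
  rw [← inner_conj_symm, Complex.conj_re]
  push_cast at h3
  have h4 : 0 ≤ ‖u‖ ^ 2 := by positivity
  have h5 : 0 ≤ (q : ℝ) * ‖altUpper u‖ ^ 2 := by positivity
  have h6 : (0 : ℝ) < q + 1 := by positivity
  refine le_of_mul_le_mul_left ?_ h6
  nlinarith

/-- The algebraic content of `𝒟_{l+1} 𝒟_l = 0`. Paired with an antisymmetric `w`, a product of two
symbols transposes to two lowerings. Exchanging the new subscripts gives minus the lowerings in the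
opposite order, by the antisymmetry of `w`, and the symmetric `ξ` does not see this exchange. For
`w` the anticommutator itself this yields `⟨w, w⟩ = 0`. -/
theorem symbolAux_anticomm {p q : ℕ} (M N : Matrix (Fin 4) (Fin 4) ℂ) {ξ : Tensor (p + 2) q}
    (hξ : ξ ∈ symExt (p + 2) q) : symbolAux p (q + 1) M (symbolAux (p + 1) q N ξ) +
      symbolAux p (q + 1) N (symbolAux (p + 1) q M ξ) = 0 := by
  set w := symbolAux p (q + 1) M (symbolAux (p + 1) q N ξ) +
      symbolAux p (q + 1) N (symbolAux (p + 1) q M ξ) with hw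
  have hm := fun M => symbolAux_mem_symExt M hξ
  have hws : w ∈ symExt p (q + 2) := Submodule.add_mem _ (symbolAux_mem_symExt M (hm N))
    (symbolAux_mem_symExt N (hm M))
  have hw' := ((mem_symExt_iff _).1 hws).2
  have hup : ∀ M B, Equivariant Perm.sign fun A => lowerMul M w (B, A) := by
    intro M B σ A
    simp only [lowerMul, LinearMap.coe_mk, AddHom.coe_mk, Finset.mul_sum]
    refine Finset.sum_congr rfl fun a _ => ?_
    have := (hw' (Fin.tail B)).cons sign_decomposeFin_zero a σ A
    simp only at this
    rw [this]; ring
  have hin : ∀ M N, inner ℂ w (symbolAux p (q + 1) M (symbolAux (p + 1) q N ξ)) =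
      inner ℂ (lowerMul N (lowerMul M w)) ξ := by
    intro M N
    rw [inner_symbolAux M (hm N) hw', inner_symbolAux N hξ (hup M)]
  have hanti : swapLower (lowerMul N (lowerMul M w)) = -lowerMul M (lowerMul N w) := by
    ext ⟨B, A⟩
    obtain ⟨b₀, b₁, B, rfl⟩ : ∃ b₀ b₁ B', B = Fin.cons (α := fun _ => Fin 4) b₀
        (Fin.cons (α := fun _ => Fin 4) b₁ B') :=
      ⟨B 0, B 1, Fin.tail (Fin.tail B), by
        rw [show B 1 = Fin.tail B 0 from rfl, Fin.cons_self_tail, Fin.cons_self_tail]⟩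
    change lowerMul N (lowerMul M w) (fun m => Fin.cons (α := fun _ => Fin 4) b₀
        (Fin.cons (α := fun _ => Fin 4) b₁ B) (swap 0 1 m), A) = -lowerMul M (lowerMul N w) _
    rw [cons_cons_comp_swap]
    simp only [lowerMul, LinearMap.coe_mk, AddHom.coe_mk, Fin.cons_zero, Fin.tail_cons,
      Finset.mul_sum]
    rw [Finset.sum_comm, ← Finset.sum_neg_distrib]
    refine Finset.sum_congr rfl fun a _ => ?_
    rw [← Finset.sum_neg_distrib]
    refine Finset.sum_congr rfl fun a' _ => ?_
    have := hw' B (swap 0 1) (Fin.cons (α := fun _ => Fin 4) a' (Fin.cons (α := fun _ => Fin 4) a A))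
    simp only [cons_cons_comp_swap] at this
    rw [this, Perm.sign_swap (by simp)]
    push_cast
    ring
  rw [← inner_self_eq_zero (𝕜 := ℂ)]
  conv_lhs => rw [hw, inner_add_right, ← hw]
  rw [hin, hin, ← swapLower_of_mem hξ, ← inner_swapLower_left, hanti, inner_neg_left,
    swapLower_of_mem hξ]
  ring

/-- Only components with four distinct superscripts can be nonzero, and then `B 0` is among them,
say at position `j`. Contracting subscript `0` with superscript `j`, any other value of `c` repeats
a superscript, so the sum reduces to the component itself. -/
theorem kerC_four_eq_bot (p : ℕ) : kerC (p + 1) 4 = ⊥ := by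
  rw [Submodule.eq_bot_iff]
  intro ξ hξ
  obtain ⟨hs, h⟩ := (mem_kerC_iff_update _).1 hξ
  have hz : ∀ B A, ¬ Function.Injective A → ξ (B, A) = 0 := by
    intro B A hA
    simp only [Function.Injective, not_forall] at hA
    obtain ⟨i, j, hij, hne⟩ := hA
    have := symExt.upper hs (swap i j) B A
    have h2 : (fun m => A (swap i j m)) = A := by
      ext m
      by_cases h1 : m = i
      · subst h1; simp [hij]
      · by_cases h3 : m = j
        · subst h3; simp [hij]
        · rw [swap_apply_of_ne_of_ne h1 h3]
    rw [h2, Perm.sign_swap hne] at this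
    exact self_eq_neg.1 (by simpa using this)
  ext ⟨B, A⟩
  by_cases hA : Function.Injective A
  · obtain ⟨j, hj⟩ := (Finite.injective_iff_surjective.1 hA) (B 0)
    have h1 := h 0 j B A
    rw [Finset.sum_eq_single (B 0)] at h1
    · rw [Function.update_eq_self, ← hj, Function.update_eq_self] at h1
      exact h1
    · intro c _ hc
      refine hz _ _ fun hi => ?_
      obtain ⟨i, hi'⟩ := (Finite.injective_iff_surjective.1 hA) c
      have hij : i ≠ j := by rintro rfl; exact hc (hi'.symm.trans hj)
      refine hij (hi ?_)
      rw [Function.update_of_ne hij, Function.update_self, hi']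
    · simp
  · exact hz B A hA

end Symbols

/-! ### The algebraic estimates in terms of the symbols on `𝒱`. -/

section SymbolForms

variable {p q : ℕ}

/-- The adjoint of the symbol before the projection to the kernel of the contraction. -/
def lowerSymbol (p q : ℕ) (j : Fin 6) : 𝒱 p (q + 1) →ₗ[ℂ] Tensor (p + 1) q where
  toFun f := lowerMul (embed (e j)) f.1
  map_add' f g := (lowerMul (embed (e j))).map_add f.1 g.1
  map_smul' c f := (lowerMul (embed (e j))).map_smul c f.1

theorem inner_adjoint_symbol (j : Fin 6) (ξ : 𝒱 (p + 1) q) (f : 𝒱 p (q + 1)) :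
    inner ℂ ξ (LinearMap.adjoint (symbol p q j) f) = inner ℂ ξ.1 (lowerSymbol p q j f) := by
  rw [LinearMap.adjoint_inner_right, ← inner_conj_symm, ← inner_conj_symm ξ.1]
  congr 1
  exact inner_symbolAux _ (kerC_le_symExt _ _ ξ.2)
    ((mem_symExt_iff _).1 (kerC_le_symExt _ _ f.2)).2

/-- The adjoint symbol is the projection of `lowerSymbol` to the kernel of the contraction, so this
is `re_inner_swapLower_le` for `∑_j v_j η_j`. For `η_j = ∂_j^* g` the right side is `|Θg|²`. -/
theorem re_sum_swapLower_le (η : Fin 6 → 𝒱 (p + 1) (q + 1)) :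
    (∑ j, ∑ k, inner ℂ (swapLower (lowerSymbol (p + 1) q j (η j))) (lowerSymbol (p + 1) q k (η k))).re ≤
      ‖∑ j, LinearMap.adjoint (symbol (p + 1) q j) (η j)‖ ^ 2 := by
  have h := re_inner_swapLower_le (v := ∑ j, lowerSymbol (p + 1) q j (η j))
    (x := (∑ j, LinearMap.adjoint (symbol (p + 1) q j) (η j) : 𝒱 (p + 2) q).1) (fun b => ?_)
    (Subtype.property _) (fun ξ hξ => ?_)
  · refine le_of_eq_of_le ?_ h
    rw [map_sum, sum_inner]
    simp only [inner_sum]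
  · have : slice b (∑ j, lowerSymbol (p + 1) q j (η j)) = ∑ j, slice b (lowerSymbol (p + 1) q j (η j)) := by
      ext BA
      simp [slice]
    rw [this]
    exact Submodule.sum_mem _ fun j _ => lowerMul_slice_mem _ (η j).2 b
  · obtain ⟨ξ, rfl⟩ : ∃ ξ' : 𝒱 (p + 2) q, ξ = ξ'.1 := ⟨⟨ξ, hξ⟩, rfl⟩
    have h2 : ∀ x y : 𝒱 (p + 2) q, inner ℂ x.1 y.1 = inner ℂ x y := fun _ _ => rfl
    rw [h2, inner_sum, inner_sum]
    exact Finset.sum_congr rfl fun j _ => (inner_adjoint_symbol j ξ (η j)).symm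

/-- The crossed indices are those left by the commutation of derivatives. After the transfer to
superscripts the double sum is the exchange form of the single tensor `u = ∑_j raiseMul (embed (e
j)) η_j`, whose alternation is `∑_j σ_j η_j`. -/
theorem neg_two_mul_le_re_sum_swapLower (η : Fin 6 → 𝒱 (p + 1) (q + 1)) :
    -2 * ‖∑ j, symbol p (q + 1) j (η j)‖ ^ 2 ≤
    (∑ j, ∑ k, inner ℂ (swapLower (lowerSymbol (p + 1) q j (η k))) (lowerSymbol (p + 1) q k (η j))).re := by
  set u : Tensor p (q + 2) := ∑ j, raiseMul (embed (e j)) (η j).1 with hu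
  have h := neg_two_mul_le_re_inner_swapUpper (u := u) (fun B σ hσ A => by
    simp only [hu, WithLp.ofLp_sum, Finset.sum_apply, Finset.mul_sum]
    exact Finset.sum_congr rfl fun j _ =>
      stabEquivariant_raiseMul _ (kerC_le_symExt _ _ (η j).2) B σ hσ A)
  have h1 : altUpper u = (∑ j, symbol p (q + 1) j (η j) : 𝒱 p (q + 2)).1 := by
    rw [hu, map_sum]
    have : ∀ y : Fin 6 → 𝒱 p (q + 2), (∑ j, y j).1 = ∑ j, (y j).1 := fun y =>
      map_sum (kerC p (q + 2)).subtype y Finset.univ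
    rw [this]
    exact Finset.sum_congr rfl fun j _ =>
      (symbolAux_eq_altUpper _ (kerC_le_symExt _ _ (η j).2)).symm
  rw [h1] at h
  refine h.trans_eq ?_
  rw [hu, map_sum, sum_inner]
  simp only [inner_sum]
  rw [Finset.sum_comm]
  congr 1
  exact Finset.sum_congr rfl fun j _ => Finset.sum_congr rfl fun k _ =>
    (inner_swapLower_lowerMul _ _ _ _).symm

theorem sum_swapLower_self (f : 𝒱 (p + 1) (q + 1)) :
    ∑ j, inner ℂ (swapLower (lowerSymbol (p + 1) q j f)) (lowerSymbol (p + 1) q j f) =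
      2 * inner ℂ f f :=
  sum_inner_swapLower_self f.2

theorem symbol_anticomm (j k : Fin 6) (ξ : 𝒱 (p + 2) q) :
    symbol p (q + 1) j (symbol (p + 1) q k ξ) + symbol p (q + 1) k (symbol (p + 1) q j ξ) = 0 :=
  Subtype.ext (symbolAux_anticomm _ _ (kerC_le_symExt _ _ ξ.2))

instance (p : ℕ) : Subsingleton (𝒱 (p + 1) 4) :=
  ⟨fun a b => Subtype.ext (((Submodule.eq_bot_iff _).1 (kerC_four_eq_bot p) _ a.2).trans
    ((Submodule.eq_bot_iff _).1 (kerC_four_eq_bot p) _ b.2).symm)⟩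

end SymbolForms

/-! ### Integration by parts and commutators for the Gaussian weight. -/

section Calculus

variable {V W : Type*} [NormedAddCommGroup V] [InnerProductSpace ℂ V]
  [NormedAddCommGroup W] [InnerProductSpace ℂ W]

theorem integrable_weight_iff {F : Type*} [NormedAddCommGroup F] [NormedSpace ℝ F]
    {h : EuclideanSpace ℝ (Fin 6) → F} :
    Integrable h weight ↔ Integrable fun x => Real.exp (-(‖x‖ ^ 2)) • h x := by
  rw [weight, integrable_withDensity_iff_integrable_smul' (by fun_prop) (by simp)]
  simp [ENNReal.toReal_ofReal, Real.exp_nonneg]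

/-- Continuous functions of at most exponential growth are square integrable for the Gaussian
weight. -/
theorem memLp_weight_of_norm_le_exp {F : Type*} [NormedAddCommGroup F]
    {f : EuclideanSpace ℝ (Fin 6) → F} (hf : Continuous f) (C c : ℝ)
    (h : ∀ x, ‖f x‖ ≤ C * Real.exp (c * ‖x‖)) : MemLp f 2 weight := by
  rw [memLp_two_iff_integrable_sq_norm hf.aestronglyMeasurable, integrable_weight_iff]
  have h0 : Integrable fun x : EuclideanSpace ℝ (Fin 6) =>
      C ^ 2 * Real.exp (2 * c ^ 2) * Real.exp (-(1 / 2) * ‖x‖ ^ 2) := by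
    have := (GaussianFourier.integrable_cexp_neg_mul_sq_norm_add (V := EuclideanSpace ℝ (Fin 6))
      (b := 1 / 2) (by norm_num) 0 0).norm
    refine (this.congr (Filter.Eventually.of_forall fun x => ?_)).const_mul _
    simp only [Complex.norm_exp]
    congr 1
    have : ((‖x‖ : ℂ) ^ 2).re = ‖x‖ ^ 2 := by norm_cast
    have h2 : (1 / 2 : ℂ) = ((1 / 2 : ℝ) : ℂ) := by norm_num
    simp only [zero_mul, add_zero, h2, ← Complex.ofReal_neg, Complex.re_ofReal_mul, this]
  refine h0.mono' (by fun_prop) (Filter.Eventually.of_forall fun x => ?_)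
  rw [smul_eq_mul, Real.norm_of_nonneg (by positivity)]
  have h1 : ‖f x‖ ^ 2 ≤ (C * Real.exp (c * ‖x‖)) ^ 2 := by gcongr; exact h x
  calc _ ≤ Real.exp (-(‖x‖ ^ 2)) * (C * Real.exp (c * ‖x‖)) ^ 2 := by gcongr
    _ = C ^ 2 * Real.exp (2 * c * ‖x‖ - ‖x‖ ^ 2) := by
      rw [mul_pow, ← Real.exp_nat_mul, mul_left_comm, ← Real.exp_add]; congr 2; push_cast; ring
    -- Completing the square: `2cr - r² ≤ 2c² - r²/2`.
    _ ≤ C ^ 2 * Real.exp (2 * c ^ 2 + -(1 / 2) * ‖x‖ ^ 2) := by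
      gcongr; nlinarith [sq_nonneg (‖x‖ - 2 * c)]
    _ = _ := by rw [Real.exp_add, mul_assoc]

theorem memLp_weight {f : EuclideanSpace ℝ (Fin 6) → V} (hf : f.HasTemperateGrowth) :
    MemLp f 2 weight := by
  obtain ⟨k, C, hC⟩ := hf.2 0
  refine memLp_weight_of_norm_le_exp hf.1.continuous (|C| * (k.factorial * Real.exp 1)) 1
    fun x => ?_
  have h1 := hC x
  rw [norm_iteratedFDeriv_zero] at h1
  have h2 := Real.pow_div_factorial_le_exp (x := 1 + ‖x‖) (by positivity) k
  rw [div_le_iff₀ (by positivity)] at h2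
  calc ‖f x‖ ≤ |C| * (1 + ‖x‖) ^ k := h1.trans (by gcongr; exact le_abs_self C)
    _ ≤ |C| * (Real.exp (1 + ‖x‖) * k.factorial) := by gcongr
    _ = _ := by rw [Real.exp_add, one_mul]; ring

theorem integrable_inner_weight {f g : EuclideanSpace ℝ (Fin 6) → V} (hf : f.HasTemperateGrowth)
    (hg : g.HasTemperateGrowth) : Integrable (fun x => inner ℂ (f x) (g x)) weight :=
  (L2.integrable_inner ((memLp_weight hf).toLp f) ((memLp_weight hg).toLp g)).congr <| by
    filter_upwards [(memLp_weight hf).coeFn_toLp, (memLp_weight hg).coeFn_toLp] with x h1 h2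
    rw [h1, h2]

theorem inner_toLp_weight {f g : EuclideanSpace ℝ (Fin 6) → V} (hf : MemLp f 2 weight)
    (hg : MemLp g 2 weight) :
    inner ℂ (hf.toLp f) (hg.toLp g) = ∫ x, inner ℂ (f x) (g x) ∂weight := by
  rw [L2.inner_def]
  refine integral_congr_ae ?_
  filter_upwards [hf.coeFn_toLp, hg.coeFn_toLp] with x h1 h2
  rw [h1, h2]

/-- The partial derivative `∂_j`. -/
def pderiv (j : Fin 6) (f : EuclideanSpace ℝ (Fin 6) → V) (x : EuclideanSpace ℝ (Fin 6)) : V :=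
  fderiv ℝ f x (e j)

/-- The formal adjoint `-∂_j + 2 x_j` of the partial derivative for the Gaussian weight. -/
def pderivAdj (j : Fin 6) (f : EuclideanSpace ℝ (Fin 6) → V) (x : EuclideanSpace ℝ (Fin 6)) : V :=
  (2 * x j) • f x - pderiv j f x

@[fun_prop]
theorem hasTemperateGrowth_coord (j : Fin 6) :
    (fun x : EuclideanSpace ℝ (Fin 6) => x j).HasTemperateGrowth :=
  (EuclideanSpace.proj (𝕜 := ℝ) j).hasTemperateGrowth

@[fun_prop]
theorem hasTemperateGrowth_pderiv {f : EuclideanSpace ℝ (Fin 6) → V} (hf : f.HasTemperateGrowth)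
    (j : Fin 6) : (pderiv j f).HasTemperateGrowth := by
  have h : (fderiv ℝ f).HasTemperateGrowth := by
    refine ⟨hf.1.fderiv_right (by simp), fun n => ?_⟩
    obtain ⟨k, C, h⟩ := hf.2 (n + 1)
    exact ⟨k, C, fun x => by rw [norm_iteratedFDeriv_fderiv]; exact h x⟩
  exact (ContinuousLinearMap.apply ℝ V (e j)).hasTemperateGrowth.comp h

@[fun_prop]
theorem hasTemperateGrowth_pderivAdj {f : EuclideanSpace ℝ (Fin 6) → V}
    (hf : f.HasTemperateGrowth) (j : Fin 6) : (pderivAdj j f).HasTemperateGrowth := by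
  unfold pderivAdj
  fun_prop

theorem hasTemperateGrowth_linearMap [FiniteDimensional ℂ V] (L : V →ₗ[ℂ] W)
    {f : EuclideanSpace ℝ (Fin 6) → V} (hf : f.HasTemperateGrowth) :
    (fun x => L (f x)).HasTemperateGrowth :=
  ((LinearMap.toContinuousLinearMap L).restrictScalars ℝ).hasTemperateGrowth.comp hf

theorem pderiv_linearMap [FiniteDimensional ℂ V] (L : V →ₗ[ℂ] W)
    {f : EuclideanSpace ℝ (Fin 6) → V} (hf : f.HasTemperateGrowth) (j : Fin 6)
    (x : EuclideanSpace ℝ (Fin 6)) : pderiv j (fun y => L (f y)) x = L (pderiv j f x) := by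
  have h := ((LinearMap.toContinuousLinearMap L).restrictScalars ℝ).hasFDerivAt.comp x
    (hf.1.differentiable (by simp) x).hasFDerivAt
  exact congrArg (fun T : EuclideanSpace ℝ (Fin 6) →L[ℝ] W => T (e j)) h.fderiv

theorem pderivAdj_linearMap [FiniteDimensional ℂ V] (L : V →ₗ[ℂ] W)
    {f : EuclideanSpace ℝ (Fin 6) → V} (hf : f.HasTemperateGrowth) (j : Fin 6)
    (x : EuclideanSpace ℝ (Fin 6)) : pderivAdj j (fun y => L (f y)) x = L (pderivAdj j f x) := by
  rw [pderivAdj, pderiv_linearMap L hf, pderivAdj, map_sub, LinearMap.map_smul_of_tower]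

theorem fderiv_coord_apply (j k : Fin 6) (x : EuclideanSpace ℝ (Fin 6)) :
    fderiv ℝ (fun y : EuclideanSpace ℝ (Fin 6) => y k) x (e j) = if k = j then 1 else 0 := by
  have h : fderiv ℝ (fun y : EuclideanSpace ℝ (Fin 6) => y k) x = EuclideanSpace.proj k :=
    (EuclideanSpace.proj (𝕜 := ℝ) k).hasFDerivAt.fderiv
  rw [h]
  simp [e]

theorem pderiv_coord_smul (j k : Fin 6) {f : EuclideanSpace ℝ (Fin 6) → V}
    (hf : f.HasTemperateGrowth) (x : EuclideanSpace ℝ (Fin 6)) :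
    pderiv j (fun y => y k • f y) x = x k • pderiv j f x + if k = j then f x else 0 := by
  have h1 : DifferentiableAt ℝ (fun y : EuclideanSpace ℝ (Fin 6) => y k) x :=
    (EuclideanSpace.proj (𝕜 := ℝ) k).differentiableAt
  rw [pderiv, fderiv_fun_smul h1 (hf.1.differentiable (by simp) x)]
  simp only [add_apply, smul_apply,
    ContinuousLinearMap.smulRight_apply, fderiv_coord_apply, ite_smul, one_smul, zero_smul]
  rfl

theorem pderiv_comm {f : EuclideanSpace ℝ (Fin 6) → V} (hf : f.HasTemperateGrowth) (j k : Fin 6)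
    (x : EuclideanSpace ℝ (Fin 6)) : pderiv j (pderiv k f) x = pderiv k (pderiv j f) x := by
  have hd : DifferentiableAt ℝ (fderiv ℝ f) x :=
    (hf.1.fderiv_right (m := ∞) (by simp)).differentiable (by simp) x
  have h : ∀ v w, fderiv ℝ (fun y => fderiv ℝ f y v) x w = fderiv ℝ (fderiv ℝ f) x w v := by
    intro v w
    have := (ContinuousLinearMap.apply ℝ V v).hasFDerivAt.comp x hd.hasFDerivAt
    exact congrArg (fun T : EuclideanSpace ℝ (Fin 6) →L[ℝ] V => T w) this.fderiv
  change fderiv ℝ (fun y => fderiv ℝ f y (e k)) x (e j) =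
    fderiv ℝ (fun y => fderiv ℝ f y (e j)) x (e k)
  rw [h, h]
  exact second_derivative_symmetric
    (fun y => (hf.1.differentiable (by simp) y).hasFDerivAt) hd.hasFDerivAt _ _

theorem pderiv_add (j : Fin 6) {f g : EuclideanSpace ℝ (Fin 6) → V} (hf : f.HasTemperateGrowth)
    (hg : g.HasTemperateGrowth) (x : EuclideanSpace ℝ (Fin 6)) :
    pderiv j (fun y => f y + g y) x = pderiv j f x + pderiv j g x := by
  rw [pderiv, fderiv_fun_add (hf.1.differentiable (by simp) x) (hg.1.differentiable (by simp) x)]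
  rfl

theorem pderiv_sub (j : Fin 6) {f g : EuclideanSpace ℝ (Fin 6) → V} (hf : f.HasTemperateGrowth)
    (hg : g.HasTemperateGrowth) (x : EuclideanSpace ℝ (Fin 6)) :
    pderiv j (fun y => f y - g y) x = pderiv j f x - pderiv j g x := by
  rw [pderiv, fderiv_fun_sub (hf.1.differentiable (by simp) x) (hg.1.differentiable (by simp) x)]
  rfl

/-- The commutator `2δ_{jk}` is the Hessian of the weight function `|x|²`. -/
theorem pderiv_pderivAdj {f : EuclideanSpace ℝ (Fin 6) → V} (hf : f.HasTemperateGrowth)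
    (j k : Fin 6) (x : EuclideanSpace ℝ (Fin 6)) :
    pderiv j (pderivAdj k f) x =
      pderivAdj k (pderiv j f) x + if k = j then (2 : ℝ) • f x else 0 := by
  have h2 : (fun y => (2 : ℝ) • f y).HasTemperateGrowth := by fun_prop
  have h0 : pderivAdj k f = fun y => y k • ((2 : ℝ) • f y) - pderiv k f y := by
    ext y; rw [pderivAdj, smul_smul, mul_comm]
  have h3 : pderiv j (fun y => (2 : ℝ) • f y) x = (2 : ℝ) • pderiv j f x := by
    rw [pderiv, fderiv_fun_const_smul (hf.1.differentiable (by simp) x)]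
    rfl
  rw [h0, pderiv_sub j (by fun_prop) (by fun_prop), pderiv_coord_smul j k h2, pderiv_comm hf,
    pderivAdj, h3, smul_smul, mul_comm]
  abel

theorem hasFDerivAt_exp_neg_norm_sq_smul {f : EuclideanSpace ℝ (Fin 6) → V}
    {x : EuclideanSpace ℝ (Fin 6)} (hf : DifferentiableAt ℝ f x) :
    HasFDerivAt (fun y => Real.exp (-(‖y‖ ^ 2)) • f y) (Real.exp (-(‖x‖ ^ 2)) • fderiv ℝ f x +
      (Real.exp (-(‖x‖ ^ 2)) •
        -((2 : ℕ) • (innerSL ℝ x : EuclideanSpace ℝ (Fin 6) →L[ℝ] ℝ))).smulRight (f x)) x :=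
  ((hasStrictFDerivAt_norm_sq x).hasFDerivAt.neg).exp.smul hf.hasFDerivAt

theorem fderiv_exp_neg_norm_sq_smul {f : EuclideanSpace ℝ (Fin 6) → V}
    {x : EuclideanSpace ℝ (Fin 6)} (hf : DifferentiableAt ℝ f x) (j : Fin 6) :
    fderiv ℝ (fun y => Real.exp (-(‖y‖ ^ 2)) • f y) x (e j) =
      -(Real.exp (-(‖x‖ ^ 2)) • pderivAdj j f x) := by
  rw [(hasFDerivAt_exp_neg_norm_sq_smul hf).fderiv, pderivAdj, pderiv]
  have : inner ℝ x (e j) = x j := by simp [e, EuclideanSpace.inner_single_right]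
  simp only [add_apply, smul_apply, ContinuousLinearMap.smulRight_apply, neg_apply,
    innerSL_apply_apply, this, smul_sub, smul_smul, neg_sub]
  rw [sub_eq_add_neg, ← neg_smul]
  congr 2
  simp

/-- Integration by parts for the Gaussian weight. -/
theorem integral_inner_pderivAdj {f g : EuclideanSpace ℝ (Fin 6) → V} (hf : f.HasTemperateGrowth)
    (hg : g.HasTemperateGrowth) (j : Fin 6) :
    ∫ x, inner ℂ (pderivAdj j f x) (g x) ∂weight = ∫ x, inner ℂ (f x) (pderiv j g x) ∂weight := by
  set w : EuclideanSpace ℝ (Fin 6) → V := fun y => Real.exp (-(‖y‖ ^ 2)) • f y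
  have hwj : ∀ x, fderiv ℝ w x (e j) = -(Real.exp (-(‖x‖ ^ 2)) • pderivAdj j f x) := fun x =>
    fderiv_exp_neg_norm_sq_smul (hf.1.differentiable (by simp) x) j
  have hint : ∀ {a b : EuclideanSpace ℝ (Fin 6) → V}, a.HasTemperateGrowth →
      b.HasTemperateGrowth → Integrable fun x => inner ℂ (Real.exp (-(‖x‖ ^ 2)) • a x) (b x) := by
    intro a b ha hb
    simpa only [inner_smul_left_eq_smul] using
      integrable_weight_iff.1 (integrable_inner_weight ha hb)
  have := integral_bilinear_fderiv_right_eq_neg_left_of_integrable (μ := volume) (f := w)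
      (g := g) (v := e j)
      (B := (isBoundedBilinearMap_inner (𝕜 := ℂ) (E := V)).toContinuousLinearMap)
      (by
        simp only [hwj]
        simpa using (hint (hasTemperateGrowth_pderivAdj hf j) hg).neg)
      (hint hf (hasTemperateGrowth_pderiv hg j))
      (hint hf hg)
      (fun x _ => (hasFDerivAt_exp_neg_norm_sq_smul
        (hf.1.differentiable (by simp) x)).differentiableAt)
      (fun x _ => hg.1.differentiable (by simp) x)
  rw [integral_weight, integral_weight]
  simp only [← inner_smul_left_eq_smul]
  change ∫ x, inner ℂ (w x) (pderiv j g x) = -∫ x, inner ℂ (fderiv ℝ w x (e j)) (g x) at this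
  simp only [hwj, inner_neg_left, integral_neg, neg_neg] at this
  exact this.symm

/-- The commutation relation `[∂_j, ∂_k^*] = 2 δ_{jk}` in integrated form. -/
theorem integral_inner_pderivAdj_pderivAdj [FiniteDimensional ℂ V] (R S : V →ₗ[ℂ] W)
    {f : EuclideanSpace ℝ (Fin 6) → V} (hf : f.HasTemperateGrowth) (j k : Fin 6) :
    ∫ x, inner ℂ (R (pderivAdj j f x)) (S (pderivAdj k f x)) ∂weight =
      ∫ x, inner ℂ (R (pderiv k f x)) (S (pderiv j f x)) ∂weight +
        if k = j then 2 * ∫ x, inner ℂ (R (f x)) (S (f x)) ∂weight else 0 := by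
  have hR := hasTemperateGrowth_linearMap R hf
  have hadj := hasTemperateGrowth_linearMap S (hasTemperateGrowth_pderivAdj hf k)
  have hd := hasTemperateGrowth_linearMap S (hasTemperateGrowth_pderiv hf j)
  -- `∂_j^*` moves to the right factor as `∂_j`, is commuted past `∂_k^*`, and `∂_k^*` moves to the
  -- left factor as `∂_k`.
  have h1 := integral_inner_pderivAdj hR hadj j
  have h2 := integral_inner_pderivAdj hd hR k
  simp only [pderivAdj_linearMap R hf, pderiv_linearMap S (hasTemperateGrowth_pderivAdj hf k),
    pderiv_pderivAdj hf] at h1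
  simp only [pderivAdj_linearMap S (hasTemperateGrowth_pderiv hf j), pderiv_linearMap R hf] at h2
  have h3 : ∫ x, inner ℂ (R (f x)) (S (pderivAdj k (pderiv j f) x)) ∂weight =
      ∫ x, inner ℂ (R (pderiv k f x)) (S (pderiv j f x)) ∂weight := by
    have := congrArg (starRingEnd ℂ) h2
    rw [← integral_conj, ← integral_conj] at this
    simpa only [inner_conj_symm] using this
  rw [h1, ← h3]
  split_ifs with hjk
  · have h4 : ∀ x, S ((2 : ℝ) • f x) = (2 : ℂ) • S (f x) := fun x => by
      rw [← map_smul]; rfl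
    simp only [map_add, inner_add_right, h4, inner_smul_right]
    rw [integral_add (integrable_inner_weight hR
        (hasTemperateGrowth_linearMap S
        (hasTemperateGrowth_pderivAdj (hasTemperateGrowth_pderiv hf j) k)))
      ((integrable_inner_weight hR (hasTemperateGrowth_linearMap S hf)).const_mul 2),
      integral_const_mul]
  · simp

end Calculus

/-! ### Density of the polynomials in the weighted space. -/

section Polynomials

open scoped FourierTransform

variable {V W : Type*} [NormedAddCommGroup V] [InnerProductSpace ℂ V]
  [NormedAddCommGroup W] [InnerProductSpace ℂ W]

/-- Multiplication of functions by the coordinate `x_j`. -/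
def mulCoord (V : Type*) [NormedAddCommGroup V] [InnerProductSpace ℂ V] (j : Fin 6) :
    (EuclideanSpace ℝ (Fin 6) → V) →ₗ[ℂ] (EuclideanSpace ℝ (Fin 6) → V) where
  toFun f x := x j • f x
  map_add' f g := by ext x; simp
  map_smul' c f := by ext x; exact smul_comm (x j) c (f x)

/-- The constant functions, as a linear map. -/
def constMap (V : Type*) [NormedAddCommGroup V] [InnerProductSpace ℂ V] :
    V →ₗ[ℂ] (EuclideanSpace ℝ (Fin 6) → V) where
  toFun v _ := v
  map_add' _ _ := rfl
  map_smul' _ _ := rfl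

/-- The `V`-valued polynomials on `ℝ⁶` of degree less than `n`. -/
def polySub (V : Type*) [NormedAddCommGroup V] [InnerProductSpace ℂ V] :
    ℕ → Submodule ℂ (EuclideanSpace ℝ (Fin 6) → V)
  | 0 => ⊥
  | n + 1 => LinearMap.range (constMap V) ⊔ polySub V n ⊔ ⨆ j, (polySub V n).map (mulCoord V j)

theorem const_mem_polySub (n : ℕ) (v : V) :
    (fun _ => v : EuclideanSpace ℝ (Fin 6) → V) ∈ polySub V (n + 1) :=
  Submodule.mem_sup_left (Submodule.mem_sup_left ⟨v, rfl⟩)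

theorem polySub_le_succ (n : ℕ) : polySub V n ≤ polySub V (n + 1) :=
  le_sup_right.trans le_sup_left

theorem polySub_mono : Monotone (polySub V) := monotone_nat_of_le_succ polySub_le_succ

theorem mulCoord_mem_polySub {n : ℕ} {f : EuclideanSpace ℝ (Fin 6) → V} (hf : f ∈ polySub V n)
    (j : Fin 6) : (fun x => x j • f x) ∈ polySub V (n + 1) :=
  Submodule.mem_sup_right (Submodule.mem_iSup_of_mem j ⟨f, hf, rfl⟩)

theorem polySub_succ_induction {n : ℕ} {motive : (EuclideanSpace ℝ (Fin 6) → V) → Prop}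
    (hc : ∀ v, motive fun _ => v) (h : ∀ f ∈ polySub V n, motive f)
    (hx : ∀ j, ∀ f ∈ polySub V n, motive fun x => x j • f x)
    (hadd : ∀ f g, motive f → motive g → motive fun x => f x + g x)
    {f : EuclideanSpace ℝ (Fin 6) → V} (hf : f ∈ polySub V (n + 1)) : motive f := by
  obtain ⟨a, ha, b, hb, rfl⟩ := Submodule.mem_sup.1 hf
  obtain ⟨c, ⟨v, rfl⟩, d, hd, rfl⟩ := Submodule.mem_sup.1 ha
  refine hadd _ _ (hadd _ _ (hc v) (h d hd)) ?_
  refine Submodule.iSup_induction _ (motive := motive) hb ?_ (hc 0) fun f g => hadd f g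
  rintro j _ ⟨g, hg, rfl⟩
  exact hx j g hg

instance finiteDimensional_polySub [FiniteDimensional ℂ V] (n : ℕ) :
    FiniteDimensional ℂ (polySub V n) := by
  induction n with
  | zero =>
    exact inferInstanceAs
      (FiniteDimensional ℂ (⊥ : Submodule ℂ (EuclideanSpace ℝ (Fin 6) → V)))
  | succ n ih =>
    change FiniteDimensional ℂ ↥(LinearMap.range (constMap V) ⊔ polySub V n ⊔
      ⨆ j, (polySub V n).map (mulCoord V j))
    infer_instance

theorem hasTemperateGrowth_and_pderiv_mem {n : ℕ} {f : EuclideanSpace ℝ (Fin 6) → V}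
    (hf : f ∈ polySub V n) :
    f.HasTemperateGrowth ∧ ∀ j, pderiv j f ∈ polySub V (n - 1) := by
  have h0 : ∀ j v, pderiv j (fun _ => v : EuclideanSpace ℝ (Fin 6) → V) = 0 := fun j v => by
    ext x; simp [pderiv]
  induction n generalizing f with
  | zero =>
    obtain rfl : f = fun _ => 0 := (Submodule.mem_bot ℂ).1 hf
    exact ⟨by fun_prop, fun j => by rw [h0]; exact zero_mem _⟩
  | succ n ih =>
    have hm : ∀ j, ∀ f ∈ polySub V (n - 1), (fun x => x j • f x) ∈ polySub V n := by
      intro j f hf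
      cases n with
      | zero =>
        obtain rfl : f = 0 := (Submodule.mem_bot ℂ).1 hf
        simp only [Pi.zero_apply, smul_zero]
        exact zero_mem (polySub V 0)
      | succ n => exact mulCoord_mem_polySub hf j
    refine polySub_succ_induction (motive := fun f => f.HasTemperateGrowth ∧
      ∀ j, pderiv j f ∈ polySub V n) ?_ ?_ ?_ ?_ hf
    · exact fun v => ⟨by fun_prop, fun j => by rw [h0]; exact zero_mem _⟩
    · exact fun f hf => ⟨(ih hf).1, fun j => polySub_mono (by omega) ((ih hf).2 j)⟩
    · intro k f hf
      have hg := (ih hf).1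
      refine ⟨by fun_prop, fun j => ?_⟩
      have : pderiv j (fun x => x k • f x) =
          (fun x => x k • pderiv j f x) + if k = j then f else 0 := by
        ext x; rw [pderiv_coord_smul j k hg]; split_ifs <;> rfl
      rw [this]
      refine add_mem (hm k _ ((ih hf).2 j)) ?_
      split_ifs
      · exact hf
      · exact zero_mem _
    · rintro f g ⟨hf, hf'⟩ ⟨hg, hg'⟩
      refine ⟨by fun_prop, fun j => ?_⟩
      have : pderiv j (fun x => f x + g x) = pderiv j f + pderiv j g :=
        funext fun x => pderiv_add j hf hg x
      rw [this]
      exact add_mem (hf' j) (hg' j)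

theorem hasTemperateGrowth_of_mem_polySub {n : ℕ} {f : EuclideanSpace ℝ (Fin 6) → V}
    (hf : f ∈ polySub V n) : f.HasTemperateGrowth :=
  (hasTemperateGrowth_and_pderiv_mem hf).1

theorem pderiv_mem_polySub {n : ℕ} {f : EuclideanSpace ℝ (Fin 6) → V} (hf : f ∈ polySub V (n + 1))
    (j : Fin 6) : pderiv j f ∈ polySub V n :=
  (hasTemperateGrowth_and_pderiv_mem hf).2 j

theorem real_smul_mem_polySub {n : ℕ} {f : EuclideanSpace ℝ (Fin 6) → V} (hf : f ∈ polySub V n)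
    (r : ℝ) : (fun x => r • f x) ∈ polySub V n :=
  (polySub V n).smul_mem (r : ℂ) hf

theorem pderivAdj_mem_polySub {n : ℕ} {f : EuclideanSpace ℝ (Fin 6) → V} (hf : f ∈ polySub V n)
    (j : Fin 6) : pderivAdj j f ∈ polySub V (n + 1) := by
  have : pderivAdj j f = (fun x => x j • ((2 : ℝ) • f x)) - pderiv j f := by
    ext x; simp [pderivAdj, smul_smul, mul_comm]
  rw [this]
  exact sub_mem (mulCoord_mem_polySub (real_smul_mem_polySub hf 2) j)
    (polySub_mono (by omega) ((hasTemperateGrowth_and_pderiv_mem hf).2 j))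

theorem linearMap_mem_polySub (L : V →ₗ[ℂ] W) {n : ℕ} {f : EuclideanSpace ℝ (Fin 6) → V}
    (hf : f ∈ polySub V n) : (fun x => L (f x)) ∈ polySub W n := by
  induction n generalizing f with
  | zero =>
    obtain rfl : f = 0 := (Submodule.mem_bot ℂ).1 hf
    simp only [Pi.zero_apply, map_zero]
    exact zero_mem (polySub W 0)
  | succ n ih =>
    refine polySub_succ_induction (motive := fun f => (fun x => L (f x)) ∈ polySub W (n + 1))
      ?_ ?_ ?_ ?_ hf
    · exact fun v => const_mem_polySub n (L v)
    · exact fun f hf => polySub_le_succ n (ih hf)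
    · intro j f hf
      simp only [LinearMap.map_smul_of_tower]
      exact mulCoord_mem_polySub (ih hf) j
    · intro f g hf hg
      simp only [map_add]
      exact add_mem hf hg

theorem inner_pow_smul_mem_polySub (t : EuclideanSpace ℝ (Fin 6)) (v : V) (n : ℕ) :
    (fun x => (inner ℝ t x ^ n : ℝ) • v) ∈ polySub V (n + 1) := by
  induction n with
  | zero => simpa using const_mem_polySub 0 v
  | succ n ih =>
    have : (fun x : EuclideanSpace ℝ (Fin 6) => (inner ℝ t x ^ (n + 1) : ℝ) • v) =
        ∑ j, fun x => x j • (t j • ((inner ℝ t x ^ n : ℝ) • v)) := by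
      ext x
      rw [Finset.sum_apply]
      simp only [smul_smul, ← Finset.sum_smul]
      congr 1
      rw [pow_succ', PiLp.inner_apply, Finset.sum_mul]
      simp [mul_assoc]
    rw [this]
    exact sum_mem fun j _ => mulCoord_mem_polySub (real_smul_mem_polySub ih _) j

/-- The polynomials of degree less than `n` in the weighted `L²` space. -/
def polyToLp (V : Type*) [NormedAddCommGroup V] [InnerProductSpace ℂ V] (n : ℕ) :
    polySub V n →ₗ[ℂ] Lp V 2 weight where
  toFun f := (memLp_weight (hasTemperateGrowth_of_mem_polySub f.2)).toLp f.1
  map_add' _ _ := rfl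
  map_smul' _ _ := rfl

def polyLp (V : Type*) [NormedAddCommGroup V] [InnerProductSpace ℂ V] (n : ℕ) :
    Submodule ℂ (Lp V 2 weight) := LinearMap.range (polyToLp V n)

instance [FiniteDimensional ℂ V] (n : ℕ) : FiniteDimensional ℂ (polyLp V n) :=
  inferInstanceAs (FiniteDimensional ℂ (LinearMap.range (polyToLp V n)))

theorem polyLp_mono : Monotone (polyLp V) := by
  rintro m n h _ ⟨f, rfl⟩
  exact ⟨⟨f.1, polySub_mono h f.2⟩, rfl⟩

theorem integrable_smul_weight {a : EuclideanSpace ℝ (Fin 6) → ℂ} (ha : Continuous a) {C c : ℝ}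
    (h : ∀ x, ‖a x‖ ≤ C * Real.exp (c * ‖x‖)) (u : Lp V 2 weight) :
    Integrable (fun x => a x • u x) weight :=
  memLp_one_iff_integrable.1 ((Lp.memLp u).smul (memLp_weight_of_norm_le_exp ha C c h))

theorem integral_inner_pow_smul_eq_zero [CompleteSpace V] {u : Lp V 2 weight}
    (hu : ∀ n, ∀ g ∈ polyLp V n, inner ℂ g u = 0) (t : EuclideanSpace ℝ (Fin 6)) (n : ℕ) :
    ∫ x, (inner ℝ t x ^ n : ℂ) • u x ∂weight = 0 := by
  refine ext_inner_left ℂ fun v => ?_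
  have hb : ∀ x : EuclideanSpace ℝ (Fin 6), ‖(inner ℝ t x ^ n : ℂ)‖ ≤
      n.factorial * Real.exp (‖t‖ * ‖x‖) := fun x => by
    have h1 := Real.pow_div_factorial_le_exp (x := ‖t‖ * ‖x‖) (by positivity) n
    rw [div_le_iff₀ (by positivity), mul_comm (Real.exp _)] at h1
    refine le_trans ?_ h1
    rw [norm_pow, Complex.norm_real]
    gcongr
    exact norm_inner_le_norm t x
  rw [inner_zero_right, ← integral_inner (integrable_smul_weight (by fun_prop) hb u),
    ← hu _ _ ⟨⟨_, inner_pow_smul_mem_polySub t v n⟩, rfl⟩, L2.inner_def]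
  refine integral_congr_ae ?_
  filter_upwards [(memLp_weight (hasTemperateGrowth_of_mem_polySub
    (inner_pow_smul_mem_polySub t v n))).coeFn_toLp] with x hx
  change _ = inner ℂ (((memLp_weight (hasTemperateGrowth_of_mem_polySub
    (inner_pow_smul_mem_polySub t v n))).toLp _ : Lp V 2 weight) x) _
  rw [hx, inner_smul_left_eq_smul, inner_smul_right, ← Complex.ofReal_pow]
  rfl

/-- The exponential series may be integrated term by term: the sum of the norms is at most
`exp(‖t‖‖x‖)‖u‖`, which is integrable for the Gaussian weight. -/
theorem integral_exp_inner_smul_eq_zero [CompleteSpace V] {u : Lp V 2 weight}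
    (hu : ∀ n, ∀ g ∈ polyLp V n, inner ℂ g u = 0) (t : EuclideanSpace ℝ (Fin 6)) :
    ∫ x, Complex.exp (inner ℝ t x * Complex.I) • u x ∂weight = 0 := by
  have hsum : ∀ x, HasSum (fun n : ℕ => ‖(inner ℝ t x * Complex.I : ℂ)‖ ^ n / n.factorial * ‖u x‖)
      (Real.exp ‖(inner ℝ t x * Complex.I : ℂ)‖ * ‖u x‖) := fun x => by
    refine HasSum.mul_right _ ?_
    rw [Real.exp_eq_exp_ℝ]
    exact NormedSpace.expSeries_div_hasSum_exp _
  have key := hasSum_integral_of_dominated_convergence (μ := weight)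
    (F := fun (n : ℕ) x => ((inner ℝ t x * Complex.I : ℂ) ^ n / n.factorial) • u x)
    (f := fun x => Complex.exp (inner ℝ t x * Complex.I) • u x)
    (fun n x => ‖(inner ℝ t x * Complex.I : ℂ)‖ ^ n / n.factorial * ‖u x‖)
    (fun n => (Continuous.aestronglyMeasurable (by fun_prop)).smul (Lp.memLp u).1)
    (fun n => Filter.Eventually.of_forall fun x => by
      rw [norm_smul, norm_div, norm_pow]; simp)
    (Filter.Eventually.of_forall fun x => (hsum x).summable)
    (by
      simp only [fun x => (hsum x).tsum_eq]
      have h1 := (integrable_smul_weight (V := V)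
        (a := fun x => (Real.exp ‖(inner ℝ t x * Complex.I : ℂ)‖ : ℂ)) (C := 1) (c := ‖t‖)
        (by fun_prop) (fun x => by
          rw [Complex.norm_real, Real.norm_of_nonneg (Real.exp_nonneg _), one_mul]
          gcongr
          simpa using norm_inner_le_norm (𝕜 := ℝ) t x) u).norm
      refine h1.congr (Filter.Eventually.of_forall fun x => ?_)
      simp only [norm_smul, Complex.norm_real, Real.norm_of_nonneg (Real.exp_nonneg _)])
    (Filter.Eventually.of_forall fun x => by
      refine HasSum.smul_const ?_ _
      rw [Complex.exp_eq_exp_ℂ]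
      exact NormedSpace.expSeries_div_hasSum_exp _)
  have h0 : ∀ n : ℕ, ∫ x, ((inner ℝ t x * Complex.I : ℂ) ^ n / n.factorial) • u x ∂weight = 0 := by
    intro n
    have := integral_inner_pow_smul_eq_zero hu t n
    have h2 : ∀ x, ((inner ℝ t x * Complex.I : ℂ) ^ n / n.factorial) • u x =
        (Complex.I ^ n / n.factorial) • ((inner ℝ t x ^ n : ℂ) • u x) := fun x => by
      rw [smul_smul]; congr 1; ring
    simp only [h2]
    rw [integral_smul, this, smul_zero]
  simp only [h0] at key
  exact key.unique hasSum_zero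

/-- The Fourier transform of the integrable function `G = e^{-|x|²} u` vanishes. Writing a test
function as a Fourier transform and moving the transform to `G` shows that `G` integrates to zero
against it. -/
theorem eq_zero_of_orthogonal_polyLp [CompleteSpace V] {u : Lp V 2 weight}
    (hu : ∀ n, ∀ g ∈ polyLp V n, inner ℂ g u = 0) : u = 0 := by
  rw [Lp.eq_zero_iff_ae_eq_zero]
  have hloc : LocallyIntegrable u weight := (Lp.memLp u).locallyIntegrable (by norm_num)
  refine ae_eq_zero_of_integral_contDiff_smul_eq_zero hloc fun g hg hc => ?_
  set G : EuclideanSpace ℝ (Fin 6) → V := fun x => Real.exp (-(‖x‖ ^ 2)) • u x with hG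
  have hGint : Integrable G := by
    have := integrable_smul_weight (a := fun _ => 1) (C := 1) (c := 0) (by fun_prop) (by simp) u
    simpa [integrable_weight_iff] using this
  have hGF : ∀ ξ, 𝓕 G ξ = 0 := fun ξ => by
    have h := integral_exp_inner_smul_eq_zero hu ((-2 * Real.pi) • ξ)
    rw [integral_weight] at h
    rw [Real.fourier_eq', ← h]
    refine integral_congr_ae (Filter.Eventually.of_forall fun x => ?_)
    simp only [hG]
    rw [smul_comm, inner_smul_left, real_inner_comm]
    rfl
  have hgc : HasCompactSupport fun x => (g x : ℂ) := hc.comp_left (g := Complex.ofReal) rfl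
  set S := hgc.toSchwartzMap (Complex.ofRealCLM.contDiff.comp hg) with hS
  have h1 := VectorFourier.integral_fourierIntegral_smul_eq_flip
    (L := innerₗ (EuclideanSpace ℝ (Fin 6)))
    Real.continuous_fourierChar continuous_inner (𝓕⁻ S).integrable hGint (μ := volume)
  have h2 : ∀ ξ, 𝓕 ((𝓕⁻ S : SchwartzMap (EuclideanSpace ℝ (Fin 6)) ℂ) :
      EuclideanSpace ℝ (Fin 6) → ℂ) ξ = (g ξ : ℂ) := fun ξ => by
    rw [← SchwartzMap.fourier_coe, FourierTransform.fourier_fourierInv_eq S]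
    rfl
  rw [flip_innerₗ] at h1
  change ∫ ξ, 𝓕 ((𝓕⁻ S : SchwartzMap (EuclideanSpace ℝ (Fin 6)) ℂ) :
      EuclideanSpace ℝ (Fin 6) → ℂ) ξ • G ξ = ∫ x, (𝓕⁻ S) x • 𝓕 G x at h1
  simp only [h2, hGF, smul_zero, integral_zero] at h1
  rw [integral_weight, ← h1]
  refine integral_congr_ae (Filter.Eventually.of_forall fun x => ?_)
  simp only [hG]
  rw [smul_comm, Complex.coe_smul]

/-- The orthogonal projections on the polynomials converge strongly to the identity. -/
theorem tendsto_starProjection_polyLp [FiniteDimensional ℂ V] (u : Lp V 2 weight) :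
    Filter.Tendsto (fun n => (polyLp V n).starProjection u) Filter.atTop (nhds u) := by
  have : CompleteSpace V := FiniteDimensional.complete ℂ V
  refine Submodule.starProjection_tendsto_self _ polyLp_mono u (le_of_eq ?_)
  rw [eq_comm, Submodule.topologicalClosure_eq_top_iff, Submodule.eq_bot_iff]
  intro v hv
  exact eq_zero_of_orthogonal_polyLp fun n g hg =>
    (Submodule.mem_orthogonal _ v).1 hv g (Submodule.mem_iSup_of_mem n hg)

end Polynomials

/-! ### `𝒟` and `Θ` on smooth functions, and the a priori estimate there. -/

section FirstOrder

variable {p q : ℕ}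

theorem diffOp_eq (f : EuclideanSpace ℝ (Fin 6) → 𝒱 (p + 1) q) :
    diffOp p q f = fun x => ∑ j, symbol p q j (pderiv j f x) := rfl

theorem formalAdj_eq {g : EuclideanSpace ℝ (Fin 6) → 𝒱 p (q + 1)} (hg : Differentiable ℝ g) :
    formalAdj p q g = fun x => ∑ j, LinearMap.adjoint (symbol p q j) (pderivAdj j g x) := by
  ext1 x
  rw [formalAdj, ← Finset.sum_neg_distrib]
  refine Finset.sum_congr rfl fun j _ => ?_
  rw [fderiv_exp_neg_norm_sq_smul (hg x), map_neg, LinearMap.map_smul_of_tower, smul_neg, neg_neg,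
    smul_smul, ← Real.exp_add, add_neg_cancel, Real.exp_zero, one_smul]

theorem hasTemperateGrowth_diffOp {f : EuclideanSpace ℝ (Fin 6) → 𝒱 (p + 1) q}
    (hf : f.HasTemperateGrowth) : (diffOp p q f).HasTemperateGrowth :=
  Function.HasTemperateGrowth.sum fun j _ =>
    hasTemperateGrowth_linearMap (symbol p q j) (hasTemperateGrowth_pderiv hf j)

theorem hasTemperateGrowth_formalAdj {g : EuclideanSpace ℝ (Fin 6) → 𝒱 p (q + 1)}
    (hg : g.HasTemperateGrowth) : (formalAdj p q g).HasTemperateGrowth := by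
  rw [formalAdj_eq (hg.1.differentiable (by simp))]
  exact Function.HasTemperateGrowth.sum fun j _ =>
    hasTemperateGrowth_linearMap _ (hasTemperateGrowth_pderivAdj hg j)

/-- Together with `formalAdj_mem_polySub`: `Θ𝒟` and `𝒟Θ` both preserve a positive degree bound,
which makes the polynomial projections compatible with the complex. -/
theorem diffOp_mem_polySub {n : ℕ} {f : EuclideanSpace ℝ (Fin 6) → 𝒱 (p + 1) q}
    (hf : f ∈ polySub (𝒱 (p + 1) q) (n + 1)) : diffOp p q f ∈ polySub (𝒱 p (q + 1)) n := by
  have : diffOp p q f = ∑ j, fun x => symbol p q j (pderiv j f x) := by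
    ext1 x; rw [Finset.sum_apply]; rfl
  rw [this]
  exact sum_mem fun j _ => linearMap_mem_polySub _ (pderiv_mem_polySub hf j)

theorem formalAdj_mem_polySub {n : ℕ} {g : EuclideanSpace ℝ (Fin 6) → 𝒱 p (q + 1)}
    (hg : g ∈ polySub (𝒱 p (q + 1)) n) : formalAdj p q g ∈ polySub (𝒱 (p + 1) q) (n + 1) := by
  have : formalAdj p q g =
      ∑ j, fun x => LinearMap.adjoint (symbol p q j) (pderivAdj j g x) := by
    ext1 x
    rw [formalAdj_eq ((hasTemperateGrowth_of_mem_polySub hg).1.differentiable (by simp)),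
      Finset.sum_apply]
  rw [this]
  exact sum_mem fun j _ => linearMap_mem_polySub _ (pderivAdj_mem_polySub hg j)

/-- `⟨𝒟 f, g⟩_φ = ⟨f, Θ g⟩_φ` for smooth functions of temperate growth. -/
theorem integral_inner_diffOp_of_hasTemperateGrowth {f : EuclideanSpace ℝ (Fin 6) → 𝒱 (p + 1) q}
    {g : EuclideanSpace ℝ (Fin 6) → 𝒱 p (q + 1)} (hf : f.HasTemperateGrowth)
    (hg : g.HasTemperateGrowth) :
    ∫ x, inner ℂ (diffOp p q f x) (g x) ∂weight = ∫ x, inner ℂ (f x) (formalAdj p q g x) ∂weight := by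
  simp only [formalAdj_eq (hg.1.differentiable (by simp)), diffOp_eq, sum_inner, inner_sum]
  rw [integral_finsetSum _ fun j _ => integrable_inner_weight
      (hasTemperateGrowth_linearMap (symbol p q j) (hasTemperateGrowth_pderiv hf j)) hg,
    integral_finsetSum _ fun j _ => integrable_inner_weight hf
      (hasTemperateGrowth_linearMap _ (hasTemperateGrowth_pderivAdj hg j))]
  refine Finset.sum_congr rfl fun j _ => ?_
  have h := integral_inner_pderivAdj
    (hasTemperateGrowth_linearMap (LinearMap.adjoint (symbol p q j)) hg) hf j
  have h' := congrArg (starRingEnd ℂ) h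
  rw [← integral_conj, ← integral_conj] at h'
  simp only [inner_conj_symm, pderivAdj_linearMap _ hg, LinearMap.adjoint_inner_right] at h'
  simp only [LinearMap.adjoint_inner_right]
  exact h'.symm

theorem pderivAdj_comm {V : Type*} [NormedAddCommGroup V] [InnerProductSpace ℂ V]
    {f : EuclideanSpace ℝ (Fin 6) → V} (hf : f.HasTemperateGrowth) (j k : Fin 6)
    (x : EuclideanSpace ℝ (Fin 6)) :
    pderivAdj j (pderivAdj k f) x = pderivAdj k (pderivAdj j f) x := by
  have h : ∀ j k, pderivAdj j (pderivAdj k f) x = (4 * x j * x k) • f x -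
      ((2 * x j) • pderiv k f x + (2 * x k) • pderiv j f x) + pderiv k (pderiv j f) x -
      if k = j then (2 : ℝ) • f x else 0 := by
    intro j k
    rw [pderivAdj, pderiv_pderivAdj hf, pderivAdj, pderivAdj, smul_sub, smul_smul]
    have : 2 * x j * (2 * x k) = 4 * x j * x k := by ring
    rw [this]
    abel
  rw [h, h, pderiv_comm hf, mul_right_comm, add_comm ((2 * x j) • _)]
  simp only [eq_comm]

/-- `Θ_l Θ_{l+1} = 0`. -/
theorem formalAdj_formalAdj {g : EuclideanSpace ℝ (Fin 6) → 𝒱 p (q + 2)}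
    (hg : g.HasTemperateGrowth) : formalAdj (p + 1) q (formalAdj p (q + 1) g) = 0 := by
  have hs : ∀ {m : ℕ} {f : Fin m → EuclideanSpace ℝ (Fin 6) → 𝒱 (p + 1) (q + 1)} (_ : ∀ k,
      (f k).HasTemperateGrowth) (j : Fin 6) x,
      pderivAdj j (fun y => ∑ k, f k y) x = ∑ k, pderivAdj j (f k) x := by
    intro m f hf j x
    simp only [pderivAdj, pderiv]
    rw [fderiv_fun_sum fun k _ => (hf k).1.differentiable (by simp) x, sum_apply,
      Finset.smul_sum, Finset.sum_sub_distrib]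
  have h1 := hasTemperateGrowth_formalAdj hg
  have key : ∀ x, formalAdj (p + 1) q (formalAdj p (q + 1) g) x =
      ∑ j, ∑ k, LinearMap.adjoint (symbol (p + 1) q j) (LinearMap.adjoint (symbol p (q + 1) k)
        (pderivAdj j (pderivAdj k g) x)) := by
    intro x
    rw [formalAdj_eq (h1.1.differentiable (by simp)), formalAdj_eq (hg.1.differentiable (by simp))]
    refine Finset.sum_congr rfl fun j _ => ?_
    rw [hs (fun k => hasTemperateGrowth_linearMap _ (hasTemperateGrowth_pderivAdj hg k)), map_sum]
    refine Finset.sum_congr rfl fun k _ => ?_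
    rw [pderivAdj_linearMap _ (hasTemperateGrowth_pderivAdj hg k)]
  have hanti : ∀ j k (v : 𝒱 p (q + 2)),
      LinearMap.adjoint (symbol (p + 1) q j) (LinearMap.adjoint (symbol p (q + 1) k) v) =
      -LinearMap.adjoint (symbol (p + 1) q k) (LinearMap.adjoint (symbol p (q + 1) j) v) := by
    intro j k v
    refine ext_inner_left ℂ fun ξ => ?_
    rw [inner_neg_right, LinearMap.adjoint_inner_right, LinearMap.adjoint_inner_right,
      LinearMap.adjoint_inner_right, LinearMap.adjoint_inner_right,
      eq_neg_of_add_eq_zero_left (symbol_anticomm k j ξ), inner_neg_left]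
  ext1 x
  rw [key]
  have h0 : ∀ a : 𝒱 (p + 2) q, a = -a → a = 0 := fun a ha => by
    have : (2 : ℂ) • a = 0 := by rw [two_smul]; exact eq_neg_iff_add_eq_zero.1 ha
    exact (smul_eq_zero.1 this).resolve_left two_ne_zero
  -- The adjoint symbols anticommute and the operators `∂_j^*` commute, so the double sum equals its
  -- negative.
  refine h0 _ ?_
  conv_lhs => rw [Finset.sum_comm]
  simp only [← Finset.sum_neg_distrib]
  refine Finset.sum_congr rfl fun j _ => Finset.sum_congr rfl fun k _ => ?_
  rw [hanti, pderivAdj_comm hg]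

/-- The a priori estimate for smooth functions of temperate growth. -/
theorem integral_norm_sq_le {g : EuclideanSpace ℝ (Fin 6) → 𝒱 (p + 1) (q + 1)}
    (hg : g.HasTemperateGrowth) :
    ∫ x, ‖g x‖ ^ 2 ∂weight ≤
      ∫ x, ‖formalAdj (p + 1) q g x‖ ^ 2 ∂weight + ∫ x, ‖diffOp p (q + 1) g x‖ ^ 2 ∂weight := by
  have hsq : ∀ {V : Type} [NormedAddCommGroup V] [InnerProductSpace ℂ V]
      {f : EuclideanSpace ℝ (Fin 6) → V}, f.HasTemperateGrowth →
      Integrable (fun x => ‖f x‖ ^ 2) weight := fun hf =>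
    (memLp_two_iff_integrable_sq_norm hf.1.continuous.aestronglyMeasurable).1 (memLp_weight hf)
  set v := fun j => lowerSymbol (p + 1) q j with hv
  set τv := fun j => (swapLower (q := q)).comp (lowerSymbol (p + 1) q j) with hτ
  have hadj := hasTemperateGrowth_pderivAdj hg
  have hder := hasTemperateGrowth_pderiv hg
  have hI1 : ∀ j k, Integrable (fun x => inner ℂ (τv j (pderivAdj j g x)) (v k (pderivAdj k g x)))
      weight := fun j k => integrable_inner_weight (hasTemperateGrowth_linearMap _ (hadj j))
      (hasTemperateGrowth_linearMap _ (hadj k))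
  have hI2 : ∀ j k, Integrable (fun x => inner ℂ (τv j (pderiv k g x)) (v k (pderiv j g x)))
      weight := fun j k => integrable_inner_weight (hasTemperateGrowth_linearMap _ (hder k))
      (hasTemperateGrowth_linearMap _ (hder j))
  have hI3 : ∀ j, Integrable (fun x => inner ℂ (τv j (g x)) (v j (g x)))
      weight := fun j => integrable_inner_weight (hasTemperateGrowth_linearMap _ hg)
      (hasTemperateGrowth_linearMap _ hg)
  have hS1 := integrable_finsetSum Finset.univ fun j _ =>
    integrable_finsetSum Finset.univ fun k _ => hI1 j k
  have hS2 := integrable_finsetSum Finset.univ fun j _ =>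
    integrable_finsetSum Finset.univ fun k _ => hI2 j k
  -- The factor `4` is the `2` of the commutator times the `2` of `sum_swapLower_self`.
  have e1 : ∫ x, ∑ j, ∑ k, inner ℂ (τv j (pderivAdj j g x)) (v k (pderivAdj k g x)) ∂weight =
      ∫ x, ∑ j, ∑ k, inner ℂ (τv j (pderiv k g x)) (v k (pderiv j g x)) ∂weight +
      4 * ∫ x, (‖g x‖ ^ 2 : ℂ) ∂weight := by
    have e3 : ∑ j, ∫ x, inner ℂ (τv j (g x)) (v j (g x)) ∂weight =
        2 * ∫ x, (‖g x‖ ^ 2 : ℂ) ∂weight := by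
      rw [← integral_finsetSum _ fun j _ => hI3 j, ← integral_const_mul]
      refine integral_congr_ae (Filter.Eventually.of_forall fun x => ?_)
      refine (sum_swapLower_self (g x)).trans ?_
      rw [inner_self_eq_norm_sq_to_K]
      rfl
    rw [integral_finsetSum _ fun j _ => integrable_finsetSum Finset.univ fun k _ => hI1 j k,
      integral_finsetSum _ fun j _ => integrable_finsetSum Finset.univ fun k _ => hI2 j k]
    have : (4 : ℂ) * ∫ x, (‖g x‖ ^ 2 : ℂ) ∂weight =
        ∑ j, 2 * ∫ x, inner ℂ (τv j (g x)) (v j (g x)) ∂weight := by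
      rw [← Finset.mul_sum, e3]; ring
    rw [this, ← Finset.sum_add_distrib]
    refine Finset.sum_congr rfl fun j _ => ?_
    rw [integral_finsetSum _ fun k _ => hI1 j k, integral_finsetSum _ fun k _ => hI2 j k]
    simp only [integral_inner_pderivAdj_pderivAdj _ _ hg, Finset.sum_add_distrib,
      Finset.sum_ite_eq', Finset.mem_univ, if_true]
  have e2 := congrArg Complex.re e1
  have h4 : (∫ x, (‖g x‖ ^ 2 : ℂ) ∂weight) = ((∫ x, ‖g x‖ ^ 2 ∂weight : ℝ) : ℂ) := by
    simp only [← Complex.ofReal_pow]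
    exact integral_ofReal
  have hre : ∀ {F : EuclideanSpace ℝ (Fin 6) → ℂ}, Integrable F weight →
      (∫ x, F x ∂weight).re = ∫ x, (F x).re ∂weight := fun hF => (integral_re hF).symm
  rw [Complex.add_re, hre hS1, hre hS2, h4, show (4 : ℂ) = ((4 : ℝ) : ℂ) by norm_num,
    Complex.re_ofReal_mul, Complex.ofReal_re] at e2
  have i1 : ∫ x, (∑ j, ∑ k, inner ℂ (τv j (pderivAdj j g x)) (v k (pderivAdj k g x))).re ∂weight ≤
      ∫ x, ‖formalAdj (p + 1) q g x‖ ^ 2 ∂weight := by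
    refine integral_mono hS1.re (hsq (hasTemperateGrowth_formalAdj hg)) fun x => ?_
    rw [formalAdj_eq (hg.1.differentiable (by simp))]
    exact re_sum_swapLower_le fun j => pderivAdj j g x
  have i2 : -2 * ∫ x, ‖diffOp p (q + 1) g x‖ ^ 2 ∂weight ≤
      ∫ x, (∑ j, ∑ k, inner ℂ (τv j (pderiv k g x)) (v k (pderiv j g x))).re ∂weight := by
    rw [← integral_const_mul]
    refine integral_mono ((hsq (hasTemperateGrowth_diffOp hg)).const_mul _) hS2.re fun x => ?_
    exact neg_two_mul_le_re_sum_swapLower fun j => pderiv j g x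
  have h5 : 0 ≤ ∫ x, ‖formalAdj (p + 1) q g x‖ ^ 2 ∂weight := integral_nonneg fun x => by positivity
  have h6 : 0 ≤ ∫ x, ‖diffOp p (q + 1) g x‖ ^ 2 ∂weight := integral_nonneg fun x => by positivity
  -- The inequalities give `4‖g‖² ≤ ‖Θg‖² + 2‖𝒟g‖²`, more than is claimed.
  linarith

end FirstOrder

/-! ### From compactly supported to temperate test functions. -/

section Cutoff

/-- A sequence of cutoff functions with uniformly bounded gradients. -/
theorem exists_cutoff : ∃ (χ : ℕ → EuclideanSpace ℝ (Fin 6) → ℝ) (C : ℝ), 0 ≤ C ∧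
    (∀ n, ContDiff ℝ ∞ (χ n)) ∧ (∀ n, HasCompactSupport (χ n)) ∧ (∀ n x, |χ n x| ≤ 1) ∧
    (∀ n j x, |fderiv ℝ (χ n) x (e j)| ≤ C) ∧
    ∀ x, ∀ᶠ n in Filter.atTop, χ n =ᶠ[nhds x] fun _ => 1 := by
  let ψ : ContDiffBump (0 : EuclideanSpace ℝ (Fin 6)) := ⟨1, 2, one_pos, one_lt_two⟩
  obtain ⟨C, hC⟩ := (ψ.hasCompactSupport.fderiv (𝕜 := ℝ)).exists_bound_of_continuous
    (ψ.contDiff (n := 1).continuous_fderiv one_ne_zero)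
  have hpos : ∀ n : ℕ, (0 : ℝ) < ((n : ℝ) + 1)⁻¹ := fun n => by positivity
  refine ⟨fun n x => ψ (((n : ℝ) + 1)⁻¹ • x), C, (norm_nonneg _).trans (hC 0), fun n => ?_,
    fun n => ?_, fun n x => ?_, fun n j x => ?_, fun x => ?_⟩
  · exact ψ.contDiff.comp (contDiff_const_smul _)
  · exact ψ.hasCompactSupport.comp_smul (hpos n).ne'
  · rw [abs_of_nonneg ψ.nonneg]; exact ψ.le_one
  · have hd := (ψ.contDiff (n := 1)).differentiable one_ne_zero (((n : ℝ) + 1)⁻¹ • x)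
    have := hd.hasFDerivAt.comp x ((hasFDerivAt_id x).const_smul ((n : ℝ) + 1)⁻¹)
    have h2 : fderiv ℝ (fun x => ψ (((n : ℝ) + 1)⁻¹ • x)) x (e j) =
        ((n : ℝ) + 1)⁻¹ * fderiv ℝ ψ (((n : ℝ) + 1)⁻¹ • x) (e j) := by
      have h3 := congrArg (fun T : EuclideanSpace ℝ (Fin 6) →L[ℝ] ℝ => T (e j)) this.fderiv
      refine h3.trans ?_
      simp
    have h4 : ‖e j‖ = 1 := by simp [e]
    have h5 := (fderiv ℝ ψ (((n : ℝ) + 1)⁻¹ • x)).le_opNorm (e j)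
    rw [h4, mul_one] at h5
    rw [h2, abs_mul, abs_of_pos (hpos n)]
    have h6 : ((n : ℝ) + 1)⁻¹ ≤ 1 := inv_le_one_of_one_le₀ (by simp)
    exact (mul_le_of_le_one_left (abs_nonneg _) h6).trans (h5.trans (hC _))
  · obtain ⟨N, hN⟩ := exists_nat_gt ‖x‖
    filter_upwards [Filter.eventually_ge_atTop N] with n hn
    have h1 : ((n : ℝ) + 1)⁻¹ • x ∈ Metric.ball (0 : EuclideanSpace ℝ (Fin 6)) ψ.rIn := by
      rw [mem_ball_zero_iff, norm_smul, Real.norm_of_nonneg (hpos n).le]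
      change _ < (1 : ℝ)
      rw [inv_mul_lt_iff₀ (by positivity), mul_one]
      have : (N : ℝ) ≤ n := by exact_mod_cast hn
      linarith
    have h2 := ψ.eventuallyEq_one_of_mem_ball h1
    exact (continuous_const_smul _).continuousAt.eventually h2

theorem tendsto_integral_inner_of_eventually_eq {V : Type*} [NormedAddCommGroup V]
    [InnerProductSpace ℂ V] (u : Lp V 2 weight) {F : ℕ → EuclideanSpace ℝ (Fin 6) → V}
    {f : EuclideanSpace ℝ (Fin 6) → V} (hF : ∀ n, Continuous (F n))
    {b : EuclideanSpace ℝ (Fin 6) → ℝ} (hb : MemLp b 2 weight) (hFb : ∀ n x, ‖F n x‖ ≤ b x)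
    (hlim : ∀ x, ∀ᶠ n in Filter.atTop, F n x = f x) :
    Filter.Tendsto (fun n => ∫ x, inner ℂ (u x) (F n x) ∂weight) Filter.atTop
      (nhds (∫ x, inner ℂ (u x) (f x) ∂weight)) := by
  refine tendsto_integral_of_dominated_convergence (fun x => ‖u x‖ * b x)
    (fun n => (Lp.memLp u).1.inner (hF n).aestronglyMeasurable)
    ((Lp.memLp u).norm.integrable_mul hb)
    (fun n => Filter.Eventually.of_forall fun x =>
      (norm_inner_le_norm _ _).trans (by gcongr; exact hFb n x))
    (Filter.Eventually.of_forall fun x => ?_)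
  refine tendsto_const_nhds.congr' ?_
  filter_upwards [hlim x] with n hn
  rw [hn]

/-- Membership in the weak graph can be tested on smooth functions of temperate growth. -/
theorem inner_toLp_of_mem_weakGraph {p q : ℕ} {fu : L2 (p + 1) q × L2 p (q + 1)}
    (h : fu ∈ weakGraph p q) {g : EuclideanSpace ℝ (Fin 6) → 𝒱 p (q + 1)}
    (hg : g.HasTemperateGrowth) :
    inner ℂ fu.2 ((memLp_weight hg).toLp g) = inner ℂ fu.1
      ((memLp_weight (hasTemperateGrowth_formalAdj hg)).toLp (formalAdj p q g)) := by
  obtain ⟨χ, C, hC0, hχ, hχc, hχ1, hχ2, hχ3⟩ := exists_cutoff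
  have hgn : ∀ n, IsTest fun x => χ n x • g x := fun n =>
    ⟨(hχ n).smul hg.1, (hχc n).smul_right⟩
  have hint : ∀ {m k : ℕ} (u : L2 m k) {w : EuclideanSpace ℝ (Fin 6) → 𝒱 m k}
      (hw : MemLp w 2 weight), inner ℂ u (hw.toLp w) = ∫ x, inner ℂ (u x) (w x) ∂weight := by
    intro m k u w hw
    rw [L2.inner_def]
    refine integral_congr_ae ?_
    filter_upwards [hw.coeFn_toLp] with x hx
    rw [hx]
  have hχd : ∀ n x j, pderiv j (fun x => χ n x • g x) x =
      χ n x • pderiv j g x + fderiv ℝ (χ n) x (e j) • g x := by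
    intro n x j
    rw [pderiv, fderiv_fun_smul ((hχ n).differentiable (by simp) x)
      (hg.1.differentiable (by simp) x)]
    rfl
  have hχadj : ∀ n x j, pderivAdj j (fun x => χ n x • g x) x =
      χ n x • pderivAdj j g x - fderiv ℝ (χ n) x (e j) • g x := by
    intro n x j
    rw [pderivAdj, hχd, pderivAdj, smul_sub, smul_comm (2 * x j)]
    abel
  let L := fun j => LinearMap.toContinuousLinearMap (LinearMap.adjoint (symbol p q j))
  have hlim1 := tendsto_integral_inner_of_eventually_eq fu.2 (f := g)
    (fun n => (hgn n).1.continuous) (memLp_weight hg).norm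
    (fun n x => by
      rw [norm_smul]
      exact mul_le_of_le_one_left (norm_nonneg _) (hχ1 n x))
    (fun x => by
      filter_upwards [hχ3 x] with n hn
      rw [hn.eq_of_nhds, one_smul])
  -- The error terms of `Θ(χ_n g)` carry the derivatives of `χ_n`: they are dominated uniformly in
  -- `n` because the gradients are, and at each point they vanish for large `n`.
  have hlim2 := tendsto_integral_inner_of_eventually_eq fu.1 (f := formalAdj p q g)
    (F := fun n => formalAdj p q fun x => χ n x • g x)
    (fun n => (hgn n).formalAdj.1.continuous)
    (b := fun x => ∑ j, ‖L j‖ * (‖pderivAdj j g x‖ + C * ‖g x‖))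
    (memLp_finsetSum _ fun j _ => (((memLp_weight (hasTemperateGrowth_pderivAdj hg j)).norm).add
      ((memLp_weight hg).norm.const_mul C)).const_mul _)
    (fun n x => by
      rw [formalAdj_eq ((hgn n).1.differentiable (by simp))]
      refine (norm_sum_le _ _).trans (Finset.sum_le_sum fun j _ => ?_)
      refine ((L j).le_opNorm _).trans ?_
      gcongr
      rw [hχadj]
      refine (norm_sub_le _ _).trans ?_
      rw [norm_smul, norm_smul]
      gcongr
      · exact mul_le_of_le_one_left (norm_nonneg _) (hχ1 n x)
      · exact hχ2 n j x)
    (fun x => by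
      filter_upwards [hχ3 x] with n hn
      rw [formalAdj_eq ((hgn n).1.differentiable (by simp)),
        formalAdj_eq (hg.1.differentiable (by simp))]
      refine Finset.sum_congr rfl fun j _ => ?_
      rw [hχadj, hn.eq_of_nhds, hn.fderiv_eq]
      simp)
  rw [hint, hint]
  refine tendsto_nhds_unique hlim1 (hlim2.congr fun n => ?_)
  have := h _ (hgn n)
  rw [hint, hint] at this
  exact this.symm

end Cutoff

/-! ### The weak operators and the a priori estimate on their domains. -/

section WeakOperators

variable {p q : ℕ}

theorem graph_weakD : (weakD p q).graph = weakGraph p q :=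
  Submodule.toLinearPMap_graph_eq _ fun x hx h0 => weakGraph_single p q x hx h0

theorem exists_weakD_eq {f : L2 (p + 1) q} {u : L2 p (q + 1)} (h : (f, u) ∈ weakGraph p q) :
    ∃ hf : f ∈ (weakD p q).domain, weakD p q ⟨f, hf⟩ = u := by
  rw [← graph_weakD, LinearPMap.mem_graph_iff] at h
  obtain ⟨y, hy, hu⟩ := h
  obtain rfl : (y : L2 (p + 1) q) = f := hy
  exact ⟨y.2, hu⟩

theorem mem_weakGraph (f : (weakD p q).domain) : ((f : L2 (p + 1) q), weakD p q f) ∈ weakGraph p q := by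
  rw [← graph_weakD]
  exact LinearPMap.mem_graph _ f

theorem weakD_isClosed : (weakD p q).IsClosed := by
  rw [LinearPMap.IsClosed, graph_weakD]
  have : (weakGraph p q : Set (L2 (p + 1) q × L2 p (q + 1))) =
      ⋂ (g : EuclideanSpace ℝ (Fin 6) → 𝒱 p (q + 1)) (hg : IsTest g),
        {fu | inner ℂ fu.2 (hg.memLp.toLp g) =
          inner ℂ fu.1 (hg.formalAdj.memLp.toLp (formalAdj p q g))} := by
    ext fu; simp only [Set.mem_iInter]; rfl
  rw [this]
  refine isClosed_iInter fun g => isClosed_iInter fun hg => isClosed_eq ?_ ?_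
  · exact continuous_snd.inner continuous_const
  · exact continuous_fst.inner continuous_const

theorem toLp_eq_zero {V : Type*} [NormedAddCommGroup V] {f : EuclideanSpace ℝ (Fin 6) → V}
    (hf : MemLp f 2 weight) (h : f = 0) : hf.toLp f = 0 := by
  subst h
  exact MemLp.toLp_zero hf

/-- If `g` is a test function, so is `Θg`. Hence the weak equation for `𝒟x` may be tested on `Θg`,
and `ΘΘg = 0`. -/
theorem weakD_weakD (x : (weakD (p + 1) q).domain) :
    ∃ h : weakD (p + 1) q x ∈ (weakD p (q + 1)).domain,
      weakD p (q + 1) ⟨weakD (p + 1) q x, h⟩ = 0 := by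
  refine exists_weakD_eq fun g hg => ?_
  have h1 := mem_weakGraph x _ hg.formalAdj
  have h0 := formalAdj_formalAdj (hg.2.hasTemperateGrowth hg.1)
  change inner ℂ (0 : L2 p (q + 2)) _ = inner ℂ (weakD (p + 1) q x) _
  refine (inner_zero_left _).trans (Eq.symm (h1.trans ?_))
  rw [toLp_eq_zero hg.formalAdj.formalAdj.memLp h0, inner_zero_right]

/-- The class in `L²_φ` of a smooth function of temperate growth. -/
def temperateToLp {V : Type*} [NormedAddCommGroup V] [InnerProductSpace ℂ V]
    (f : EuclideanSpace ℝ (Fin 6) → V) (hf : f.HasTemperateGrowth) : Lp V 2 weight :=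
  (memLp_weight hf).toLp f

theorem norm_temperateToLp_sq {V : Type*} [NormedAddCommGroup V] [InnerProductSpace ℂ V]
    {f : EuclideanSpace ℝ (Fin 6) → V} (hf : f.HasTemperateGrowth) :
    ‖temperateToLp f hf‖ ^ 2 = ∫ x, ‖f x‖ ^ 2 ∂weight := by
  have h := inner_toLp_weight (memLp_weight hf) (memLp_weight hf)
  have h1 : ∀ x, inner ℂ (f x) (f x) = ((‖f x‖ ^ 2 : ℝ) : ℂ) := fun x => by
    rw [inner_self_eq_norm_sq_to_K]; norm_cast
  rw [inner_self_eq_norm_sq_to_K] at h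
  simp only [h1] at h
  rw [integral_complex_ofReal] at h
  change (‖temperateToLp f hf‖ : ℂ) ^ 2 = _ at h
  exact_mod_cast h

theorem temperate_mem_weakGraph {f : EuclideanSpace ℝ (Fin 6) → 𝒱 (p + 1) q}
    (hf : f.HasTemperateGrowth) :
    (temperateToLp f hf, temperateToLp (diffOp p q f) (hasTemperateGrowth_diffOp hf)) ∈
      weakGraph p q := by
  intro g hg
  have hg' := hg.2.hasTemperateGrowth hg.1
  exact (inner_toLp_weight (memLp_weight (hasTemperateGrowth_diffOp hf)) hg.memLp).trans
    ((integral_inner_diffOp_of_hasTemperateGrowth hf hg').trans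
      (inner_toLp_weight (memLp_weight hf) hg.formalAdj.memLp).symm)

theorem inner_temperateToLp_diffOp {f : EuclideanSpace ℝ (Fin 6) → 𝒱 (p + 1) q}
    {g : EuclideanSpace ℝ (Fin 6) → 𝒱 p (q + 1)} (hf : f.HasTemperateGrowth)
    (hg : g.HasTemperateGrowth) :
    inner ℂ (temperateToLp (diffOp p q f) (hasTemperateGrowth_diffOp hf)) (temperateToLp g hg) =
      inner ℂ (temperateToLp f hf) (temperateToLp (formalAdj p q g)
        (hasTemperateGrowth_formalAdj hg)) :=
  inner_toLp_of_mem_weakGraph (temperate_mem_weakGraph hf) hg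

theorem norm_le_of_norm_sq_eq_inner {H : Type*} [NormedAddCommGroup H] [InnerProductSpace ℂ H]
    {a b : H} (h : inner ℂ a a = (inner ℂ b a : ℂ)) : ‖a‖ ≤ ‖b‖ := by
  have h1 : ‖a‖ ^ 2 = ‖(inner ℂ b a : ℂ)‖ := by
    rw [← h, inner_self_eq_norm_sq_to_K]; simp
  have h2 := norm_inner_le_norm (𝕜 := ℂ) b a
  by_contra! hlt
  nlinarith [norm_nonneg b]

/-- The a priori estimate on `Dom(𝒟_l^*) ∩ Dom(𝒟_{l+1})`. -/
theorem norm_sq_le_adjoint_add {u : L2 (p + 1) (q + 1)} (h : u ∈ (weakD (p + 1) q)†.domain)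
    (h' : u ∈ (weakD p (q + 1)).domain) :
    ‖u‖ ^ 2 ≤ ‖(weakD (p + 1) q)† ⟨u, h⟩‖ ^ 2 + ‖weakD p (q + 1) ⟨u, h'⟩‖ ^ 2 := by
  -- The estimate for smooth functions applies to the polynomial `g` that represents the projection
  -- of `u`. The bound `n + 1` leaves room for `𝒟` to lower the degree.
  have hn : ∀ n, ‖(polyLp (𝒱 (p + 1) (q + 1)) (n + 1)).starProjection u‖ ^ 2 ≤
      ‖(weakD (p + 1) q)† ⟨u, h⟩‖ ^ 2 + ‖weakD p (q + 1) ⟨u, h'⟩‖ ^ 2 := by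
    intro n
    set K := polyLp (𝒱 (p + 1) (q + 1)) (n + 1)
    obtain ⟨⟨g, hg⟩, hgu⟩ : K.starProjection u ∈ K := Submodule.starProjection_apply_mem K u
    have tg := hasTemperateGrowth_of_mem_polySub hg
    change temperateToLp g tg = K.starProjection u at hgu
    have hproj : ∀ {w : EuclideanSpace ℝ (Fin 6) → 𝒱 (p + 1) (q + 1)}
        (hw : w ∈ polySub _ (n + 1)) (tw : w.HasTemperateGrowth),
        inner ℂ (temperateToLp g tg) (temperateToLp w tw) = inner ℂ u (temperateToLp w tw) := by
      intro w hw tw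
      have hw' : temperateToLp w tw ∈ K := ⟨⟨w, hw⟩, rfl⟩
      rw [hgu, Submodule.inner_starProjection_left_eq_right,
        Submodule.starProjection_eq_self_iff.2 hw']
    have tD := hasTemperateGrowth_diffOp tg
    have tΘ := hasTemperateGrowth_formalAdj tg
    -- `‖𝒟g‖² = ⟨g, Θ𝒟g⟩ = ⟨u, Θ𝒟g⟩ = ⟨𝒟u, 𝒟g⟩`, because `Θ𝒟g` lies in the space projected to.
    have hD : ‖temperateToLp _ tD‖ ≤ ‖weakD p (q + 1) ⟨u, h'⟩‖ := by
      refine norm_le_of_norm_sq_eq_inner ?_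
      rw [inner_temperateToLp_diffOp tg tD,
        hproj (formalAdj_mem_polySub (diffOp_mem_polySub hg))]
      exact (inner_toLp_of_mem_weakGraph (mem_weakGraph ⟨u, h'⟩) tD).symm
    -- Likewise `‖Θg‖² = ⟨g, 𝒟Θg⟩ = ⟨u, 𝒟Θg⟩ = ⟨𝒟^*u, Θg⟩`.
    have hΘ : ‖temperateToLp _ tΘ‖ ≤ ‖(weakD (p + 1) q)† ⟨u, h⟩‖ := by
      refine norm_le_of_norm_sq_eq_inner ?_
      obtain ⟨h1, h2⟩ := exists_weakD_eq (temperate_mem_weakGraph tΘ)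
      have h3 := LinearPMap.adjoint_isFormalAdjoint (weakD_dense (p + 1) q) ⟨u, h⟩
        ⟨temperateToLp _ tΘ, h1⟩
      rw [h2] at h3
      rw [h3, ← hproj (diffOp_mem_polySub (formalAdj_mem_polySub hg)), ← inner_conj_symm,
        ← inner_conj_symm (temperateToLp g tg), inner_temperateToLp_diffOp tΘ tg]
    have h4 := integral_norm_sq_le tg
    rw [← norm_temperateToLp_sq tg, ← norm_temperateToLp_sq tΘ, ← norm_temperateToLp_sq tD] at h4
    have h5 : ‖temperateToLp g tg‖ ^ 2 ≤
        ‖(weakD (p + 1) q)† ⟨u, h⟩‖ ^ 2 + ‖weakD p (q + 1) ⟨u, h'⟩‖ ^ 2 :=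
      h4.trans (add_le_add (pow_le_pow_left₀ (norm_nonneg _) hΘ 2)
        (pow_le_pow_left₀ (norm_nonneg _) hD 2))
    rwa [hgu] at h5
  have hlim := ((tendsto_starProjection_polyLp u).comp (Filter.tendsto_add_atTop_nat 1)).norm.pow 2
  exact le_of_tendsto' hlim hn

end WeakOperators

/-! ### The top degree and the conclusion. -/

theorem hodgeLaplacian_eq {p l : ℕ} (h : l = 2 → 0 < p) :
    hodgeLaplacian p l = pcomp (weakD (p + 1) l) (weakD (p + 1) l)† +
      pcomp (weakD p (l + 1))† (weakD p (l + 1)) := by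
  rw [hodgeLaplacian]
  split_ifs with hl
  swap
  · rfl
  subst hl
  obtain ⟨p, rfl⟩ := Nat.exists_eq_succ_of_ne_zero (h rfl).ne'
  -- The extra summand factors through functions with values in `𝒱_4 = 0`, so it is everywhere
  -- defined and zero: adding it changes neither domain nor values.
  have hz : ∀ u : L2 (p + 1) 4, u = 0 := fun u => by
    rw [Lp.eq_zero_iff_ae_eq_zero]
    exact Filter.Eventually.of_forall fun x => Subsingleton.elim (α := 𝒱 (p + 1) 4) _ _
  have hdom : ∀ f, f ∈ (weakD (p + 1) 3).domain := fun f =>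
    (exists_weakD_eq (u := 0) fun g hg => by
      have hg0 : g = 0 := funext fun x => Subsingleton.elim (α := 𝒱 (p + 1) 4) _ _
      have h1 : formalAdj (p + 1) 3 g = 0 := by
        subst hg0
        ext1 x
        simp [formalAdj]
      rw [toLp_eq_zero hg.memLp hg0, toLp_eq_zero hg.formalAdj.memLp h1, inner_zero_right,
        inner_zero_right]).1
  have h0 : ∀ x, weakD (p + 1) 3 x = 0 := fun x => hz _
  have hall : ∀ f, f ∈ (pcomp (weakD (p + 1) 3)† (weakD (p + 1) 3)).domain := fun f =>
    (mem_pcomp_domain _ _ _).2 ⟨hdom f, by rw [h0]; exact zero_mem _⟩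
  refine LinearPMap.ext (Submodule.ext fun f => ?_) fun f h1 h2 => ?_
  · exact ⟨fun h => ⟨h, hall f⟩, fun h => h.1⟩
  · have hv : ∀ y : (weakD (p + 1) 3)†.domain, (y : L2 (p + 1) 4) = 0 →
        (weakD (p + 1) 3)† y = 0 := fun y hy => by
      rw [show y = 0 from Subtype.ext hy, LinearPMap.map_zero]
    have h3 : pcomp (weakD (p + 1) 3)† (weakD (p + 1) 3) ⟨f, hall f⟩ = 0 := hv _ (h0 _)
    rw [LinearPMap.add_apply]
    exact (add_zero _).symm.trans (congrArg _ h3.symm)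

end Massless

end

theorem mainTheorem1 (k : ℕ) (hk : 6 ≤ k) :
    ∃ C : ℝ, 0 < C ∧ ∀ l p : ℕ, l ≤ 2 → p + l + 2 = k →
      ∃ N : Massless.L2 (p + 1) (l + 1) →L[ℂ] Massless.L2 (p + 1) (l + 1),
        Massless.IsBoundedInverse (Massless.hodgeLaplacian p l) N ∧
        IsSelfAdjoint N ∧
        (∀ f, ‖N f‖ ≤ C * ‖f‖) ∧
        ∀ f : Massless.L2 (p + 1) (l + 1),
          ∃ (h₁ : N f ∈ (Massless.weakD (p + 1) l)†.domain)
            (h₂ : N f ∈ (Massless.weakD p (l + 1)).domain),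
            ‖(Massless.weakD (p + 1) l)† ⟨N f, h₁⟩‖ ≤ C * ‖f‖ ∧
            ‖Massless.weakD p (l + 1) ⟨N f, h₂⟩‖ ≤ C * ‖f‖ ∧
            ∀ hf : f ∈ (Massless.weakD p (l + 1)).domain, Massless.weakD p (l + 1) ⟨f, hf⟩ = 0 →
              (∃ h₃ : (Massless.weakD (p + 1) l)† ⟨N f, h₁⟩ ∈ (Massless.weakD (p + 1) l).domain,
                Massless.weakD (p + 1) l ⟨(Massless.weakD (p + 1) l)† ⟨N f, h₁⟩, h₃⟩ = f) ∧
              ∀ v : (Massless.weakD (p + 1) l).domain, Massless.weakD (p + 1) l v = 0 →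
                inner ℂ (v : Massless.L2 (p + 1 + 1) l)
                  ((Massless.weakD (p + 1) l)† ⟨N f, h₁⟩) = 0 := by
  -- The a priori estimate has constant `1`, whatever `k` is. The size of `k` enters only in top
  -- degree: for `l = 2` it gives `p = k - 4 > 0`, as the vanishing of `𝒱_4` requires.
  refine ⟨1, one_pos, fun l p hl hp => ?_⟩
  rw [Massless.hodgeLaplacian_eq (fun h => by omega)]
  simp only [one_mul]
  exact Massless.exists_hodge_solution (Massless.weakD_dense _ _) (Massless.weakD_dense _ _)
    Massless.weakD_isClosed Massless.weakD_isClosed Massless.weakD_weakD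
    fun u h h' => Massless.norm_sq_le_adjoint_add h h'
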